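/- Let $d,t\ge 2$ be integers. A system of affine-linear forms $\Psi=(\psi_1,\dots,\psi_t):\mathbb Z^d\to\mathbb Z^t$ has linear coefficients $\dot\psi_i(e_j)\in\mathbb Z$ and constant coefficients $\psi_i(0)\in\mathbb Z$. For a prime $p$ put $\Lambda_p(b)=\frac{p}{p-1}$ if $p\nmid b$ and $\Lambda_p(b)=0$ otherwise, and let $$\beta_p=\frac1{p^d}\sum_{a\in(\mathbb Z/p\mathbb Z)^d}\ \prod_{i=1}^t\Lambda_p(\psi_i(a)).$$ Call $\Psi$ \emph{admissible} if no $\psi_i$ is of the form $\lambda\psi_j+\mu$ with $j\ne i$ and $\lambda,\mu\in\mathbb Q$, and $\beta_p\neq0$ for every prime $p$. Let $P_\Psi$ be the set of exceptional primes, i.e. the primes $p$ such that, modulo $p$, some $\psi_i$ is of the form $\lambda\psi_j+\mu$ with $j\neq i$ and $\lambda,\mu\in\mathbb Z/p\mathbb Z$. For real $Z>1$ and $B>0$ let $$\|\Psi\|_{Z,B}=\frac1{\log^BZ}\Big(\sum_{i}\Big|\frac{\psi_i(0)}Z\Big|+\sum_{i,j}|\dot\psi_i(e_j)|\Big).$$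 For a smooth function $\chi:\mathbb R\to\mathbb R$ of bounded support and $R>1$ let $$\Lambda_{\chi,R}(n)=\log R\,\Big(\sum_{m\mid n}\mu(m)\,\chi\Big(\frac{\log m}{\log R}\Big)\Big)^2\qquad(n\in\mathbb Z),$$ the sum being over positive divisors $m$ of $n$ (all positive integers if $n=0$), and let $c_\chi=\int_0^\infty\chi'(x)^2\,dx$. Write $[Z]=\{n\in\mathbb Z:1\le n\le Z\}$. (a) For all $B,L>0$ there are constants $C,Z_0$, depending only on $d,t,B,L$, such that for every $Z\ge Z_0$ and every admissible $\Psi$ with $\|\Psi\|_{Z,B}\le L$ the set $P_\Psi$ is finite and $\sum_{p\in P_\Psi}p^{-1/2}\le C\sqrt{\log\log Z}$. (b) For every $S>0$ there is $\gamma_0=\gamma_0(d,t,S)>0$ with the following property. Let $0<\gamma<\gamma_0$, let $\chi$ be smooth and supported on $[-S,S]$ with $\chi(0)=1$, and let $A,B,L>0$. Let $N\to\infty$, put $R=N^\gamma$, and let $Z$ be real with $N\log^{-A}N\le Z\le N\log^AN$. Then, for $N$ large enough, for every admissible $\Psi$ with $\|\Psi\|_{Z,B}\le L$ the product $\prod_p\beta_p$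 converges (unconditionally) to a positive real number, and $$\sum_{n\in[Z]^d}\ \prod_{i=1}^t\Lambda_{\chi,R}(\psi_i(n))=c_\chi^{\,t}\,Z^d\prod_p\beta_p\,(1+o(1)),$$ where the $o(1)$ is as $N\to\infty$, uniformly in $\Psi$ and $Z$, for fixed $d,t,S,\gamma,\chi,A,B,L$. In particular, if $c_\chi=1$, the right-hand side is $Z^d\prod_p\beta_p(1+o(1))$. -/

import Mathlib

open scoped ContDiff

noncomputable section

/-- A system `Ψ = (ψ₁, …, ψ_t) : ℤ^d → ℤ^t` of affine-linear forms, given by its linear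
coefficients `lin i j = ψ̇_i(e_j)` and its constant coefficients `const i = ψ_i(0)`. -/
structure AffineSystem (d t : ℕ) where
  lin : Fin t → Fin d → ℤ
  const : Fin t → ℤ

namespace AffineSystem

variable {d t : ℕ}

/-- The form `ψ_i` read over a commutative ring `K`: for `K = ℤ` it is `ψ_i` itself, for
`K = ZMod p` its reduction modulo `p`. -/
def form (Ψ : AffineSystem d t) (K : Type*) [CommRing K] (i : Fin t) (n : Fin d → K) : K :=
  ∑ j, (Ψ.lin i j : K) * n j + (Ψ.const i : K)

/-- Over `K`, the form `ψ_i` lies in the affine-linear span of `ψ_j`. -/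
def InAffineSpan (Ψ : AffineSystem d t) (K : Type*) [CommRing K] (i j : Fin t) : Prop :=
  ∃ a b : K, ∀ n : Fin d → K, Ψ.form K i n = a * Ψ.form K j n + b

/-- No form is in the (rational) affine-linear span of another one. -/
def FiniteComplexity (Ψ : AffineSystem d t) : Prop :=
  ∀ i j : Fin t, i ≠ j → ¬ Ψ.InAffineSpan ℚ i j

/-- The size `‖Ψ‖_{N,B}` of the system at scale `(N, B)`. -/
def size (Ψ : AffineSystem d t) (N B : ℝ) : ℝ :=
  1 / Real.log N ^ B *
    (∑ i, |(Ψ.const i : ℝ) / N| + ∑ i, ∑ j, |(Ψ.lin i j : ℝ)|)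

/-- The primes modulo which some form is in the affine-linear span of another one. -/
def exceptionalPrimes (Ψ : AffineSystem d t) : Set ℕ :=
  {p | p.Prime ∧ ∃ i j : Fin t, i ≠ j ∧ Ψ.InAffineSpan (ZMod p) i j}

end AffineSystem

open Classical in
/-- `Λ_q(b) = (q / φ(q)) 1_{(b, q) = 1}` for a residue class `b` modulo `q`. -/
def localVonMangoldt (q : ℕ) (b : ZMod q) : ℝ :=
  if IsUnit b then (q : ℝ) / (Nat.totient q : ℝ) else 0

instance neZeroOfPrimes (p : Nat.Primes) : NeZero (p : ℕ) := ⟨p.2.ne_zero⟩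

namespace AffineSystem

variable {d t : ℕ}

/-- The local factor `β_p`, the average over `a ∈ (ℤ/pℤ)^d` of `∏_i Λ_p(ψ_i(a))`. -/
def localFactor (Ψ : AffineSystem d t) (p : Nat.Primes) : ℝ :=
  (∑ a : Fin d → ZMod (p : ℕ), ∏ i, localVonMangoldt p (Ψ.form (ZMod (p : ℕ)) i a)) /
    ((p : ℕ) : ℝ) ^ d

/-- Finite complexity and no vanishing local factor. -/
def Admissible (Ψ : AffineSystem d t) : Prop :=
  Ψ.FiniteComplexity ∧ ∀ p : Nat.Primes, Ψ.localFactor p ≠ 0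

end AffineSystem

/-- `Λ_{χ,R}(n) = log R (∑_{m ∣ n} μ(m) χ(log m / log R))²`, where `m` runs over the positive
divisors of the integer `n`. Every positive integer divides `0`; the sum is still finite when
`χ` has bounded support and `R > 1`. -/
def truncatedDivisorSum (χ : ℝ → ℝ) (R : ℝ) (n : ℤ) : ℝ :=
  Real.log R *
    (∑ᶠ m ∈ {m : ℕ | 0 < m ∧ (m : ℤ) ∣ n},
      (ArithmeticFunction.moebius m : ℝ) * χ (Real.log m / Real.log R)) ^ 2

/-- The box `[Z]^d`, where `[Z]` is the set of integers `1 ≤ n ≤ Z`. -/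
def intBox (d : ℕ) (Z : ℝ) : Finset (Fin d → ℤ) :=
  Fintype.piFinset fun _ => Finset.Icc 1 ⌊Z⌋

end

/-!
Expanding the squares, the correlation sum becomes a sum over squarefree moduli of size at most a
small power of `N`, on which the box `[Z]^d` is equidistributed; this reduces it to a mean over
residues. Writing `χ(x) = ∫ φ(v) e^{-(1 - 2πiv)x} dv` with `φ` rapidly decaying, that mean is the
integral of a twisted Euler product. Its factor at `p` is, up to a factor which tends to `β_p` as
the twists go to `0`, the Euler factor of a product of ratios
`ζ(1 + z) ζ(1 + z') / ζ(1 + z + z')`, inverted, with `z` and `z'` of size `1 / log R`. The pole of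
`ζ` at `1` gives the main term: what is left of the integral factors into `t` copies of
`∫∫ φ φ' s s' / (s + s') = c_χ`.

The error in replacing the twisted factors by the `β_p` is at most
`exp(O(1 + ∑_{p ∈ P_Ψ} p^{-1/2})) / √(log R)`. An exceptional prime divides a nonzero product of
`2 × 2` minors of the linear parts, which is at most a power of `log Z`; such an integer has
`O(log log Z)` prime factors, so `∑_{p ∈ P_Ψ} p^{-1/2} = O(√(log log Z))` and the error is `o(1)`.
-/

open scoped BigOperators

/-! ### Sums of `p ^ (-1/2)` over prime divisors -/

theorem rpow_neg_half_eq {x : ℝ} (hx : 0 ≤ x) : x ^ (-(1 / 2) : ℝ) = 1 / √x := by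
  rw [Real.rpow_neg hx, ← Real.sqrt_eq_rpow, one_div]

theorem sum_Icc_rpow_neg_half_le (k : ℕ) :
    ∑ n ∈ Finset.Icc 1 k, (n : ℝ) ^ (-(1 / 2) : ℝ) ≤ 2 * √k := by
  induction k with
  | zero => simp
  | succ k ih =>
    have telescope : 1 / √((k + 1 : ℕ) : ℝ) ≤ 2 * √((k + 1 : ℕ) : ℝ) - 2 * √(k : ℝ) := by
      rw [div_le_iff₀ (Real.sqrt_pos.2 (by positivity))]
      have hsucc : √((k + 1 : ℕ) : ℝ) ^ 2 = k + 1 := by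
        rw [Real.sq_sqrt (by positivity), Nat.cast_succ]
      have hk : √(k : ℝ) ^ 2 = k := Real.sq_sqrt (by positivity)
      nlinarith [sq_nonneg (√((k + 1 : ℕ) : ℝ) - √(k : ℝ))]
    rw [Finset.sum_Icc_succ_top (by omega), rpow_neg_half_eq (by positivity)]
    linarith

theorem sum_rpow_neg_half_le_sqrt_card (s : Finset ℕ) (hs : ∀ n ∈ s, 0 < n) :
    ∑ n ∈ s, (n : ℝ) ^ (-(1 / 2) : ℝ) ≤ 3 * √s.card := by
  rcases s.eq_empty_or_nonempty with rfl | hne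
  · simp
  have hcard : (0 : ℝ) < s.card := by exact_mod_cast hne.card_pos
  have small : ∑ n ∈ s with n ≤ s.card, (n : ℝ) ^ (-(1 / 2) : ℝ) ≤ 2 * √s.card := by
    refine le_trans (Finset.sum_le_sum_of_subset_of_nonneg (fun n hn => ?_)
      fun _ _ _ => by positivity) (sum_Icc_rpow_neg_half_le _)
    rw [Finset.mem_filter] at hn
    exact Finset.mem_Icc.2 ⟨hs n hn.1, hn.2⟩
  have large : ∑ n ∈ s with ¬ n ≤ s.card, (n : ℝ) ^ (-(1 / 2) : ℝ) ≤ √s.card :=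
    calc ∑ n ∈ s with ¬ n ≤ s.card, (n : ℝ) ^ (-(1 / 2) : ℝ)
        ≤ ∑ n ∈ s with ¬ n ≤ s.card, (s.card : ℝ) ^ (-(1 / 2) : ℝ) := by
          refine Finset.sum_le_sum fun n hn => ?_
          have hn : s.card < n := not_le.1 (Finset.mem_filter.1 hn).2
          exact Real.rpow_le_rpow_of_nonpos hcard (by exact_mod_cast hn.le) (by norm_num)
      _ ≤ s.card * (1 / √s.card) := by
          rw [Finset.sum_const, nsmul_eq_mul, rpow_neg_half_eq hcard.le]
          gcongr
          exact Finset.filter_subset _ _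
      _ = √s.card := by rw [mul_one_div, Real.div_sqrt]
  linarith [Finset.sum_filter_add_sum_filter_not s (fun n => n ≤ s.card)
    fun n => (n : ℝ) ^ (-(1 / 2) : ℝ)]

theorem card_primeFactors_le_two_mul_log {n : ℕ} (hn : n ≠ 0) :
    (n.primeFactors.card : ℝ) ≤ 2 * Real.log n := by
  have two_pow_le : 2 ^ n.primeFactors.card ≤ n :=
    calc 2 ^ n.primeFactors.card ≤ ∏ p ∈ n.primeFactors, p := by
          rw [← Finset.prod_const]
          exact Finset.prod_le_prod' fun p hp => (Nat.prime_of_mem_primeFactors hp).two_le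
      _ ≤ n := Nat.le_of_dvd (Nat.pos_of_ne_zero hn) (Nat.prod_primeFactors_dvd n)
  have log_le : Real.log ((2 : ℝ) ^ n.primeFactors.card) ≤ Real.log n :=
    Real.log_le_log (by positivity) (by exact_mod_cast two_pow_le)
  rw [Real.log_pow] at log_le
  nlinarith [Real.log_two_gt_d9, (Nat.cast_nonneg n.primeFactors.card : (0 : ℝ) ≤ _)]

theorem sum_primeFactors_rpow_neg_half_le {n : ℕ} (hn : n ≠ 0) :
    ∑ p ∈ n.primeFactors, (p : ℝ) ^ (-(1 / 2) : ℝ) ≤ 3 * √(2 * Real.log n) :=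
  calc ∑ p ∈ n.primeFactors, (p : ℝ) ^ (-(1 / 2) : ℝ) ≤ 3 * √n.primeFactors.card :=
        sum_rpow_neg_half_le_sqrt_card _ fun _ hp => (Nat.prime_of_mem_primeFactors hp).pos
    _ ≤ 3 * √(2 * Real.log n) := by gcongr; exact card_primeFactors_le_two_mul_log hn

/-! ### Minors and exceptional primes -/

namespace AffineSystem

variable {d t : ℕ} {Ψ : AffineSystem d t} {i j : Fin t}

/-- The `2 × 2` minor, in the columns `k` and `l`, of the matrix whose rows are the linear parts
of `ψ_i` and `ψ_j`. The pair `ψ_i`, `ψ_j` is degenerate over a field exactly when all its minors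
vanish there, so the exceptional primes are found among the divisors of nonzero minors. -/
def minor (Ψ : AffineSystem d t) (i j : Fin t) (k l : Fin d) : ℤ :=
  Ψ.lin i k * Ψ.lin j l - Ψ.lin i l * Ψ.lin j k

theorem inAffineSpan_iff_exists_lin_eq {K : Type*} [CommRing K] :
    Ψ.InAffineSpan K i j ↔ ∃ a : K, ∀ k, (Ψ.lin i k : K) = a * (Ψ.lin j k : K) := by
  constructor
  · rintro ⟨a, b, h⟩
    refine ⟨a, fun k => ?_⟩
    have at_zero := h 0
    have at_single := h (Pi.single k 1)
    simp only [form, Pi.zero_apply, mul_zero, Finset.sum_const_zero, zero_add] at at_zero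
    simp only [form, Pi.single_apply, mul_ite, mul_one, mul_zero, Finset.sum_ite_eq',
      Finset.mem_univ, if_true] at at_single
    linear_combination at_single - at_zero
  · rintro ⟨a, h⟩
    refine ⟨a, Ψ.const i - a * Ψ.const j, fun n => ?_⟩
    simp only [form, h, mul_add, Finset.mul_sum, mul_assoc]
    ring

theorem InAffineSpan.minor_eq_zero {K : Type*} [CommRing K] (h : Ψ.InAffineSpan K i j)
    (k l : Fin d) : (Ψ.minor i j k l : K) = 0 := by
  obtain ⟨a, h⟩ := inAffineSpan_iff_exists_lin_eq.1 h
  simp only [minor, Int.cast_sub, Int.cast_mul, h]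
  ring

theorem exists_minor_ne_zero {K : Type*} [Field K] (hij : ¬ Ψ.InAffineSpan K i j)
    (hji : ¬ Ψ.InAffineSpan K j i) : ∃ k l, (Ψ.minor i j k l : K) ≠ 0 := by
  obtain ⟨l, hl⟩ : ∃ l, (Ψ.lin j l : K) ≠ 0 := by
    by_contra! h
    exact hji (inAffineSpan_iff_exists_lin_eq.2 ⟨0, fun k => by simp [h]⟩)
  by_contra! hm
  refine hij (inAffineSpan_iff_exists_lin_eq.2 ⟨(Ψ.lin i l : K) / Ψ.lin j l, fun k => ?_⟩)
  have hkl := hm k l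
  simp only [minor, Int.cast_sub, Int.cast_mul] at hkl
  field_simp
  linear_combination hkl

theorem natAbs_minor_le {M : ℝ} (h : ∀ i k, |(Ψ.lin i k : ℝ)| ≤ M) (i j : Fin t) (k l : Fin d) :
    ((Ψ.minor i j k l).natAbs : ℝ) ≤ 2 * M ^ 2 := by
  have hM : 0 ≤ M := (abs_nonneg _).trans (h i k)
  rw [Nat.cast_natAbs, Int.cast_abs, minor, Int.cast_sub, Int.cast_mul, Int.cast_mul]
  calc |(Ψ.lin i k : ℝ) * Ψ.lin j l - Ψ.lin i l * Ψ.lin j k|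
      ≤ |(Ψ.lin i k : ℝ)| * |(Ψ.lin j l : ℝ)| + |(Ψ.lin i l : ℝ)| * |(Ψ.lin j k : ℝ)| := by
        rw [← abs_mul, ← abs_mul]; exact abs_sub _ _
    _ ≤ M * M + M * M := by gcongr <;> exact h _ _
    _ = 2 * M ^ 2 := by ring

theorem FiniteComplexity.exists_multiple_of_exceptionalPrimes (h : Ψ.FiniteComplexity) :
    ∃ D : ℕ, D ≠ 0 ∧ (∀ p ∈ Ψ.exceptionalPrimes, p ∣ D) ∧
      ∀ M : ℝ, 1 ≤ M → (∀ i k, |(Ψ.lin i k : ℝ)| ≤ M) → (D : ℝ) ≤ (2 * M ^ 2) ^ (t * t) := by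
  have pair : ∀ i j : Fin t, ∃ m : ℕ, m ≠ 0 ∧
      (i ≠ j → ∀ p : ℕ, Ψ.InAffineSpan (ZMod p) i j → p ∣ m) ∧
      ∀ M : ℝ, 1 ≤ M → (∀ i k, |(Ψ.lin i k : ℝ)| ≤ M) → (m : ℝ) ≤ 2 * M ^ 2 := by
    intro i j
    rcases eq_or_ne i j with rfl | hij
    · refine ⟨1, one_ne_zero, fun hne => absurd rfl hne, fun M hM _ => ?_⟩
      rw [Nat.cast_one]
      nlinarith
    · obtain ⟨k, l, hkl⟩ := exists_minor_ne_zero (h i j hij) (h j i hij.symm)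
      refine ⟨(Ψ.minor i j k l).natAbs, Int.natAbs_ne_zero.2 (by exact_mod_cast hkl),
        fun _ p hp => ?_, fun M _ hlin => natAbs_minor_le hlin i j k l⟩
      exact Int.natCast_dvd.1 ((ZMod.intCast_zmod_eq_zero_iff_dvd _ _).1 (hp.minor_eq_zero k l))
  choose m hm0 hdvd hle using pair
  refine ⟨∏ q : Fin t × Fin t, m q.1 q.2, Finset.prod_ne_zero_iff.2 fun q _ => hm0 _ _, ?_, ?_⟩
  · rintro p ⟨-, i, j, hij, hspan⟩
    exact (hdvd i j hij p hspan).trans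
      (Finset.dvd_prod_of_mem (fun q : Fin t × Fin t => m q.1 q.2) (Finset.mem_univ (i, j)))
  · intro M hM hlin
    rw [Nat.cast_prod]
    refine (Finset.prod_le_prod (fun _ _ => Nat.cast_nonneg _)
      fun q _ => hle q.1 q.2 M hM hlin).trans_eq ?_
    simp

/-- The sum of `p ^ (-1/2)` over the exceptional primes: the measure of the damage they do. -/
noncomputable def exceptionalSum (Ψ : AffineSystem d t) : ℝ :=
  ∑' p : Ψ.exceptionalPrimes, ((p : ℕ) : ℝ) ^ (-(1 / 2) : ℝ)

theorem exceptionalSum_nonneg (Ψ : AffineSystem d t) : 0 ≤ Ψ.exceptionalSum :=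
  tsum_nonneg fun _ => by positivity

theorem FiniteComplexity.finite_exceptionalPrimes (h : Ψ.FiniteComplexity) :
    Ψ.exceptionalPrimes.Finite := by
  obtain ⟨D, hD, hdvd, -⟩ := h.exists_multiple_of_exceptionalPrimes
  exact (Finset.finite_toSet D.primeFactors).subset fun p hp =>
    Nat.mem_primeFactors.2 ⟨hp.1, hdvd p hp, hD⟩

theorem exceptionalSum_eq_sum (h : Ψ.exceptionalPrimes.Finite) :
    Ψ.exceptionalSum = ∑ p ∈ h.toFinset, (p : ℝ) ^ (-(1 / 2) : ℝ) := by
  rw [exceptionalSum, ← Finset.tsum_subtype' h.toFinset fun p : ℕ => (p : ℝ) ^ (-(1 / 2) : ℝ),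
    h.coe_toFinset]

theorem FiniteComplexity.exceptionalSum_le {M : ℝ} (h : Ψ.FiniteComplexity) (hM : 1 ≤ M)
    (hlin : ∀ i k, |(Ψ.lin i k : ℝ)| ≤ M) :
    Ψ.exceptionalSum ≤ 3 * √(2 * (t * t * Real.log (2 * M ^ 2))) := by
  obtain ⟨D, hD, hdvd, hle⟩ := h.exists_multiple_of_exceptionalPrimes
  have hlog : Real.log D ≤ t * t * Real.log (2 * M ^ 2) := by
    refine (Real.log_le_log (by positivity) (hle M hM hlin)).trans_eq ?_
    rw [Real.log_pow, Nat.cast_mul]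
  calc Ψ.exceptionalSum
      = ∑ p ∈ h.finite_exceptionalPrimes.toFinset, (p : ℝ) ^ (-(1 / 2) : ℝ) :=
        exceptionalSum_eq_sum _
    _ ≤ ∑ p ∈ D.primeFactors, (p : ℝ) ^ (-(1 / 2) : ℝ) := by
        refine Finset.sum_le_sum_of_subset_of_nonneg (fun p hp => ?_) fun _ _ _ => by positivity
        have hp := h.finite_exceptionalPrimes.mem_toFinset.1 hp
        exact Nat.mem_primeFactors.2 ⟨hp.1, hdvd p hp, hD⟩
    _ ≤ 3 * √(2 * Real.log D) := sum_primeFactors_rpow_neg_half_le hD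
    _ ≤ 3 * √(2 * (t * t * Real.log (2 * M ^ 2))) := by gcongr

theorem abs_lin_le_of_size_le {Z B L : ℝ} (hZ : 1 < Z) (h : Ψ.size Z B ≤ L) (i : Fin t)
    (k : Fin d) : |(Ψ.lin i k : ℝ)| ≤ L * Real.log Z ^ B := by
  have hlog : 0 < Real.log Z ^ B := Real.rpow_pos_of_pos (Real.log_pos hZ) _
  rw [size, one_div, inv_mul_le_iff₀ hlog, mul_comm] at h
  have lin_le_sum : |(Ψ.lin i k : ℝ)| ≤ ∑ i, ∑ j, |(Ψ.lin i j : ℝ)| :=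
    (Finset.single_le_sum (f := fun j => |(Ψ.lin i j : ℝ)|) (fun _ _ => abs_nonneg _)
      (Finset.mem_univ k)).trans
      (Finset.single_le_sum (f := fun i => ∑ j, |(Ψ.lin i j : ℝ)|)
        (fun _ _ => Finset.sum_nonneg fun _ _ => abs_nonneg _) (Finset.mem_univ i))
  have const_nonneg : 0 ≤ ∑ i, |(Ψ.const i : ℝ) / Z| := Finset.sum_nonneg fun _ _ => abs_nonneg _
  linarith

theorem exists_exceptionalSum_le_mul_sqrt_log_log (d t : ℕ) {B L : ℝ} (hB : 0 < B) (hL : 0 < L) :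
    ∃ C Z₀ : ℝ, 0 ≤ C ∧ ∀ Z : ℝ, Z₀ ≤ Z →
      ∀ Ψ : AffineSystem d t, Ψ.FiniteComplexity → Ψ.size Z B ≤ L →
        Ψ.exceptionalSum ≤ C * √(Real.log (Real.log Z)) := by
  set b : ℝ := Real.log (2 * (1 + L) ^ 2)
  have hb : 0 ≤ b := Real.log_nonneg (by nlinarith)
  refine ⟨3 * √(2 * (t * t * (b + 2 * B))), Real.exp (Real.exp 1), by positivity,
    fun Z hZ Ψ hΨ hsize => ?_⟩
  have hZ1 : 1 < Z := (Real.one_lt_exp_iff.2 (Real.exp_pos 1)).trans_le hZ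
  have hlog : Real.exp 1 ≤ Real.log Z := (Real.le_log_iff_exp_le (by linarith)).2 hZ
  have hlog_pos : 0 < Real.log Z := (Real.exp_pos 1).trans_le hlog
  have hloglog : 1 ≤ Real.log (Real.log Z) := (Real.le_log_iff_exp_le hlog_pos).2 hlog
  have hpow : 1 ≤ Real.log Z ^ B :=
    Real.one_le_rpow ((Real.one_lt_exp_iff.2 one_pos).le.trans hlog) hB.le
  have hlin : ∀ i k, |(Ψ.lin i k : ℝ)| ≤ (1 + L) * Real.log Z ^ B := fun i k =>
    (abs_lin_le_of_size_le hZ1 hsize i k).trans (by gcongr; linarith)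
  have hlogM : Real.log (2 * ((1 + L) * Real.log Z ^ B) ^ 2) ≤
      (b + 2 * B) * Real.log (Real.log Z) := by
    rw [mul_pow, ← mul_assoc, Real.log_mul (by positivity) (by positivity), Real.log_pow,
      Real.log_rpow hlog_pos, Nat.cast_two]
    nlinarith
  calc Ψ.exceptionalSum
      ≤ 3 * √(2 * (t * t * Real.log (2 * ((1 + L) * Real.log Z ^ B) ^ 2))) :=
        hΨ.exceptionalSum_le (by nlinarith) hlin
    _ ≤ 3 * √(2 * (t * t * ((b + 2 * B) * Real.log (Real.log Z)))) := by gcongr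
    _ = 3 * √(2 * (t * t * (b + 2 * B))) * √(Real.log (Real.log Z)) := by
        rw [mul_assoc 3, ← Real.sqrt_mul (by positivity)]
        ring_nf

end AffineSystem

/-! ### Elementary estimates for finite products -/

section FiniteProducts

variable {ι 𝕜 : Type*} [NormedField 𝕜]

theorem norm_prod_le_prod_of_le (s : Finset ι) {a : ι → 𝕜} {m : ι → ℝ}
    (ha : ∀ i ∈ s, ‖a i‖ ≤ m i) : ‖∏ i ∈ s, a i‖ ≤ ∏ i ∈ s, m i := by
  rw [norm_prod]
  exact Finset.prod_le_prod (fun _ _ => norm_nonneg _) ha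

theorem norm_prod_sub_prod_le (s : Finset ι) {a b : ι → 𝕜} {m : ι → ℝ} (hm : ∀ i ∈ s, 1 ≤ m i)
    (ha : ∀ i ∈ s, ‖a i‖ ≤ m i) (hb : ∀ i ∈ s, ‖b i‖ ≤ m i) :
    ‖∏ i ∈ s, a i - ∏ i ∈ s, b i‖ ≤ (∏ i ∈ s, m i) * ∑ i ∈ s, ‖a i - b i‖ := by
  classical
  induction s using Finset.induction_on with
  | empty => simp
  | insert j s hj ih =>
    simp only [Finset.forall_mem_insert] at hm ha hb
    have prod_le : ‖∏ i ∈ s, a i‖ ≤ ∏ i ∈ s, m i := norm_prod_le_prod_of_le s ha.2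
    have prod_nonneg : 0 ≤ ∏ i ∈ s, m i := (norm_nonneg _).trans prod_le
    have hmj : 0 ≤ m j := zero_le_one.trans hm.1
    simp only [Finset.prod_insert hj, Finset.sum_insert hj]
    calc ‖a j * ∏ i ∈ s, a i - b j * ∏ i ∈ s, b i‖
        = ‖(a j - b j) * ∏ i ∈ s, a i + b j * (∏ i ∈ s, a i - ∏ i ∈ s, b i)‖ := by ring_nf
      _ ≤ ‖a j - b j‖ * ‖∏ i ∈ s, a i‖ + ‖b j‖ * ‖∏ i ∈ s, a i - ∏ i ∈ s, b i‖ := by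
          rw [← norm_mul, ← norm_mul]; exact norm_add_le _ _
      _ ≤ ‖a j - b j‖ * (m j * ∏ i ∈ s, m i) +
          m j * ((∏ i ∈ s, m i) * ∑ i ∈ s, ‖a i - b i‖) := by
          gcongr
          · exact prod_le.trans (le_mul_of_one_le_left prod_nonneg hm.1)
          · exact hb.1
          · exact ih hm.2 ha.2 hb.2
      _ = m j * (∏ i ∈ s, m i) * (‖a j - b j‖ + ∑ i ∈ s, ‖a i - b i‖) := by ring

theorem norm_prod_sub_prod_le_pow [Fintype ι] {a b : ι → 𝕜} {M : ℝ} (hM : 1 ≤ M)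
    (ha : ∀ i, ‖a i‖ ≤ M) (hb : ∀ i, ‖b i‖ ≤ M) :
    ‖∏ i, a i - ∏ i, b i‖ ≤ M ^ Fintype.card ι * ∑ i, ‖a i - b i‖ := by
  simpa using norm_prod_sub_prod_le Finset.univ (m := fun _ => M) (fun _ _ => hM)
    (fun i _ => ha i) (fun i _ => hb i)

variable {y : ι → 𝕜} {δ M : ℝ}

theorem norm_prod_one_add_sub_one_le_pow (s : Finset ι) (hM : 1 + δ ≤ M) (hδ : 0 ≤ δ)
    (hy : ∀ i ∈ s, ‖y i‖ ≤ δ) : ‖∏ i ∈ s, (1 + y i) - 1‖ ≤ M ^ s.card * (s.card * δ) := by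
  have hM1 : 1 ≤ M := by linarith
  have h := norm_prod_sub_prod_le s (a := fun i => 1 + y i) (b := fun _ => (1 : 𝕜))
    (m := fun _ => M) (fun _ _ => hM1)
    (fun i hi => (norm_add_le _ _).trans (by rw [norm_one]; linarith [hy i hi]))
    (fun _ _ => by simpa using hM1)
  simp only [Finset.prod_const_one, Finset.prod_const, add_sub_cancel_left] at h
  refine h.trans (mul_le_mul_of_nonneg_left ?_ (by positivity))
  simpa using Finset.sum_le_card_nsmul s _ δ hy

theorem norm_prod_one_add_sub_one_sub_sum_le (s : Finset ι) (hM : 1 + δ ≤ M) (hδ : 0 ≤ δ)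
    (hy : ∀ i ∈ s, ‖y i‖ ≤ δ) :
    ‖∏ i ∈ s, (1 + y i) - 1 - ∑ i ∈ s, y i‖ ≤ s.card ^ 2 * M ^ s.card * δ ^ 2 := by
  classical
  induction s using Finset.induction_on with
  | empty => simp
  | insert j s hj ih =>
    simp only [Finset.forall_mem_insert] at hy
    have hM1 : 1 ≤ M := by linarith
    rw [Finset.prod_insert hj, Finset.sum_insert hj, Finset.card_insert_of_notMem hj]
    calc ‖(1 + y j) * ∏ i ∈ s, (1 + y i) - 1 - (y j + ∑ i ∈ s, y i)‖
        = ‖(∏ i ∈ s, (1 + y i) - 1 - ∑ i ∈ s, y i) + y j * (∏ i ∈ s, (1 + y i) - 1)‖ := by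
          ring_nf
      _ ≤ s.card ^ 2 * M ^ s.card * δ ^ 2 + δ * (M ^ s.card * (s.card * δ)) := by
          refine (norm_add_le _ _).trans (add_le_add (ih hy.2) ?_)
          rw [norm_mul]
          exact mul_le_mul hy.1 (norm_prod_one_add_sub_one_le_pow s hM hδ hy.2) (norm_nonneg _) hδ
      _ = (s.card ^ 2 + s.card : ℝ) * M ^ s.card * δ ^ 2 := by ring
      _ ≤ ((s.card + 1 : ℕ) : ℝ) ^ 2 * M ^ (s.card + 1) * δ ^ 2 := by
          gcongr
          · push_cast; nlinarith [(Nat.cast_nonneg s.card : (0 : ℝ) ≤ _)]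
          · omega

end FiniteProducts

/-! ### Zeros of the forms modulo a prime -/

theorem expect_comp_of_surjective {G H : Type*} [AddCommGroup G] [AddCommGroup H] [Fintype G]
    [Fintype H] (f : G →+ H) (hf : Function.Surjective f) (φ : H → ℝ) :
    𝔼 g, φ (f g) = 𝔼 h, φ h := by
  classical
  set k : ℕ := (Finset.univ.filter fun g => f g = 0).card
  have card_fiber : ∀ h, (Finset.univ.filter fun g => f g = h).card = k := fun h =>
    AddMonoidHom.card_fiber_eq_of_mem_range f (hf h) (hf 0)
  have sum_eq : ∀ ψ : H → ℝ, ∑ g, ψ (f g) = k * ∑ h, ψ h := fun ψ => by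
    rw [Finset.sum_comp ψ f, Finset.image_univ_of_surjective hf, Finset.mul_sum]
    simp only [card_fiber, nsmul_eq_mul]
  have card_eq : (Fintype.card G : ℝ) = k * Fintype.card H := by simpa using sum_eq fun _ => 1
  have hk0 : (k : ℝ) ≠ 0 := fun h0 => by simp [h0] at card_eq
  rw [Fintype.expect_eq_sum_div_card, Fintype.expect_eq_sum_div_card, sum_eq, card_eq,
    mul_div_mul_left _ _ hk0]

namespace AffineSystem

variable {d t : ℕ}

instance (p : Nat.Primes) : Fact (p : ℕ).Prime := ⟨p.2⟩

/-- The linear part of `ψ_i` over `K`. -/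
def linHom (Ψ : AffineSystem d t) (K : Type*) [CommRing K] (i : Fin t) : (Fin d → K) →+ K where
  toFun n := ∑ j, (Ψ.lin i j : K) * n j
  map_zero' := by simp
  map_add' := by intros; simp [mul_add, Finset.sum_add_distrib]

open Classical in
/-- The indicator function of the zeros of `ψ_i` over `K`, taking values in `ℝ`. -/
noncomputable def zeroInd (Ψ : AffineSystem d t) (K : Type*) [CommRing K] (i : Fin t)
    (a : Fin d → K) : ℝ :=
  if Ψ.form K i a = 0 then 1 else 0

section Ring

variable (Ψ : AffineSystem d t) (K : Type*) [CommRing K] (i : Fin t)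

theorem form_eq_zero_iff (n : Fin d → K) :
    Ψ.form K i n = 0 ↔ Ψ.linHom K i n = -(Ψ.const i : K) := by
  rw [eq_neg_iff_add_eq_zero]; rfl

theorem linHom_single (k : Fin d) (c : K) :
    Ψ.linHom K i (Pi.single k c) = (Ψ.lin i k : K) * c := by
  simp [linHom, Pi.single_apply]

theorem zeroInd_nonneg (a : Fin d → K) : 0 ≤ Ψ.zeroInd K i a := by
  unfold zeroInd; split_ifs <;> norm_num

theorem zeroInd_le_one (a : Fin d → K) : Ψ.zeroInd K i a ≤ 1 := by
  unfold zeroInd; split_ifs <;> norm_num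

end Ring

section Field

variable (Ψ : AffineSystem d t) {K : Type*} [Field K] {i j : Fin t} {k l : Fin d}

theorem linHom_surjective (h : (Ψ.lin i k : K) ≠ 0) : Function.Surjective (Ψ.linHom K i) :=
  fun y => ⟨Pi.single k (y / Ψ.lin i k), by rw [linHom_single, mul_div_cancel₀ _ h]⟩

-- Cramer's rule, in the columns `k` and `l`.
theorem linHom_prod_surjective (h : (Ψ.minor i j k l : K) ≠ 0) :
    Function.Surjective ((Ψ.linHom K i).prod (Ψ.linHom K j)) := by
  rintro ⟨y, z⟩
  refine ⟨Pi.single k ((y * Ψ.lin j l - z * Ψ.lin i l) / Ψ.minor i j k l) +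
    Pi.single l ((z * Ψ.lin i k - y * Ψ.lin j k) / Ψ.minor i j k l), ?_⟩
  simp only [AddMonoidHom.prod_apply, map_add, linHom_single, Prod.mk_add_mk,
    Prod.mk.injEq]
  constructor <;>
  · field_simp
    simp only [minor, Int.cast_sub, Int.cast_mul]
    ring

end Field

variable {Ψ : AffineSystem d t} {p : Nat.Primes} {i j : Fin t} {k l : Fin d}

theorem expect_zeroInd_of_lin_ne_zero (h : (Ψ.lin i k : ZMod p) ≠ 0) :
    𝔼 a, Ψ.zeroInd (ZMod p) i a = 1 / (p : ℝ) := by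
  classical
  have zeroInd_eq : ∀ a, Ψ.zeroInd (ZMod p) i a =
      if Ψ.linHom (ZMod p) i a = -(Ψ.const i : ZMod p) then 1 else 0 := fun a => by
    simp only [zeroInd, form_eq_zero_iff]
  simp only [zeroInd_eq]
  rw [expect_comp_of_surjective _ (Ψ.linHom_surjective h)
    fun b => if b = -(Ψ.const i : ZMod p) then 1 else 0, Fintype.expect_ite_eq']
  simp [NNRat.smul_def]

theorem expect_zeroInd_mul_of_minor_ne_zero (h : (Ψ.minor i j k l : ZMod p) ≠ 0) :
    𝔼 a, Ψ.zeroInd (ZMod p) i a * Ψ.zeroInd (ZMod p) j a = (1 / (p : ℝ)) ^ 2 := by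
  classical
  have zeroInd_mul_eq : ∀ a, Ψ.zeroInd (ZMod p) i a * Ψ.zeroInd (ZMod p) j a =
      if (Ψ.linHom (ZMod p) i).prod (Ψ.linHom (ZMod p) j) a =
        (-(Ψ.const i : ZMod p), -(Ψ.const j : ZMod p)) then 1 else 0 := fun a => by
    simp only [zeroInd, form_eq_zero_iff, AddMonoidHom.prod_apply, Prod.mk.injEq]
    split_ifs <;> simp_all
  simp only [zeroInd_mul_eq]
  rw [expect_comp_of_surjective _ (Ψ.linHom_prod_surjective h) fun b =>
    if b = (-(Ψ.const i : ZMod p), -(Ψ.const j : ZMod p)) then 1 else 0, Fintype.expect_ite_eq']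
  simp [NNRat.smul_def, sq]

theorem expect_zeroInd_eq (ht : 2 ≤ t) (h : (p : ℕ) ∉ Ψ.exceptionalPrimes) (i : Fin t) :
    𝔼 a, Ψ.zeroInd (ZMod p) i a = 1 / (p : ℝ) := by
  obtain ⟨k, hk⟩ : ∃ k, (Ψ.lin i k : ZMod p) ≠ 0 := by
    by_contra! hlin
    have : Nontrivial (Fin t) := Fin.nontrivial_iff_two_le.2 ht
    obtain ⟨j, hj⟩ := exists_ne i
    exact h ⟨p.2, i, j, hj.symm,
      inAffineSpan_iff_exists_lin_eq.2 ⟨0, fun k => by rw [hlin, zero_mul]⟩⟩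
  exact expect_zeroInd_of_lin_ne_zero hk

theorem expect_zeroInd_mul_eq (h : (p : ℕ) ∉ Ψ.exceptionalPrimes) (hij : i ≠ j) :
    𝔼 a, Ψ.zeroInd (ZMod p) i a * Ψ.zeroInd (ZMod p) j a = (1 / (p : ℝ)) ^ 2 := by
  obtain ⟨k, l, hkl⟩ := exists_minor_ne_zero (Ψ := Ψ) (K := ZMod p)
    (fun hs => h ⟨p.2, i, j, hij, hs⟩) (fun hs => h ⟨p.2, j, i, hij.symm, hs⟩)
  exact expect_zeroInd_mul_of_minor_ne_zero hkl

theorem localVonMangoldt_form (Ψ : AffineSystem d t) (p : Nat.Primes) (i : Fin t)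
    (a : Fin d → ZMod p) :
    localVonMangoldt p (Ψ.form (ZMod p) i a) =
      (1 - Ψ.zeroInd (ZMod p) i a) * ((p : ℝ) / (p - 1)) := by
  rw [localVonMangoldt, zeroInd, Nat.totient_prime p.2]
  simp only [isUnit_iff_ne_zero]
  split_ifs <;> simp_all [Nat.cast_sub p.2.one_le]

theorem localFactor_eq (Ψ : AffineSystem d t) (p : Nat.Primes) :
    Ψ.localFactor p =
      (𝔼 a, ∏ i, (1 - Ψ.zeroInd (ZMod p) i a)) * ((p : ℝ) / (p - 1)) ^ t := by
  simp only [localFactor, localVonMangoldt_form, Finset.prod_mul_distrib, Finset.prod_const,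
    Finset.card_univ, Fintype.card_fin, ← Finset.sum_mul, Fintype.expect_eq_sum_div_card,
    Fintype.card_pi, ZMod.card, Nat.cast_pow]
  ring

theorem expect_zeroInd_le (h : Ψ.localFactor p ≠ 0) (i : Fin t) :
    𝔼 a, Ψ.zeroInd (ZMod p) i a ≤ 1 / (p : ℝ) := by
  by_cases hlin : ∃ k, (Ψ.lin i k : ZMod p) ≠ 0
  · obtain ⟨k, hk⟩ := hlin
    exact (expect_zeroInd_of_lin_ne_zero hk).le
  · push Not at hlin
    have hconst : (Ψ.const i : ZMod p) ≠ 0 := fun hconst => h <| by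
      rw [localFactor_eq, Finset.expect_eq_zero, zero_mul]
      exact fun a _ => Finset.prod_eq_zero (Finset.mem_univ i)
        (by simp [zeroInd, form, hlin, hconst])
    rw [Finset.expect_eq_zero fun a _ => by simp [zeroInd, form, hlin, hconst]]
    positivity

end AffineSystem

/-! ### The Euler factor of a ratio of zeta functions -/

/-- The Euler factor at `p` of `ζ(1 + z) ζ(1 + z') / ζ(1 + z + z')`, where `x = 1 / p` and the
twists are `u = p ^ (-z)` and `u' = p ^ (-z')`. -/
noncomputable def eulerRatio (x u u' : ℂ) : ℂ :=
  (1 - u * u' * x) * ((1 - u * x)⁻¹ * (1 - u' * x)⁻¹)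

section EulerRatio

variable {x u u' : ℂ}

theorem one_half_le_norm_one_sub (hx : ‖x‖ ≤ 1 / 2) (hu : ‖u‖ ≤ 1) : 1 / 2 ≤ ‖1 - u * x‖ := by
  have mul_le : ‖u * x‖ ≤ 1 / 2 := by
    rw [norm_mul]; nlinarith [norm_nonneg u, norm_nonneg x]
  have sub_le := norm_sub_norm_le (1 : ℂ) (u * x)
  rw [norm_one] at sub_le
  linarith

theorem one_sub_mul_ne_zero (hx : ‖x‖ ≤ 1 / 2) (hu : ‖u‖ ≤ 1) : 1 - u * x ≠ 0 :=
  norm_pos_iff.1 (one_half_pos.trans_le (one_half_le_norm_one_sub hx hu))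

theorem norm_inv_one_sub_le (hx : ‖x‖ ≤ 1 / 2) (hu : ‖u‖ ≤ 1) : ‖(1 - u * x)⁻¹‖ ≤ 2 := by
  rw [norm_inv]
  exact (inv_anti₀ (by norm_num) (one_half_le_norm_one_sub hx hu)).trans (by norm_num)

theorem norm_mul_le_one (hu : ‖u‖ ≤ 1) (hu' : ‖u'‖ ≤ 1) : ‖u * u'‖ ≤ 1 := by
  rw [norm_mul]; exact mul_le_one₀ hu (norm_nonneg _) hu'

theorem norm_add_sub_mul_le (hu : ‖u‖ ≤ 1) (hu' : ‖u'‖ ≤ 1) : ‖u + u' - u * u'‖ ≤ 3 :=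
  calc ‖u + u' - u * u'‖ ≤ ‖u‖ + ‖u'‖ + ‖u * u'‖ :=
        (norm_sub_le _ _).trans (by gcongr; exact norm_add_le _ _)
    _ ≤ 3 := by linarith [norm_mul_le_one hu hu']

theorem eulerRatio_ne_zero (hx : ‖x‖ ≤ 1 / 2) (hu : ‖u‖ ≤ 1) (hu' : ‖u'‖ ≤ 1) :
    eulerRatio x u u' ≠ 0 :=
  mul_ne_zero (one_sub_mul_ne_zero hx (norm_mul_le_one hu hu'))
    (mul_ne_zero (inv_ne_zero (one_sub_mul_ne_zero hx hu))
      (inv_ne_zero (one_sub_mul_ne_zero hx hu')))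

theorem norm_eulerRatio_sub_one_le (hx : ‖x‖ ≤ 1 / 2) (hu : ‖u‖ ≤ 1) (hu' : ‖u'‖ ≤ 1) :
    ‖eulerRatio x u u' - 1‖ ≤ 16 * ‖x‖ := by
  have hne := one_sub_mul_ne_zero hx hu
  have hne' := one_sub_mul_ne_zero hx hu'
  have inv_le := norm_inv_one_sub_le hx hu
  have inv_le' := norm_inv_one_sub_le hx hu'
  have mul_le : ‖u * u' * x‖ ≤ 1 := norm_mul_le_one (norm_mul_le_one hu hu') (by linarith)
  have num_le : ‖(u + u' - u * u') - u * u' * x‖ ≤ 4 :=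
    (norm_sub_le _ _).trans (by linarith [norm_add_sub_mul_le hu hu'])
  calc ‖eulerRatio x u u' - 1‖
      = ‖x * ((u + u' - u * u') - u * u' * x) * ((1 - u * x)⁻¹ * (1 - u' * x)⁻¹)‖ := by
        congr 1
        rw [eulerRatio]
        field_simp
        ring
    _ ≤ ‖x‖ * 4 * (2 * 2) := by simp only [norm_mul] at *; gcongr
    _ = 16 * ‖x‖ := by ring

theorem norm_eulerRatio_le (hx : ‖x‖ ≤ 1 / 2) (hu : ‖u‖ ≤ 1) (hu' : ‖u'‖ ≤ 1) :
    ‖eulerRatio x u u'‖ ≤ 9 := by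
  have sub_le := norm_sub_norm_le (eulerRatio x u u') 1
  rw [norm_one] at sub_le
  linarith [norm_eulerRatio_sub_one_le hx hu hu']

theorem norm_eulerRatio_sub_one_sub_le (hx : ‖x‖ ≤ 1 / 2) (hu : ‖u‖ ≤ 1) (hu' : ‖u'‖ ≤ 1) :
    ‖eulerRatio x u u' - 1 - (u + u' - u * u') * x‖ ≤ 64 * ‖x‖ ^ 2 := by
  have hne := one_sub_mul_ne_zero hx hu
  have hne' := one_sub_mul_ne_zero hx hu'
  have inv_le := norm_inv_one_sub_le hx hu
  have inv_le' := norm_inv_one_sub_le hx hu'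
  have mul_le : ‖u * u' * x‖ ≤ 1 := norm_mul_le_one (norm_mul_le_one hu hu') (by linarith)
  have add_le : ‖u + u' - u * u' * x‖ ≤ 3 :=
    (norm_sub_le _ _).trans (by linarith [norm_add_le u u'])
  have num_le : ‖-(u * u') + (u + u' - u * u') * (u + u' - u * u' * x)‖ ≤ 16 := by
    refine (norm_add_le _ _).trans ?_
    rw [norm_neg, norm_mul (u + u' - u * u')]
    linarith [norm_mul_le_one hu hu',
      mul_le_mul (norm_add_sub_mul_le hu hu') add_le (norm_nonneg _) (by norm_num)]
  calc ‖eulerRatio x u u' - 1 - (u + u' - u * u') * x‖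
      = ‖x ^ 2 * (-(u * u') + (u + u' - u * u') * (u + u' - u * u' * x)) *
          ((1 - u * x)⁻¹ * (1 - u' * x)⁻¹)‖ := by
        congr 1
        rw [eulerRatio]
        field_simp
        ring
    _ ≤ ‖x‖ ^ 2 * 16 * (2 * 2) := by
        rw [norm_mul, norm_mul, norm_pow, norm_mul (1 - u * x)⁻¹]; gcongr
    _ = 64 * ‖x‖ ^ 2 := by ring

theorem eulerRatio_one_one (hx : x ≠ 1) : eulerRatio x 1 1 = (1 - x)⁻¹ := by
  have : 1 - x ≠ 0 := sub_ne_zero.2 hx.symm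
  simp only [eulerRatio, one_mul]
  exact mul_inv_cancel_left₀ this _

theorem norm_eulerRatio_sub_le (hx : ‖x‖ ≤ 1 / 2) (hu : ‖u‖ ≤ 1) (hu' : ‖u'‖ ≤ 1) :
    ‖eulerRatio x u u' - eulerRatio x 1 1‖ ≤ 8 * ‖x‖ * (‖u - 1‖ * ‖u' - 1‖) := by
  have hx1 : x ≠ 1 := fun h => by norm_num [h] at hx
  have hne := one_sub_mul_ne_zero hx hu
  have hne' := one_sub_mul_ne_zero hx hu'
  have hne1 : 1 - x ≠ 0 := sub_ne_zero.2 hx1.symm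
  have inv_le := norm_inv_one_sub_le hx hu
  have inv_le' := norm_inv_one_sub_le hx hu'
  have inv_le1 : ‖(1 - x)⁻¹‖ ≤ 2 := by simpa using norm_inv_one_sub_le (u := 1) hx (by simp)
  calc ‖eulerRatio x u u' - eulerRatio x 1 1‖
      = ‖-x * ((u - 1) * (u' - 1)) * ((1 - u * x)⁻¹ * (1 - u' * x)⁻¹ * (1 - x)⁻¹)‖ := by
        congr 1
        rw [eulerRatio_one_one hx1, eulerRatio]
        field_simp
        ring
    _ ≤ ‖x‖ * (‖u - 1‖ * ‖u' - 1‖) * (2 * 2 * 2) := by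
        simp only [norm_mul, norm_neg] at *; gcongr
    _ = 8 * ‖x‖ * (‖u - 1‖ * ‖u' - 1‖) := by ring

theorem norm_one_div_prime (p : Nat.Primes) : ‖(1 / p : ℂ)‖ = 1 / (p : ℝ) := by
  rw [norm_div, norm_one, Complex.norm_natCast]

theorem norm_one_div_prime_le (p : Nat.Primes) : ‖(1 / p : ℂ)‖ ≤ 1 / 2 := by
  rw [norm_one_div_prime]
  exact one_div_le_one_div_of_le (by norm_num) (by exact_mod_cast p.2.two_le)

end EulerRatio

section ProdEulerRatio

variable {ι : Type*} [Fintype ι] (p : Nat.Primes) {u u' : ι → ℂ}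

theorem norm_prod_eulerRatio_le (hu : ∀ i, ‖u i‖ ≤ 1) (hu' : ∀ i, ‖u' i‖ ≤ 1) :
    ‖∏ i, eulerRatio (1 / p) (u i) (u' i)‖ ≤ 9 ^ Fintype.card ι := by
  refine (norm_prod_le_prod_of_le _ fun i _ =>
    norm_eulerRatio_le (norm_one_div_prime_le p) (hu i) (hu' i)).trans_eq ?_
  simp

theorem norm_prod_eulerRatio_sub_one_le (hu : ∀ i, ‖u i‖ ≤ 1) (hu' : ∀ i, ‖u' i‖ ≤ 1) :
    ‖∏ i, eulerRatio (1 / p) (u i) (u' i) - 1‖ ≤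
      9 ^ Fintype.card ι * (16 * Fintype.card ι) * (1 / p) := by
  have hx := norm_one_div_prime_le p
  have h := norm_prod_one_add_sub_one_le_pow Finset.univ (M := 9)
    (y := fun i => eulerRatio (1 / p) (u i) (u' i) - 1) (by linarith) (by positivity)
    fun i _ => norm_eulerRatio_sub_one_le hx (hu i) (hu' i)
  simp only [add_sub_cancel, Finset.card_univ, norm_one_div_prime] at h
  exact h.trans_eq (by ring)

theorem norm_prod_eulerRatio_sub_le (hu : ∀ i, ‖u i‖ ≤ 1) (hu' : ∀ i, ‖u' i‖ ≤ 1) :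
    ‖∏ i, eulerRatio (1 / p) (u i) (u' i) - ∏ _i : ι, eulerRatio (1 / p) 1 1‖ ≤
      9 ^ Fintype.card ι * 8 * (∑ i, ‖u i - 1‖ * ‖u' i - 1‖) * (1 / p) := by
  have hx := norm_one_div_prime_le p
  calc ‖∏ i, eulerRatio (1 / p) (u i) (u' i) - ∏ _i : ι, eulerRatio (1 / p) 1 1‖
      ≤ 9 ^ Fintype.card ι * ∑ i, ‖eulerRatio (1 / p) (u i) (u' i) - eulerRatio (1 / p) 1 1‖ :=
        norm_prod_sub_prod_le_pow (by norm_num)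
          (fun i => norm_eulerRatio_le hx (hu i) (hu' i))
          fun _ => norm_eulerRatio_le hx (by simp) (by simp)
    _ ≤ 9 ^ Fintype.card ι * ∑ i, 8 * ‖(1 / p : ℂ)‖ * (‖u i - 1‖ * ‖u' i - 1‖) := by
        gcongr with i
        exact norm_eulerRatio_sub_le hx (hu i) (hu' i)
    _ = 9 ^ Fintype.card ι * 8 * (∑ i, ‖u i - 1‖ * ‖u' i - 1‖) * (1 / p) := by
        rw [← Finset.mul_sum, norm_one_div_prime]; ring

theorem norm_prod_eulerRatio_sub_one_sub_le (hu : ∀ i, ‖u i‖ ≤ 1) (hu' : ∀ i, ‖u' i‖ ≤ 1) :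
    ‖∏ i, eulerRatio (1 / p) (u i) (u' i) - 1 -
        ∑ i, (u i + u' i - u i * u' i) * (1 / (p : ℂ))‖ ≤
      (Fintype.card ι ^ 2 * 9 ^ Fintype.card ι * 16 ^ 2 + Fintype.card ι * 64) *
        (1 / (p : ℝ)) ^ 2 := by
  have hx := norm_one_div_prime_le p
  set r := fun i => eulerRatio (1 / p) (u i) (u' i) - 1
  have prod_le := norm_prod_one_add_sub_one_sub_sum_le Finset.univ (M := 9) (y := r)
    (by linarith) (by positivity) fun i _ => norm_eulerRatio_sub_one_le hx (hu i) (hu' i)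
  have sum_le : ‖∑ i, r i - ∑ i, (u i + u' i - u i * u' i) * (1 / (p : ℂ))‖ ≤
      Fintype.card ι * (64 * ‖(1 / p : ℂ)‖ ^ 2) := by
    rw [← Finset.sum_sub_distrib]
    refine (norm_sum_le_of_le _ fun i _ =>
      norm_eulerRatio_sub_one_sub_le hx (hu i) (hu' i)).trans_eq ?_
    simp
  simp only [r, add_sub_cancel, Finset.card_univ] at prod_le
  rw [← sub_add_sub_cancel _ (∑ i, r i)]
  refine (norm_add_le_of_le prod_le sum_le).trans_eq ?_
  rw [norm_one_div_prime]
  ring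

end ProdEulerRatio

/-! ### The local factors of the twisted Euler product -/

theorem prod_one_sub_eq_one_sub_sum {ι R : Type*} [CommRing R] (s : Finset ι) {y : ι → R}
    (h : ∀ i ∈ s, ∀ j ∈ s, i ≠ j → y i * y j = 0) :
    ∏ i ∈ s, (1 - y i) = 1 - ∑ i ∈ s, y i := by
  classical
  induction s using Finset.induction_on with
  | empty => simp
  | insert k s hk ih =>
    have cross : y k * ∑ i ∈ s, y i = 0 := by
      rw [Finset.mul_sum]
      exact Finset.sum_eq_zero fun i hi => h k (Finset.mem_insert_self _ _) i
        (Finset.mem_insert_of_mem hi) (ne_of_mem_of_not_mem hi hk).symm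
    rw [Finset.prod_insert hk, Finset.sum_insert hk, ih fun i hi j hj =>
      h i (Finset.mem_insert_of_mem hi) j (Finset.mem_insert_of_mem hj)]
    linear_combination cross

namespace AffineSystem

variable {d t : ℕ}

/-- The mean over `a ∈ (ℤ/pℤ)^d` of `∏_i (1 - w_i 1_{ψ_i(a) = 0})`. -/
noncomputable def localMean (Ψ : AffineSystem d t) (p : Nat.Primes) (w : Fin t → ℂ) : ℂ :=
  𝔼 a : Fin d → ZMod p, ∏ i, (1 - (Ψ.zeroInd (ZMod p) i a : ℂ) * w i)

/-- The local factor `β_p` deformed by twists `u` and `u'` of the two copies of the sieve weights;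
the untwisted case `u = u' = 1` is `β_p` itself. The product of Euler ratios makes it
`1 + O(1 / p²)` at the primes which are not exceptional. -/
noncomputable def twistedFactor (Ψ : AffineSystem d t) (p : Nat.Primes) (u u' : Fin t → ℂ) : ℂ :=
  Ψ.localMean p (u + u' - u * u') * ∏ i, eulerRatio (1 / p) (u i) (u' i)

section Pointwise

variable (Ψ : AffineSystem d t) {K : Type*} [CommRing K] (a : Fin d → K)

theorem norm_zeroInd_mul (i : Fin t) (w : ℂ) :
    ‖(Ψ.zeroInd K i a : ℂ) * w‖ = Ψ.zeroInd K i a * ‖w‖ := by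
  rw [norm_mul, Complex.norm_real, Real.norm_of_nonneg (Ψ.zeroInd_nonneg K i a)]

theorem norm_zeroInd_mul_le (i : Fin t) {w : ℂ} {c : ℝ} (hw : ‖w‖ ≤ c) :
    ‖(Ψ.zeroInd K i a : ℂ) * w‖ ≤ c := by
  rw [norm_zeroInd_mul]
  exact (mul_le_of_le_one_left (norm_nonneg _) (Ψ.zeroInd_le_one K i a)).trans hw

theorem norm_one_sub_zeroInd_mul_le (i : Fin t) {w : ℂ} (hw : ‖w‖ ≤ 3) :
    ‖1 - (Ψ.zeroInd K i a : ℂ) * w‖ ≤ 4 := by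
  refine (norm_sub_le _ _).trans ?_
  rw [norm_one]
  linarith [Ψ.norm_zeroInd_mul_le a i hw]

theorem norm_prod_one_sub_zeroInd_le {w : Fin t → ℂ} (hw : ∀ i, ‖w i‖ ≤ 3) :
    ‖∏ i, (1 - (Ψ.zeroInd K i a : ℂ) * w i)‖ ≤ 4 ^ t := by
  refine (norm_prod_le_prod_of_le _ fun i _ =>
    Ψ.norm_one_sub_zeroInd_mul_le a i (hw i)).trans_eq ?_
  simp

theorem norm_prod_one_sub_zeroInd_sub_le {w w' : Fin t → ℂ} (hw : ∀ i, ‖w i‖ ≤ 3)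
    (hw' : ∀ i, ‖w' i‖ ≤ 3) :
    ‖∏ i, (1 - (Ψ.zeroInd K i a : ℂ) * w i) - ∏ i, (1 - (Ψ.zeroInd K i a : ℂ) * w' i)‖ ≤
      4 ^ t * ∑ i, Ψ.zeroInd K i a * ‖w i - w' i‖ := by
  have h := norm_prod_sub_prod_le_pow (M := 4) (by norm_num)
    (fun i => Ψ.norm_one_sub_zeroInd_mul_le a i (hw i))
    (fun i => Ψ.norm_one_sub_zeroInd_mul_le a i (hw' i))
  simp only [sub_sub_sub_cancel_left, ← mul_sub, norm_zeroInd_mul, Fintype.card_fin] at h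
  simpa only [norm_sub_rev] using h

-- The left side vanishes unless two of the forms have a common zero at `a`.
theorem norm_prod_one_sub_zeroInd_sub_one_add_le {w : Fin t → ℂ} (hw : ∀ i, ‖w i‖ ≤ 3) :
    ‖∏ i, (1 - (Ψ.zeroInd K i a : ℂ) * w i) - 1 + ∑ i, (Ψ.zeroInd K i a : ℂ) * w i‖ ≤
      (4 ^ t + 1 + t * 3) * ∑ q : Fin t × Fin t with q.1 ≠ q.2,
        Ψ.zeroInd K q.1 a * Ψ.zeroInd K q.2 a := by
  have term_nonneg : ∀ q ∈ ({q | q.1 ≠ q.2} : Finset (Fin t × Fin t)),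
      0 ≤ Ψ.zeroInd K q.1 a * Ψ.zeroInd K q.2 a := fun q _ =>
    mul_nonneg (Ψ.zeroInd_nonneg K _ a) (Ψ.zeroInd_nonneg K _ a)
  by_cases h : ∃ i j, i ≠ j ∧ Ψ.form K i a = 0 ∧ Ψ.form K j a = 0
  · obtain ⟨i, j, hij, hi, hj⟩ := h
    have one_le : (1 : ℝ) ≤ ∑ q : Fin t × Fin t with q.1 ≠ q.2,
        Ψ.zeroInd K q.1 a * Ψ.zeroInd K q.2 a :=
      calc (1 : ℝ) = Ψ.zeroInd K i a * Ψ.zeroInd K j a := by simp [zeroInd, hi, hj]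
        _ ≤ _ := Finset.single_le_sum term_nonneg (a := (i, j)) (by simpa using hij)
    have sum_le : ‖∑ i, (Ψ.zeroInd K i a : ℂ) * w i‖ ≤ t * 3 := by
      simpa using norm_sum_le_of_le Finset.univ fun i _ => Ψ.norm_zeroInd_mul_le a i (hw i)
    refine le_trans ?_ (le_mul_of_one_le_right (by positivity) one_le)
    refine norm_add_le_of_le (norm_sub_le_of_le ?_ (by simp)) sum_le
    exact Ψ.norm_prod_one_sub_zeroInd_le a hw
  · push Not at h
    refine le_trans (le_of_eq ?_) (mul_nonneg (by positivity) (Finset.sum_nonneg term_nonneg))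
    rw [norm_eq_zero, prod_one_sub_eq_one_sub_sum, sub_sub_cancel_left, neg_add_cancel]
    intro i _ j _ hij
    by_cases hi : Ψ.form K i a = 0
    · simp [zeroInd, h i j hij hi]
    · simp [zeroInd, hi]

end Pointwise

section LocalMean

variable {Ψ : AffineSystem d t} {p : Nat.Primes} {w w' : Fin t → ℂ}

theorem localMean_zero (Ψ : AffineSystem d t) (p : Nat.Primes) : Ψ.localMean p 0 = 1 := by
  simp [localMean]

theorem norm_localMean_le (Ψ : AffineSystem d t) (p : Nat.Primes) (hw : ∀ i, ‖w i‖ ≤ 3) :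
    ‖Ψ.localMean p w‖ ≤ 4 ^ t :=
  calc ‖Ψ.localMean p w‖
      ≤ 𝔼 a : Fin d → ZMod p, ‖∏ i, (1 - (Ψ.zeroInd (ZMod p) i a : ℂ) * w i)‖ :=
        RCLike.norm_expect_le (K := ℂ)
    _ ≤ 𝔼 _a : Fin d → ZMod p, (4 : ℝ) ^ t :=
        Finset.expect_le_expect fun a _ => Ψ.norm_prod_one_sub_zeroInd_le a hw
    _ = 4 ^ t := Fintype.expect_const _

theorem norm_localMean_sub_le (h : Ψ.localFactor p ≠ 0) (hw : ∀ i, ‖w i‖ ≤ 3)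
    (hw' : ∀ i, ‖w' i‖ ≤ 3) :
    ‖Ψ.localMean p w - Ψ.localMean p w'‖ ≤ 4 ^ t * (∑ i, ‖w i - w' i‖) * (1 / p) := by
  rw [localMean, localMean, ← Finset.expect_sub_distrib]
  calc ‖𝔼 a : Fin d → ZMod p, (∏ i, (1 - (Ψ.zeroInd (ZMod p) i a : ℂ) * w i) -
          ∏ i, (1 - (Ψ.zeroInd (ZMod p) i a : ℂ) * w' i))‖
      ≤ 𝔼 a : Fin d → ZMod p, 4 ^ t * ∑ i, Ψ.zeroInd (ZMod p) i a * ‖w i - w' i‖ :=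
        (RCLike.norm_expect_le (K := ℂ)).trans <| Finset.expect_le_expect fun a _ =>
          Ψ.norm_prod_one_sub_zeroInd_sub_le a hw hw'
    _ = 4 ^ t * ∑ i, (𝔼 a, Ψ.zeroInd (ZMod p) i a) * ‖w i - w' i‖ := by
        simp only [← Finset.mul_expect, Finset.expect_sum_comm, ← Finset.expect_mul]
    _ ≤ 4 ^ t * ∑ i, 1 / p * ‖w i - w' i‖ := by
        gcongr with i
        exact expect_zeroInd_le h i
    _ = 4 ^ t * (∑ i, ‖w i - w' i‖) * (1 / p) := by rw [← Finset.mul_sum]; ring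

theorem localMean_sub_one_add_eq (ht : 2 ≤ t) (h : (p : ℕ) ∉ Ψ.exceptionalPrimes)
    (w : Fin t → ℂ) :
    Ψ.localMean p w - 1 + ∑ i, w i * (1 / (p : ℂ)) =
      𝔼 a, (∏ i, (1 - (Ψ.zeroInd (ZMod p) i a : ℂ) * w i) - 1 +
        ∑ i, (Ψ.zeroInd (ZMod p) i a : ℂ) * w i) := by
  have expect_eq : ∀ i, 𝔼 a, (Ψ.zeroInd (ZMod p) i a : ℂ) = 1 / (p : ℂ) := fun i => by
    rw [← Complex.ofReal_expect, expect_zeroInd_eq ht h i]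
    push_cast
    rfl
  simp only [Finset.expect_add_distrib, Finset.expect_sub_distrib, Finset.expect_sum_comm,
    ← Finset.expect_mul, expect_eq, Fintype.expect_const, localMean, mul_comm (w _)]

theorem norm_localMean_sub_one_add_le (ht : 2 ≤ t) (h : (p : ℕ) ∉ Ψ.exceptionalPrimes)
    (hw : ∀ i, ‖w i‖ ≤ 3) :
    ‖Ψ.localMean p w - 1 + ∑ i, w i * (1 / (p : ℂ))‖ ≤
      (4 ^ t + 1 + t * 3) * (t * t) * (1 / (p : ℝ)) ^ 2 := by
  rw [localMean_sub_one_add_eq ht h]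
  have card_le : ((Finset.univ.filter fun q : Fin t × Fin t => q.1 ≠ q.2).card : ℝ) ≤ t * t := by
    have := Finset.card_filter_le (Finset.univ : Finset (Fin t × Fin t)) (fun q => q.1 ≠ q.2)
    simp only [Finset.card_univ, Fintype.card_prod, Fintype.card_fin] at this
    exact_mod_cast this
  refine (RCLike.norm_expect_le (K := ℂ)).trans ?_
  calc 𝔼 a : Fin d → ZMod p, ‖∏ i, (1 - (Ψ.zeroInd (ZMod p) i a : ℂ) * w i) - 1 +
          ∑ i, (Ψ.zeroInd (ZMod p) i a : ℂ) * w i‖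
      ≤ 𝔼 a : Fin d → ZMod p, (4 ^ t + 1 + t * 3 : ℝ) * ∑ q : Fin t × Fin t with q.1 ≠ q.2,
          Ψ.zeroInd (ZMod p) q.1 a * Ψ.zeroInd (ZMod p) q.2 a :=
        Finset.expect_le_expect fun a _ => Ψ.norm_prod_one_sub_zeroInd_sub_one_add_le a hw
    _ = (4 ^ t + 1 + t * 3 : ℝ) * ∑ q : Fin t × Fin t with q.1 ≠ q.2, (1 / (p : ℝ)) ^ 2 := by
        rw [← Finset.mul_expect, Finset.expect_sum_comm]
        congr 1
        exact Finset.sum_congr rfl fun q hq => expect_zeroInd_mul_eq h (by simpa using hq)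
    _ ≤ (4 ^ t + 1 + t * 3) * (t * t) * (1 / (p : ℝ)) ^ 2 := by
        rw [Finset.sum_const, nsmul_eq_mul, ← mul_assoc]
        gcongr

theorem twistedFactor_one (Ψ : AffineSystem d t) (p : Nat.Primes) :
    Ψ.twistedFactor p 1 1 = Ψ.localFactor p := by
  have hp : (p : ℂ) ≠ 0 := by exact_mod_cast p.2.ne_zero
  have hp1 : (1 / p : ℂ) ≠ 1 := by
    rw [Ne, one_div, inv_eq_one]; exact_mod_cast p.2.one_lt.ne'
  have ratio_eq : eulerRatio (1 / p) 1 1 = (p : ℂ) / (p - 1) := by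
    rw [eulerRatio_one_one hp1, one_sub_div hp, inv_div]
  rw [twistedFactor, localMean, localFactor_eq]
  simp only [Pi.one_apply, ratio_eq, Finset.prod_const, Finset.card_univ, Fintype.card_fin,
    mul_one, add_sub_cancel_right]
  push_cast
  rfl

end LocalMean

section TwistedFactor

variable {Ψ : AffineSystem d t} {p : Nat.Primes} {u u' : Fin t → ℂ}

theorem norm_twistedFactor_sub_one_le (hu : ∀ i, ‖u i‖ ≤ 1) (hu' : ∀ i, ‖u' i‖ ≤ 1)
    (h : Ψ.localFactor p ≠ 0) :
    ‖Ψ.twistedFactor p u u' - 1‖ ≤ 9 ^ t * (4 ^ t * 3 + 16) * t * (1 / p) := by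
  set w := u + u' - u * u'
  set E := ∏ i, eulerRatio (1 / p) (u i) (u' i)
  have hw : ∀ i, ‖w i‖ ≤ 3 := fun i => norm_add_sub_mul_le (hu i) (hu' i)
  have mean_le : ‖Ψ.localMean p w - 1‖ ≤ 4 ^ t * (t * 3) * (1 / p) := by
    rw [← Ψ.localMean_zero p]
    refine (norm_localMean_sub_le h hw fun _ => by simp).trans ?_
    gcongr
    simpa using Finset.sum_le_card_nsmul Finset.univ _ 3 fun i _ => hw i
  have prod_le : ‖E‖ ≤ 9 ^ t := by
    simpa only [Fintype.card_fin] using norm_prod_eulerRatio_le p hu hu'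
  have prod_sub_le : ‖E - 1‖ ≤ 9 ^ t * (16 * t) * (1 / p) := by
    simpa only [Fintype.card_fin] using norm_prod_eulerRatio_sub_one_le p hu hu'
  calc ‖Ψ.twistedFactor p u u' - 1‖ = ‖(Ψ.localMean p w - 1) * E + (E - 1)‖ := by
        rw [show Ψ.twistedFactor p u u' = Ψ.localMean p w * E from rfl]
        congr 1
        ring
    _ ≤ 4 ^ t * (t * 3) * (1 / p) * 9 ^ t + 9 ^ t * (16 * t) * (1 / p) :=
        norm_add_le_of_le (norm_mul_le_of_le mean_le prod_le) prod_sub_le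
    _ = 9 ^ t * (4 ^ t * 3 + 16) * t * (1 / p) := by ring

theorem norm_twistedFactor_sub_localFactor_le (hu : ∀ i, ‖u i‖ ≤ 1) (hu' : ∀ i, ‖u' i‖ ≤ 1)
    (h : Ψ.localFactor p ≠ 0) :
    ‖Ψ.twistedFactor p u u' - Ψ.localFactor p‖ ≤
      9 ^ t * 4 ^ t * 9 * (∑ i, ‖u i - 1‖ * ‖u' i - 1‖) * (1 / p) := by
  set w := u + u' - u * u'
  set E := ∏ i, eulerRatio (1 / p) (u i) (u' i)
  set E₁ := ∏ _i : Fin t, eulerRatio (1 / p) 1 1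
  set δ := ∑ i, ‖u i - 1‖ * ‖u' i - 1‖
  have hw : ∀ i, ‖w i‖ ≤ 3 := fun i => norm_add_sub_mul_le (hu i) (hu' i)
  have hone : ∀ i, ‖(1 : Fin t → ℂ) i‖ ≤ 3 := fun i => by norm_num
  have mean_sub_le : ‖Ψ.localMean p w - Ψ.localMean p 1‖ ≤ 4 ^ t * δ * (1 / p) := by
    refine (norm_localMean_sub_le h hw hone).trans_eq ?_
    congr 2
    refine Finset.sum_congr rfl fun i _ => ?_
    rw [← norm_mul, ← norm_neg]
    congr 1
    simp only [w, Pi.add_apply, Pi.sub_apply, Pi.mul_apply, Pi.one_apply]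
    ring
  have prod_le : ‖E‖ ≤ 9 ^ t := by
    simpa only [Fintype.card_fin] using norm_prod_eulerRatio_le p hu hu'
  have prod_sub_le : ‖E - E₁‖ ≤ 9 ^ t * 8 * δ * (1 / p) := by
    simpa only [Fintype.card_fin] using norm_prod_eulerRatio_sub_le p hu hu'
  calc ‖Ψ.twistedFactor p u u' - Ψ.localFactor p‖
      = ‖(Ψ.localMean p w - Ψ.localMean p 1) * E + Ψ.localMean p 1 * (E - E₁)‖ := by
        have one_eq : Ψ.twistedFactor p 1 1 = Ψ.localMean p 1 * E₁ := by
          rw [twistedFactor, mul_one, add_sub_cancel_right]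
          rfl
        rw [← twistedFactor_one, one_eq, show Ψ.twistedFactor p u u' = Ψ.localMean p w * E from rfl]
        congr 1
        ring
    _ ≤ 4 ^ t * δ * (1 / p) * 9 ^ t + 4 ^ t * (9 ^ t * 8 * δ * (1 / p)) :=
        norm_add_le_of_le (norm_mul_le_of_le mean_sub_le prod_le)
          (norm_mul_le_of_le (Ψ.norm_localMean_le p hone) prod_sub_le)
    _ = 9 ^ t * 4 ^ t * 9 * δ * (1 / p) := by ring

-- The terms of order `1 / p` in the local mean and in the Euler ratios cancel.
theorem norm_twistedFactor_sub_one_le_sq (hu : ∀ i, ‖u i‖ ≤ 1) (hu' : ∀ i, ‖u' i‖ ≤ 1)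
    (ht : 2 ≤ t) (h : (p : ℕ) ∉ Ψ.exceptionalPrimes) :
    ‖Ψ.twistedFactor p u u' - 1‖ ≤ ((3 * t) ^ 2 + (t ^ 2 * 9 ^ t * 16 ^ 2 + t * 64) * 4 ^ t +
      (4 ^ t + 1 + t * 3) * (t * t) * (1 + 3 * t)) * (1 / (p : ℝ)) ^ 2 := by
  set w := u + u' - u * u'
  set E := ∏ i, eulerRatio (1 / p) (u i) (u' i)
  set s := ∑ i, w i * (1 / (p : ℂ))
  have hw : ∀ i, ‖w i‖ ≤ 3 := fun i => norm_add_sub_mul_le (hu i) (hu' i)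
  have inv_le : 1 / (p : ℝ) ≤ 1 := by
    have := norm_one_div_prime_le p
    rw [norm_one_div_prime] at this
    linarith
  have mean_le : ‖Ψ.localMean p w - 1 + s‖ ≤
      (4 ^ t + 1 + t * 3) * (t * t) * (1 / (p : ℝ)) ^ 2 := norm_localMean_sub_one_add_le ht h hw
  have prod_le : ‖E - 1 - s‖ ≤ (t ^ 2 * 9 ^ t * 16 ^ 2 + t * 64) * (1 / (p : ℝ)) ^ 2 :=
    (norm_prod_eulerRatio_sub_one_sub_le p hu hu').trans_eq (by rw [Fintype.card_fin])
  have sum_le : ‖s‖ ≤ 3 * t * (1 / p) := by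
    refine (norm_sum_le_of_le Finset.univ fun i _ => norm_mul_le_of_le (hw i)
      (norm_one_div_prime p).le).trans_eq ?_
    simp only [Finset.sum_const, Finset.card_univ, Fintype.card_fin, nsmul_eq_mul]
    ring
  have one_add_le : ‖1 + s‖ ≤ 1 + 3 * t :=
    norm_add_le_of_le (by simp) (sum_le.trans (mul_le_of_le_one_right (by positivity) inv_le))
  calc ‖Ψ.twistedFactor p u u' - 1‖
      = ‖-s * s + (E - 1 - s) * Ψ.localMean p w + (Ψ.localMean p w - 1 + s) * (1 + s)‖ := by
        rw [show Ψ.twistedFactor p u u' = Ψ.localMean p w * E from rfl]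
        congr 1
        ring
    _ ≤ 3 * t * (1 / p) * (3 * t * (1 / p)) +
        (t ^ 2 * 9 ^ t * 16 ^ 2 + t * 64) * (1 / (p : ℝ)) ^ 2 * 4 ^ t +
        (4 ^ t + 1 + t * 3) * (t * t) * (1 / (p : ℝ)) ^ 2 * (1 + 3 * t) :=
        norm_add_le_of_le
          (norm_add_le_of_le (norm_mul_le_of_le ((norm_neg s).trans_le sum_le) sum_le)
            (norm_mul_le_of_le prod_le (Ψ.norm_localMean_le p hw)))
          (norm_mul_le_of_le mean_le one_add_le)
    _ = _ := by ring

end TwistedFactor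

theorem exists_twistedFactor_bound (t : ℕ) (ht : 2 ≤ t) : ∃ C : ℝ, 1 ≤ C ∧
    ∀ (d : ℕ) (Ψ : AffineSystem d t) (p : Nat.Primes) (u u' : Fin t → ℂ), (∀ i, ‖u i‖ ≤ 1) →
      (∀ i, ‖u' i‖ ≤ 1) → Ψ.localFactor p ≠ 0 →
      ‖Ψ.twistedFactor p u u' - 1‖ ≤ C * (1 / p) ∧
      ((p : ℕ) ∉ Ψ.exceptionalPrimes → ‖Ψ.twistedFactor p u u' - 1‖ ≤ C * (1 / (p : ℝ)) ^ 2) ∧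
      ‖Ψ.twistedFactor p u u' - Ψ.localFactor p‖ ≤
        C * (∑ i, ‖u i - 1‖ * ‖u' i - 1‖) * (1 / p) := by
  set C₁ : ℝ := 9 ^ t * (4 ^ t * 3 + 16) * t
  set C₂ : ℝ := (3 * t) ^ 2 + (t ^ 2 * 9 ^ t * 16 ^ 2 + t * 64) * 4 ^ t +
      (4 ^ t + 1 + t * 3) * (t * t) * (1 + 3 * t)
  set C₃ : ℝ := 9 ^ t * 4 ^ t * 9
  have hC₁ : 0 ≤ C₁ := by positivity
  have hC₂ : 0 ≤ C₂ := by positivity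
  have hC₃ : 0 ≤ C₃ := by positivity
  refine ⟨1 + C₁ + C₂ + C₃, by linarith, fun d Ψ p u u' hu hu' h => ⟨?_, fun hexc => ?_, ?_⟩⟩
  · exact (norm_twistedFactor_sub_one_le hu hu' h).trans
      (mul_le_mul_of_nonneg_right (by linarith) (by positivity))
  · exact (norm_twistedFactor_sub_one_le_sq hu hu' ht hexc).trans
      (mul_le_mul_of_nonneg_right (by linarith) (by positivity))
  · refine (norm_twistedFactor_sub_localFactor_le hu hu' h).trans ?_
    gcongr
    linarith

end AffineSystem

/-! ### Comparison of the twisted and untwisted products -/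

theorem one_sub_sum_le_prod_one_sub {ι : Type*} (s : Finset ι) {f : ι → ℝ}
    (hf : ∀ i ∈ s, 0 ≤ f i) (hf' : ∀ i ∈ s, f i ≤ 1) :
    1 - ∑ i ∈ s, f i ≤ ∏ i ∈ s, (1 - f i) := by
  classical
  induction s using Finset.induction_on with
  | empty => simp
  | insert j s hj ih =>
    simp only [Finset.forall_mem_insert] at hf hf'
    rw [Finset.sum_insert hj, Finset.prod_insert hj]
    have prod_le_one : ∏ i ∈ s, (1 - f i) ≤ 1 :=
      Finset.prod_le_one (fun i hi => by linarith [hf'.2 i hi]) fun i hi => by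
        linarith [hf.2 i hi]
    nlinarith [ih hf.2 hf'.2, hf.1]

theorem norm_exp_sub_one_le_of_re_nonpos {z : ℂ} (hz : z.re ≤ 0) :
    ‖Complex.exp z - 1‖ ≤ ‖z‖ := by
  have h := (convex_halfSpace_re_le 0).norm_image_sub_le_of_norm_deriv_le (f := Complex.exp)
    (C := 1) (x := 0) (y := z) (fun w _ => Complex.differentiable_exp.differentiableAt)
    (fun w hw => by
      rw [Complex.deriv_exp, Complex.norm_exp]
      exact Real.exp_le_one_iff.2 hw) (by simp) hz
  simpa using h

theorem summable_one_div_prime_sq : Summable fun p : Nat.Primes => (1 / (p : ℝ)) ^ 2 := by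
  refine (Nat.Primes.summable_rpow.2 (by norm_num : (-2 : ℝ) < -1)).congr fun p => ?_
  rw [Real.rpow_neg (by positivity), one_div, inv_pow]
  norm_cast

/-- The twists `p ^ (-z i)` of the sieve weights at the prime `p` that arise from the Fourier
expansion of the cut-off. -/
noncomputable def primeTwist {ι : Type*} (z : ι → ℂ) (p : Nat.Primes) (i : ι) : ℂ :=
  (p : ℂ) ^ (-z i)

theorem le_sqrt_mul_rpow_of_le {x C s y : ℝ} (hx : 0 < x) (hs : 0 ≤ s) (hC : 0 ≤ C) (hy : 0 ≤ y)
    (h : y ≤ C * (1 / x) ^ 2) (h' : y ≤ C * s * x ^ (-(1 / 2) : ℝ)) :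
    y ≤ C * (√s * x ^ (-(5 / 4) : ℝ)) := by
  have rpow_sq : (x ^ (-(5 / 4) : ℝ)) ^ 2 = (1 / x) ^ 2 * x ^ (-(1 / 2) : ℝ) := by
    rw [one_div, inv_pow, ← Real.rpow_natCast x, ← Real.rpow_neg hx.le, ← Real.rpow_add hx,
      ← Real.rpow_natCast, ← Real.rpow_mul hx.le]
    norm_num
  refine (pow_le_pow_iff_left₀ hy (by positivity) two_ne_zero).1 ?_
  calc y ^ 2 ≤ C * (1 / x) ^ 2 * (C * s * x ^ (-(1 / 2) : ℝ)) := by rw [sq]; gcongr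
    _ = (C * (√s * x ^ (-(5 / 4) : ℝ))) ^ 2 := by
        rw [mul_pow, mul_pow, Real.sq_sqrt hs, rpow_sq]; ring

section PrimeTwist

variable {ι : Type*} {z : ι → ℂ} (p : Nat.Primes) {i : ι}

theorem norm_primeTwist_le_one (hz : 0 ≤ (z i).re) : ‖primeTwist z p i‖ ≤ 1 := by
  rw [primeTwist, Complex.norm_natCast_cpow_of_pos p.2.pos, Complex.neg_re]
  exact Real.rpow_le_one_of_one_le_of_nonpos (by exact_mod_cast p.2.one_le) (by linarith)

theorem norm_primeTwist_sub_one_le (hz : 0 ≤ (z i).re) :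
    ‖primeTwist z p i - 1‖ ≤ ‖z i‖ * Real.log p := by
  have log_nonneg : 0 ≤ Real.log p := Real.log_natCast_nonneg _
  have hp : (p : ℂ) ≠ 0 := by exact_mod_cast p.2.ne_zero
  rw [primeTwist, Complex.cpow_def_of_ne_zero hp, Complex.natCast_log.symm]
  refine (norm_exp_sub_one_le_of_re_nonpos ?_).trans_eq ?_
  · rw [Complex.re_ofReal_mul, Complex.neg_re]
    nlinarith
  · rw [norm_mul, norm_neg, Complex.norm_real, Real.norm_of_nonneg log_nonneg, mul_comm]

theorem log_prime_sq_mul_le : Real.log p ^ 2 * (1 / p) ≤ 16 * (p : ℝ) ^ (-(1 / 2) : ℝ) := by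
  have hp : (0 : ℝ) < p := by exact_mod_cast p.2.pos
  have log_le : Real.log p ≤ 4 * (p : ℝ) ^ (1 / 4 : ℝ) := by
    have := Real.log_le_rpow_div hp.le (ε := 1 / 4) (by norm_num)
    linarith
  calc Real.log p ^ 2 * (1 / p) ≤ (4 * (p : ℝ) ^ (1 / 4 : ℝ)) ^ 2 * (1 / p) := by
        have : 0 ≤ Real.log p := Real.log_natCast_nonneg _
        gcongr
    _ = 16 * (((p : ℝ) ^ (1 / 4 : ℝ)) ^ (2 : ℝ) * (p : ℝ) ^ (-1 : ℝ)) := by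
        rw [Real.rpow_neg_one, Real.rpow_ofNat]; ring
    _ = 16 * (p : ℝ) ^ (-(1 / 2) : ℝ) := by
        rw [← Real.rpow_mul hp.le, ← Real.rpow_add hp]; norm_num

theorem sum_norm_primeTwist_sub_one_mul_le {ι : Type*} [Fintype ι] {z z' : ι → ℂ}
    (hz : ∀ i, 0 ≤ (z i).re) (hz' : ∀ i, 0 ≤ (z' i).re) :
    (∑ i, ‖primeTwist z p i - 1‖ * ‖primeTwist z' p i - 1‖) * (1 / p) ≤
      16 * (∑ i, ‖z i‖ * ‖z' i‖) * (p : ℝ) ^ (-(1 / 2) : ℝ) :=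
  calc (∑ i, ‖primeTwist z p i - 1‖ * ‖primeTwist z' p i - 1‖) * (1 / p)
      ≤ (∑ i, ‖z i‖ * Real.log p * (‖z' i‖ * Real.log p)) * (1 / p) := by
        have : 0 ≤ Real.log p := Real.log_natCast_nonneg _
        gcongr with i
        · exact norm_primeTwist_sub_one_le p (hz i)
        · exact norm_primeTwist_sub_one_le p (hz' i)
    _ = (∑ i, ‖z i‖ * ‖z' i‖) * (Real.log p ^ 2 * (1 / p)) := by
        simp_rw [mul_mul_mul_comm ‖z _‖, ← Finset.sum_mul]
        ring
    _ ≤ (∑ i, ‖z i‖ * ‖z' i‖) * (16 * (p : ℝ) ^ (-(1 / 2) : ℝ)) :=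
        mul_le_mul_of_nonneg_left (log_prime_sq_mul_le p)
          (Finset.sum_nonneg fun _ _ => by positivity)
    _ = 16 * (∑ i, ‖z i‖ * ‖z' i‖) * (p : ℝ) ^ (-(1 / 2) : ℝ) := by ring

end PrimeTwist

namespace AffineSystem

variable {d t : ℕ}

/-- The term `p^{-1/2}` of `exceptionalSum` at an exceptional prime `p`, and `0` at all others. -/
noncomputable def exceptionalWeight (Ψ : AffineSystem d t) (p : Nat.Primes) : ℝ :=
  Ψ.exceptionalPrimes.indicator (fun n : ℕ => (n : ℝ) ^ (-(1 / 2) : ℝ)) p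

section ExceptionalWeight

variable {Ψ : AffineSystem d t} {p : Nat.Primes}

theorem exceptionalWeight_of_mem (h : (p : ℕ) ∈ Ψ.exceptionalPrimes) :
    Ψ.exceptionalWeight p = (p : ℝ) ^ (-(1 / 2) : ℝ) :=
  Set.indicator_of_mem h _

theorem exceptionalWeight_nonneg (Ψ : AffineSystem d t) (p : Nat.Primes) :
    0 ≤ Ψ.exceptionalWeight p :=
  Set.indicator_nonneg (fun _ _ => by positivity) _

theorem sum_exceptionalWeight_le (h : Ψ.exceptionalPrimes.Finite) (P : Finset Nat.Primes) :
    ∑ p ∈ P, Ψ.exceptionalWeight p ≤ Ψ.exceptionalSum := by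
  set w : ℕ → ℝ := Ψ.exceptionalPrimes.indicator fun n => (n : ℝ) ^ (-(1 / 2) : ℝ)
  have hw : Summable w := summable_of_hasFiniteSupport (h.subset Set.support_indicator_subset)
  calc ∑ p ∈ P, Ψ.exceptionalWeight p = ∑ n ∈ P.map ⟨_, Subtype.val_injective⟩, w n :=
        (Finset.sum_map P ⟨_, Subtype.val_injective⟩ w).symm
    _ ≤ ∑' n, w n :=
        hw.sum_le_tsum _ fun _ _ => Set.indicator_nonneg (fun _ _ => by positivity) _
    _ = Ψ.exceptionalSum := (tsum_subtype _ _).symm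

end ExceptionalWeight

theorem exists_norm_twistedFactor_le (t : ℕ) (ht : 2 ≤ t) : ∃ C : ℝ, 1 ≤ C ∧
    ∀ (d : ℕ) (Ψ : AffineSystem d t) (p : Nat.Primes) (u u' : Fin t → ℂ), (∀ i, ‖u i‖ ≤ 1) →
      (∀ i, ‖u' i‖ ≤ 1) → Ψ.localFactor p ≠ 0 →
      ‖Ψ.twistedFactor p u u'‖ ≤ 1 + C * ((1 / (p : ℝ)) ^ 2 + Ψ.exceptionalWeight p) := by
  obtain ⟨C, hC, bound⟩ := exists_twistedFactor_bound t ht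
  refine ⟨C, hC, fun d Ψ p u u' hu hu' hΨ => ?_⟩
  obtain ⟨sub_one_le, sub_one_le_sq, -⟩ := bound d Ψ p u u' hu hu' hΨ
  suffices ‖Ψ.twistedFactor p u u' - 1‖ ≤ C * ((1 / (p : ℝ)) ^ 2 + Ψ.exceptionalWeight p) by
    have := norm_sub_norm_le (Ψ.twistedFactor p u u') 1
    rw [norm_one] at this
    linarith
  by_cases hp : (p : ℕ) ∈ Ψ.exceptionalPrimes
  · have one_div_le : 1 / (p : ℝ) ≤ (p : ℝ) ^ (-(1 / 2) : ℝ) := by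
      rw [one_div, ← Real.rpow_neg_one]
      exact Real.rpow_le_rpow_of_exponent_le (by exact_mod_cast p.2.one_le) (by norm_num)
    rw [exceptionalWeight_of_mem hp]
    exact sub_one_le.trans (by gcongr; exact le_add_of_nonneg_of_le (by positivity) one_div_le)
  · exact (sub_one_le_sq hp).trans (by
      gcongr; exact le_add_of_nonneg_right (Ψ.exceptionalWeight_nonneg p))

-- Away from the exceptional primes, the bound `O(p⁻²)`, which does not see the twists, is
-- interpolated with the bound `O(s p^{-1/2})`, which is not summable.
theorem exists_norm_twistedFactor_primeTwist_sub_le (t : ℕ) (ht : 2 ≤ t) : ∃ C : ℝ, 1 ≤ C ∧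
    ∀ (d : ℕ) (Ψ : AffineSystem d t) (p : Nat.Primes) (z z' : Fin t → ℂ), (∀ i, 0 ≤ (z i).re) →
      (∀ i, 0 ≤ (z' i).re) → Ψ.localFactor p ≠ 0 →
      ‖Ψ.twistedFactor p (primeTwist z p) (primeTwist z' p) - Ψ.localFactor p‖ ≤
        C * (√(∑ i, ‖z i‖ * ‖z' i‖) * (p : ℝ) ^ (-(5 / 4) : ℝ) +
          (∑ i, ‖z i‖ * ‖z' i‖) * Ψ.exceptionalWeight p) := by
  obtain ⟨C, hC, bound⟩ := exists_twistedFactor_bound t ht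
  refine ⟨16 * C, by linarith, fun d Ψ p z z' hz hz' hΨ => ?_⟩
  have hp : (0 : ℝ) < p := by exact_mod_cast p.2.pos
  set F := Ψ.twistedFactor p (primeTwist z p) (primeTwist z' p)
  set s := ∑ i, ‖z i‖ * ‖z' i‖
  have hs : 0 ≤ s := Finset.sum_nonneg fun _ _ => by positivity
  obtain ⟨-, sub_one_le, sub_le⟩ := bound d Ψ p (primeTwist z p) (primeTwist z' p)
    (fun i => norm_primeTwist_le_one p (hz i)) (fun i => norm_primeTwist_le_one p (hz' i)) hΨ
  have sub_le_half : ‖F - Ψ.localFactor p‖ ≤ 16 * C * s * (p : ℝ) ^ (-(1 / 2) : ℝ) := by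
    rw [mul_assoc] at sub_le
    refine (sub_le.trans (mul_le_mul_of_nonneg_left
      (sum_norm_primeTwist_sub_one_mul_le p hz hz') (by linarith))).trans_eq (by ring)
  by_cases hexc : (p : ℕ) ∈ Ψ.exceptionalPrimes
  · rw [exceptionalWeight_of_mem hexc, mul_add, ← mul_assoc (16 * C) s]
    exact le_add_of_nonneg_of_le (by positivity) sub_le_half
  · have sub_le_sq : ‖F - Ψ.localFactor p‖ ≤ 2 * C * (1 / (p : ℝ)) ^ 2 := by
      have one_sub_le := (bound d Ψ p 1 1 (by simp) (by simp) hΨ).2.1 hexc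
      rw [twistedFactor_one, norm_sub_rev] at one_sub_le
      exact (norm_sub_le_norm_sub_add_norm_sub F 1 _).trans
        ((add_le_add (sub_one_le hexc) one_sub_le).trans_eq (by ring))
    refine (le_sqrt_mul_rpow_of_le hp hs (by linarith) (norm_nonneg _)
      (sub_le_sq.trans (by gcongr; norm_num)) sub_le_half).trans ?_
    gcongr
    exact le_add_of_nonneg_right (mul_nonneg hs (Ψ.exceptionalWeight_nonneg p))

theorem prod_one_add_exceptionalWeight_le {Ψ : AffineSystem d t} {C : ℝ} (hC : 0 ≤ C)
    (h : Ψ.exceptionalPrimes.Finite) (P : Finset Nat.Primes) :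
    ∏ p ∈ P, (1 + C * ((1 / (p : ℝ)) ^ 2 + Ψ.exceptionalWeight p)) ≤
      Real.exp (C * (1 + ∑' p : Nat.Primes, (1 / (p : ℝ)) ^ 2) * (1 + Ψ.exceptionalSum)) := by
  set K := ∑' p : Nat.Primes, (1 / (p : ℝ)) ^ 2
  have hK : 0 ≤ K := tsum_nonneg fun _ => by positivity
  refine (Real.prod_one_add_le_exp_sum _ fun p => ?_).trans (Real.exp_le_exp.2 ?_)
  · have := Ψ.exceptionalWeight_nonneg p
    positivity
  · calc ∑ p ∈ P, C * ((1 / (p : ℝ)) ^ 2 + Ψ.exceptionalWeight p)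
        ≤ C * (K + Ψ.exceptionalSum) := by
          rw [← Finset.mul_sum, Finset.sum_add_distrib]
          gcongr
          · exact summable_one_div_prime_sq.sum_le_tsum P fun _ _ => by positivity
          · exact sum_exceptionalWeight_le h P
      _ ≤ C * ((1 + K) * (1 + Ψ.exceptionalSum)) := by
          gcongr
          nlinarith [Ψ.exceptionalSum_nonneg]
      _ = C * (1 + K) * (1 + Ψ.exceptionalSum) := by ring

theorem sum_rpow_add_exceptionalWeight_le {Ψ : AffineSystem d t} {C s s' : ℝ} (hC : 0 ≤ C)
    (hs : 0 ≤ s) (hs' : 0 ≤ s') (h : Ψ.exceptionalPrimes.Finite) (P : Finset Nat.Primes) :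
    ∑ p ∈ P, C * (s * (p : ℝ) ^ (-(5 / 4) : ℝ) + s' * Ψ.exceptionalWeight p) ≤
      C * (1 + ∑' p : Nat.Primes, (p : ℝ) ^ (-(5 / 4) : ℝ)) * (1 + Ψ.exceptionalSum) *
        (s + s') := by
  set K := ∑' p : Nat.Primes, (p : ℝ) ^ (-(5 / 4) : ℝ)
  have hK : 0 ≤ K := tsum_nonneg fun _ => by positivity
  have hX := Ψ.exceptionalSum_nonneg
  calc ∑ p ∈ P, C * (s * (p : ℝ) ^ (-(5 / 4) : ℝ) + s' * Ψ.exceptionalWeight p)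
      ≤ C * (s * K + s' * Ψ.exceptionalSum) := by
        rw [← Finset.mul_sum, Finset.sum_add_distrib, ← Finset.mul_sum, ← Finset.mul_sum]
        gcongr
        · exact (Nat.Primes.summable_rpow.2 (by norm_num)).sum_le_tsum P fun _ _ => by positivity
        · exact sum_exceptionalWeight_le h P
    _ ≤ C * (s * ((1 + K) * (1 + Ψ.exceptionalSum)) +
          s' * ((1 + K) * (1 + Ψ.exceptionalSum))) := by
        gcongr <;> nlinarith
    _ = C * (1 + K) * (1 + Ψ.exceptionalSum) * (s + s') := by ring

theorem exists_prod_twistedFactor_bound (t : ℕ) (ht : 2 ≤ t) : ∃ C : ℝ, 1 ≤ C ∧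
    ∀ (d : ℕ) (Ψ : AffineSystem d t) (P : Finset Nat.Primes) (z z' : Fin t → ℂ),
      Ψ.Admissible → (∀ i, 0 ≤ (z i).re) → (∀ i, 0 ≤ (z' i).re) →
      ‖∏ p ∈ P, Ψ.twistedFactor p (primeTwist z p) (primeTwist z' p)‖ ≤
        Real.exp (C * (1 + Ψ.exceptionalSum)) ∧
      ‖∏ p ∈ P, Ψ.twistedFactor p (primeTwist z p) (primeTwist z' p) -
          ∏ p ∈ P, (Ψ.localFactor p : ℂ)‖ ≤
        Real.exp (C * (1 + Ψ.exceptionalSum)) * (C * (1 + Ψ.exceptionalSum) *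
          (√(∑ i, ‖z i‖ * ‖z' i‖) + ∑ i, ‖z i‖ * ‖z' i‖)) := by
  obtain ⟨C₁, hC₁, norm_le⟩ := exists_norm_twistedFactor_le t ht
  obtain ⟨C₂, hC₂, sub_le⟩ := exists_norm_twistedFactor_primeTwist_sub_le t ht
  set K₁ := ∑' p : Nat.Primes, (1 / (p : ℝ)) ^ 2
  set K₂ := ∑' p : Nat.Primes, (p : ℝ) ^ (-(5 / 4) : ℝ)
  have hK₁ : 0 ≤ K₁ := tsum_nonneg fun _ => by positivity
  refine ⟨max (C₁ * (1 + K₁)) (C₂ * (1 + K₂)), le_max_of_le_left (by nlinarith),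
    fun d Ψ P z z' hΨ hz hz' => ?_⟩
  have hfin := hΨ.1.finite_exceptionalPrimes
  have hX := Ψ.exceptionalSum_nonneg
  set m : Nat.Primes → ℝ := fun p => 1 + C₁ * ((1 / (p : ℝ)) ^ 2 + Ψ.exceptionalWeight p)
  have one_le : ∀ p, 1 ≤ m p := fun p => le_add_of_nonneg_right <|
    mul_nonneg (by linarith) (add_nonneg (by positivity) (Ψ.exceptionalWeight_nonneg p))
  have twisted_le : ∀ p, ‖Ψ.twistedFactor p (primeTwist z p) (primeTwist z' p)‖ ≤ m p := fun p =>
    norm_le d Ψ p _ _ (fun i => norm_primeTwist_le_one p (hz i))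
      (fun i => norm_primeTwist_le_one p (hz' i)) (hΨ.2 p)
  have local_le : ∀ p, ‖(Ψ.localFactor p : ℂ)‖ ≤ m p := fun p => by
    rw [← twistedFactor_one]
    exact norm_le d Ψ p _ _ (by simp) (by simp) (hΨ.2 p)
  have prod_le := (prod_one_add_exceptionalWeight_le (by linarith) hfin P).trans <|
    Real.exp_le_exp.2 <| mul_le_mul_of_nonneg_right
      (le_max_left (C₁ * (1 + K₁)) (C₂ * (1 + K₂))) (by linarith)
  refine ⟨(norm_prod_le_prod_of_le P fun p _ => twisted_le p).trans prod_le, ?_⟩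
  refine (norm_prod_sub_prod_le P (fun p _ => one_le p) (fun p _ => twisted_le p)
    fun p _ => local_le p).trans (mul_le_mul prod_le ?_ (by positivity) (by positivity))
  refine ((Finset.sum_le_sum fun p _ => sub_le d Ψ p z z' hz hz' (hΨ.2 p)).trans
    (sum_rpow_add_exceptionalWeight_le (by linarith) (by positivity) (by positivity)
      hfin P)).trans ?_
  gcongr
  exact le_max_right _ _

/-! ### The singular series -/

section SingularSeries

variable {Ψ : AffineSystem d t} {p : Nat.Primes}

theorem multipliable_localFactor (ht : 2 ≤ t) (hΨ : Ψ.Admissible) :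
    Multipliable Ψ.localFactor := by
  obtain ⟨C, -, bound⟩ := exists_twistedFactor_bound t ht
  have finite_preimage : ((fun p : Nat.Primes => (p : ℕ)) ⁻¹' Ψ.exceptionalPrimes).Finite :=
    hΨ.1.finite_exceptionalPrimes.preimage Subtype.val_injective.injOn
  have summable_sub_one : Summable fun p => Ψ.localFactor p - 1 := by
    refine (summable_one_div_prime_sq.mul_left C).of_norm_bounded_eventually ?_
    filter_upwards [finite_preimage.compl_mem_cofinite] with p hp
    have sub_one_le := (bound d Ψ p 1 1 (by simp) (by simp) (hΨ.2 p)).2.1 hp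
    rwa [twistedFactor_one, ← Complex.ofReal_one, ← Complex.ofReal_sub,
      Complex.norm_real] at sub_one_le
  simpa using Real.multipliable_one_add_of_summable summable_sub_one

theorem tendsto_prod_localFactor (ht : 2 ≤ t) (hΨ : Ψ.Admissible) :
    Filter.Tendsto (fun P : Finset Nat.Primes => ∏ p ∈ P, Ψ.localFactor p) Filter.atTop
      (nhds (∏' p, Ψ.localFactor p)) := by
  simpa [HasProd] using (multipliable_localFactor ht hΨ).hasProd

theorem one_sub_zeroInd_nonneg (Ψ : AffineSystem d t) {K : Type*} [CommRing K] (i : Fin t)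
    (a : Fin d → K) : 0 ≤ 1 - Ψ.zeroInd K i a :=
  sub_nonneg.2 (Ψ.zeroInd_le_one K i a)

theorem one_add_one_div_prime_le (p : Nat.Primes) : 1 + 1 / (p : ℝ) ≤ p / (p - 1 : ℝ) := by
  have hp : (1 : ℝ) < p := by exact_mod_cast p.2.one_lt
  rw [le_div_iff₀ (by linarith)]
  field_simp
  nlinarith

theorem one_add_mul_one_div_prime_le_pow (t : ℕ) (p : Nat.Primes) :
    1 + t * (1 / (p : ℝ)) ≤ (p / (p - 1 : ℝ)) ^ t :=
  (one_add_mul_le_pow (le_trans (by norm_num) (by positivity : 0 ≤ 1 / (p : ℝ))) t).trans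
    (pow_le_pow_left₀ (by positivity) (one_add_one_div_prime_le p) t)

theorem one_div_pow_le_localFactor (h : Ψ.localFactor p ≠ 0) :
    (1 / (p : ℝ)) ^ d ≤ Ψ.localFactor p := by
  rw [localFactor_eq] at h ⊢
  obtain ⟨a, -, ha⟩ := Finset.exists_ne_zero_of_expect_ne_zero (left_ne_zero_of_mul h)
  have prod_eq_one : ∏ i, (1 - Ψ.zeroInd (ZMod p) i a) = 1 := by
    refine Finset.prod_eq_one fun i _ => ?_
    have := Finset.prod_ne_zero_iff.1 ha i (Finset.mem_univ i)
    unfold zeroInd at this ⊢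
    split_ifs at this ⊢ <;> simp_all
  have one_le_sum : 1 ≤ ∑ a, ∏ i, (1 - Ψ.zeroInd (ZMod p) i a) :=
    prod_eq_one.ge.trans (Finset.single_le_sum
      (f := fun a => ∏ i, (1 - Ψ.zeroInd (ZMod p) i a))
      (fun a _ => Finset.prod_nonneg fun i _ => Ψ.one_sub_zeroInd_nonneg i a)
      (Finset.mem_univ a))
  have expect_ge : (1 / (p : ℝ)) ^ d ≤ 𝔼 a, ∏ i, (1 - Ψ.zeroInd (ZMod p) i a) := by
    rw [Fintype.expect_eq_sum_div_card, Fintype.card_pi_const, ZMod.card, one_div_pow]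
    push_cast
    gcongr
  have one_le_pow : 1 ≤ ((p : ℝ) / (p - 1)) ^ t :=
    (le_add_of_nonneg_right (by positivity)).trans (one_add_mul_one_div_prime_le_pow t p)
  exact expect_ge.trans (le_mul_of_one_le_right (le_trans (by positivity) expect_ge) one_le_pow)

theorem localFactor_pos (h : Ψ.localFactor p ≠ 0) : 0 < Ψ.localFactor p :=
  have hp : (0 : ℝ) < p := by exact_mod_cast p.2.pos
  lt_of_lt_of_le (by positivity) (one_div_pow_le_localFactor h)

theorem one_sub_sq_le_localFactor (h : Ψ.localFactor p ≠ 0) :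
    1 - t ^ 2 * (1 / (p : ℝ)) ^ 2 ≤ Ψ.localFactor p := by
  set x := 1 / (p : ℝ)
  by_cases hlarge : 1 ≤ t * x
  · exact le_trans (by nlinarith) (localFactor_pos h).le
  have expect_ge : 1 - t * x ≤ 𝔼 a, ∏ i, (1 - Ψ.zeroInd (ZMod p) i a) := by
    calc 1 - t * x = 1 - ∑ _i : Fin t, x := by simp
      _ ≤ 1 - ∑ i, 𝔼 a, Ψ.zeroInd (ZMod p) i a :=
          sub_le_sub_left (Finset.sum_le_sum fun i _ => expect_zeroInd_le h i) _
      _ = 𝔼 a, (1 - ∑ i, Ψ.zeroInd (ZMod p) i a) := by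
          rw [Finset.expect_sub_distrib, Finset.expect_sum_comm, Fintype.expect_const]
      _ ≤ 𝔼 a, ∏ i, (1 - Ψ.zeroInd (ZMod p) i a) := Finset.expect_le_expect fun a _ =>
          one_sub_sum_le_prod_one_sub _ (fun i _ => Ψ.zeroInd_nonneg _ i a)
            fun i _ => Ψ.zeroInd_le_one _ i a
  rw [localFactor_eq]
  calc 1 - t ^ 2 * x ^ 2 = (1 - t * x) * (1 + t * x) := by ring
    _ ≤ _ := mul_le_mul expect_ge (one_add_mul_one_div_prime_le_pow t p) (by positivity)
        (le_trans (by linarith) expect_ge)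

end SingularSeries

theorem exists_prod_localFactor_ge (d t : ℕ) : ∃ c : ℝ, 0 < c ∧
    ∀ (Ψ : AffineSystem d t) (P : Finset Nat.Primes), (∀ p, Ψ.localFactor p ≠ 0) →
      c ≤ ∏ p ∈ P, Ψ.localFactor p := by
  classical
  obtain ⟨S, hS⟩ := summable_iff_vanishing_norm.1
    (summable_one_div_prime_sq.mul_left ((t : ℝ) ^ 2)) (1 / 2) (by norm_num)
  have pow_pos : ∀ p : Nat.Primes, 0 < (1 / (p : ℝ)) ^ d := fun p => by
    have : (0 : ℝ) < p := by exact_mod_cast p.2.pos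
    positivity
  have pow_le_one : ∀ p : Nat.Primes, (1 / (p : ℝ)) ^ d ≤ 1 := fun p =>
    pow_le_one₀ (by positivity) (div_le_one_of_le₀ (by exact_mod_cast p.2.one_le) (by positivity))
  refine ⟨(∏ p ∈ S, (1 / (p : ℝ)) ^ d) * (1 / 2),
    mul_pos (Finset.prod_pos fun p _ => pow_pos p) (by norm_num), fun Ψ P hΨ => ?_⟩
  have small_primes : ∏ p ∈ S, (1 / (p : ℝ)) ^ d ≤ ∏ p ∈ P ∩ S, Ψ.localFactor p :=
    (Finset.prod_le_prod_of_subset_of_le_one Finset.inter_subset_right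
      (fun p _ => (pow_pos p).le) fun p _ _ => pow_le_one p).trans
      (Finset.prod_le_prod (fun p _ => (pow_pos p).le)
        fun p _ => one_div_pow_le_localFactor (hΨ p))
  have large_primes : (1 : ℝ) / 2 ≤ ∏ p ∈ P \ S, Ψ.localFactor p := by
    have sum_lt : ∑ p ∈ P \ S, (t : ℝ) ^ 2 * (1 / (p : ℝ)) ^ 2 < 1 / 2 :=
      (le_abs_self _).trans_lt (hS _ Finset.sdiff_disjoint)
    have term_le : ∀ p ∈ P \ S, (t : ℝ) ^ 2 * (1 / (p : ℝ)) ^ 2 ≤ 1 := fun p hp =>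
      (Finset.single_le_sum (f := fun p : Nat.Primes => (t : ℝ) ^ 2 * (1 / (p : ℝ)) ^ 2)
        (fun _ _ => by positivity) hp).trans (by linarith)
    calc (1 : ℝ) / 2 ≤ 1 - ∑ p ∈ P \ S, (t : ℝ) ^ 2 * (1 / (p : ℝ)) ^ 2 := by linarith
      _ ≤ ∏ p ∈ P \ S, (1 - (t : ℝ) ^ 2 * (1 / (p : ℝ)) ^ 2) :=
          one_sub_sum_le_prod_one_sub _ (fun _ _ => by positivity) term_le
      _ ≤ ∏ p ∈ P \ S, Ψ.localFactor p :=
          Finset.prod_le_prod (fun p hp => by linarith [term_le p hp])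
            fun p _ => one_sub_sq_le_localFactor (hΨ p)
  rw [← Finset.prod_inter_mul_prod_sdiff P S]
  exact mul_le_mul small_primes large_primes (by norm_num)
    (Finset.prod_nonneg fun p _ => (localFactor_pos (hΨ p)).le)

end AffineSystem

/-! ### Fourier representation of the weight -/

section FourierDensity

open MeasureTheory Filter

/-- The point `1 - 2πiv` of the line `Re = 1`. -/
noncomputable def lineOne (v : ℝ) : ℂ := 1 - 2 * Real.pi * v * Complex.I

@[simp]
theorem lineOne_re (v : ℝ) : (lineOne v).re = 1 := by simp [lineOne]

theorem continuous_lineOne : Continuous lineOne := by unfold lineOne; fun_prop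

theorem one_le_norm_lineOne (v : ℝ) : 1 ≤ ‖lineOne v‖ := by
  simpa using Complex.abs_re_le_norm (lineOne v)

theorem norm_lineOne_le (v : ℝ) : ‖lineOne v‖ ≤ 1 + 2 * Real.pi * |v| := by
  refine (norm_sub_le _ _).trans_eq ?_
  simp [abs_of_pos Real.pi_pos]

theorem norm_exp_neg_lineOne_mul (v x : ℝ) :
    ‖Complex.exp (-lineOne v * x)‖ = Real.exp (-x) := by
  rw [Complex.norm_exp]; simp

theorem norm_lineOne_pow_le (v : ℝ) (k : ℕ) :
    ‖lineOne v‖ ^ k ≤ 2 ^ k * (1 + (2 * Real.pi) ^ k * ‖v‖ ^ k) :=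
  calc ‖lineOne v‖ ^ k ≤ (1 + 2 * Real.pi * |v|) ^ k :=
        pow_le_pow_left₀ (norm_nonneg _) (norm_lineOne_le v) k
    _ ≤ 2 ^ (k - 1) * (1 ^ k + (2 * Real.pi * |v|) ^ k) :=
        add_pow_le zero_le_one (by positivity) k
    _ ≤ 2 ^ k * (1 ^ k + (2 * Real.pi * |v|) ^ k) := by
        gcongr
        · norm_num
        · omega
    _ = 2 ^ k * (1 + (2 * Real.pi) ^ k * ‖v‖ ^ k) := by
        rw [one_pow, mul_pow, Real.norm_eq_abs]

theorem integrable_norm_mul_norm_lineOne_pow (φ : SchwartzMap ℝ ℂ) (k : ℕ) :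
    Integrable fun v => ‖φ v‖ * ‖lineOne v‖ ^ k := by
  have majorant_integrable :
      Integrable fun v => (2 ^ k : ℝ) * (‖φ v‖ + (2 * Real.pi) ^ k * (‖v‖ ^ k * ‖φ v‖)) :=
    (φ.integrable.norm.add ((φ.integrable_pow_mul volume k).const_mul _)).const_mul _
  refine majorant_integrable.mono
    (φ.continuous.norm.mul (continuous_lineOne.norm.pow k)).aestronglyMeasurable
    (Eventually.of_forall fun v => ?_)
  rw [Real.norm_of_nonneg (by positivity), Real.norm_of_nonneg (by positivity)]
  calc ‖φ v‖ * ‖lineOne v‖ ^ k ≤ ‖φ v‖ * (2 ^ k * (1 + (2 * Real.pi) ^ k * ‖v‖ ^ k)) := by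
        gcongr
        exact norm_lineOne_pow_le v k
    _ = 2 ^ k * (‖φ v‖ + (2 * Real.pi) ^ k * (‖v‖ ^ k * ‖φ v‖)) := by ring

/-- `φ` is a rapidly decaying density with `χ(x) = ∫ φ(v) e^{-(1 - 2πiv)x} dv`: up to the factor
`e^x`, the Fourier expansion of the cut-off `χ`. -/
structure IsFourierDensity (φ : ℝ → ℂ) (χ : ℝ → ℝ) : Prop where
  continuous : Continuous φ
  integrable : ∀ k : ℕ, Integrable fun v => ‖φ v‖ * ‖lineOne v‖ ^ k
  eq_integral : ∀ x : ℝ, (χ x : ℂ) = ∫ v, φ v * Complex.exp (-lineOne v * x)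

theorem exists_isFourierDensity {χ : ℝ → ℝ} (hχ : ContDiff ℝ ∞ χ) (hsupp : HasCompactSupport χ) :
    ∃ φ, IsFourierDensity φ χ := by
  have g_supp : HasCompactSupport fun x : ℝ => ((Real.exp x * χ x : ℝ) : ℂ) :=
    (hsupp.mul_left (f := Real.exp)).comp_left (g := fun r : ℝ => (r : ℂ)) Complex.ofReal_zero
  have g_smooth : ContDiff ℝ ∞ fun x : ℝ => ((Real.exp x * χ x : ℝ) : ℂ) :=
    Complex.ofRealCLM.contDiff.comp (Real.contDiff_exp.mul hχ)
  set g := g_supp.toSchwartzMap g_smooth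
  set φ := FourierTransform.fourier g
  refine ⟨φ, φ.continuous, integrable_norm_mul_norm_lineOne_pow φ, fun x => ?_⟩
  have g_eq : g x = ∫ v, Complex.exp (↑(2 * Real.pi * inner ℝ v x) * Complex.I) • φ v := by
    rw [← Real.fourierInv_eq', ← SchwartzMap.fourierInv_coe,
      FourierTransform.fourierInv_fourier_eq]
  have χ_eq : (χ x : ℂ) = Complex.exp (-x) * g x := by
    rw [show g x = ((Real.exp x * χ x : ℝ) : ℂ) from rfl]
    push_cast
    rw [← mul_assoc, ← Complex.exp_add, neg_add_cancel, Complex.exp_zero, one_mul]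
  rw [χ_eq, g_eq, ← integral_const_mul]
  congr 1 with v
  rw [smul_eq_mul, ← mul_assoc, ← Complex.exp_add, mul_comm]
  congr 2
  simp only [lineOne, RCLike.inner_apply, conj_trivial, Complex.ofReal_mul, Complex.ofReal_ofNat]
  ring

namespace IsFourierDensity

variable {φ : ℝ → ℂ} {χ : ℝ → ℝ}

theorem integrable_mul_exp (h : IsFourierDensity φ χ) (x : ℝ) :
    Integrable fun v => φ v * Complex.exp (-lineOne v * x) := by
  refine ((h.integrable 0).mul_const (Real.exp (-x))).mono ?_ (Eventually.of_forall fun v => ?_)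
  · have := continuous_lineOne
    have := h.continuous
    exact (by fun_prop : Continuous _).aestronglyMeasurable
  · rw [norm_mul, norm_exp_neg_lineOne_mul, Real.norm_of_nonneg (by positivity), pow_zero, mul_one]

theorem integrable_mul_lineOne (h : IsFourierDensity φ χ) :
    Integrable fun v => φ v * lineOne v := by
  refine (h.integrable 1).mono (h.continuous.mul continuous_lineOne).aestronglyMeasurable
    (Eventually.of_forall fun v => ?_)
  rw [norm_mul, pow_one, norm_mul, norm_norm, norm_norm]

theorem hasDerivAt (h : IsFourierDensity φ χ) (x : ℝ) :
    HasDerivAt (fun x => (χ x : ℂ))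
      (∫ v, φ v * (-lineOne v * Complex.exp (-lineOne v * x))) x := by
  have := continuous_lineOne
  have := h.continuous
  rw [funext h.eq_integral]
  refine (hasDerivAt_integral_of_dominated_loc_of_deriv_le (s := Set.Ioi (x - 1))
    (F := fun (y : ℝ) v => φ v * Complex.exp (-lineOne v * y))
    (F' := fun (y : ℝ) v => φ v * (-lineOne v * Complex.exp (-lineOne v * y)))
    (bound := fun v => ‖φ v‖ * ‖lineOne v‖ ^ 1 * Real.exp (-(x - 1)))
    (Ioi_mem_nhds (by linarith)) (Eventually.of_forall fun y => ?_)
    (h.integrable_mul_exp x) ?_ (Eventually.of_forall fun v y hy => ?_)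
    ((h.integrable 1).mul_const _) (Eventually.of_forall fun v y _ => ?_)).2
  · exact (by fun_prop : Continuous _).aestronglyMeasurable
  · exact (by fun_prop : Continuous _).aestronglyMeasurable
  · rw [norm_mul, norm_mul, norm_exp_neg_lineOne_mul, norm_neg, pow_one, mul_assoc]
    gcongr
    exact le_of_lt hy
  · have linear : HasDerivAt (fun y : ℝ => -lineOne v * (y : ℂ)) (-lineOne v) y := by
      simpa using (Complex.ofRealCLM.hasDerivAt (x := y)).const_mul (-lineOne v)
    exact (linear.cexp.const_mul (φ v)).congr_deriv (by ring)

theorem ofReal_deriv (h : IsFourierDensity φ χ) (hχ : Differentiable ℝ χ) (x : ℝ) :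
    ((deriv χ x : ℝ) : ℂ) = ∫ v, φ v * (-lineOne v * Complex.exp (-lineOne v * x)) :=
  ((hχ x).hasDerivAt.ofReal_comp).unique (h.hasDerivAt x)

theorem ofReal_deriv_sq (h : IsFourierDensity φ χ) (hχ : Differentiable ℝ χ) (x : ℝ) :
    ((deriv χ x ^ 2 : ℝ) : ℂ) = ∫ q : ℝ × ℝ, φ q.1 * lineOne q.1 * (φ q.2 * lineOne q.2) *
      Complex.exp (-(lineOne q.1 + lineOne q.2) * x) := by
  rw [Complex.ofReal_pow, h.ofReal_deriv hχ, sq, ← integral_prod_mul, ← Measure.volume_eq_prod]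
  congr 1 with q
  rw [neg_add, add_mul, Complex.exp_add]
  ring

theorem integrable_prod_exp (h : IsFourierDensity φ χ) :
    Integrable (Function.uncurry fun (x : ℝ) (q : ℝ × ℝ) =>
      φ q.1 * lineOne q.1 * (φ q.2 * lineOne q.2) *
        Complex.exp (-(lineOne q.1 + lineOne q.2) * x))
      ((volume.restrict (Set.Ioi 0)).prod volume) := by
  have := continuous_lineOne
  have := h.continuous
  have exp_integrable : Integrable (fun x : ℝ => Real.exp (-2 * x)) (volume.restrict (Set.Ioi 0)) :=
    exp_neg_integrableOn_Ioi 0 (by norm_num)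
  have norm_integrable := h.integrable_mul_lineOne.norm
  refine (exp_integrable.mul_prod (norm_integrable.mul_prod norm_integrable)).mono
    (by unfold Function.uncurry; fun_prop : Continuous _).aestronglyMeasurable
    (Eventually.of_forall fun y => le_of_eq ?_)
  simp only [Function.uncurry, norm_mul, abs_norm, Complex.norm_exp, Real.norm_eq_abs,
    Real.abs_exp, neg_add, add_mul, Complex.add_re, Complex.re_mul_ofReal, Complex.neg_re,
    lineOne_re]
  ring_nf

theorem integral_prod_eq (h : IsFourierDensity φ χ) (hχ : Differentiable ℝ χ) :
    ∫ q : ℝ × ℝ, φ q.1 * φ q.2 * (lineOne q.1 * lineOne q.2 / (lineOne q.1 + lineOne q.2)) =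
      ((∫ x in Set.Ioi (0 : ℝ), deriv χ x ^ 2 : ℝ) : ℂ) := by
  rw [← integral_complex_ofReal]
  simp_rw [h.ofReal_deriv_sq hχ]
  rw [integral_integral_swap h.integrable_prod_exp]
  congr 1 with q
  have re_neg : (-(lineOne q.1 + lineOne q.2)).re < 0 := by simp
  have sum_ne_zero : lineOne q.1 + lineOne q.2 ≠ 0 := fun h₀ => by simp [h₀] at re_neg
  rw [integral_const_mul, integral_exp_mul_complex_Ioi re_neg]
  simp only [Complex.ofReal_zero, mul_zero, Complex.exp_zero]
  field_simp

end IsFourierDensity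

theorem integral_deriv_sq_pos {χ : ℝ → ℝ} (hχ : ContDiff ℝ 1 χ) (hsupp : HasCompactSupport χ)
    (h₀ : χ 0 ≠ 0) : 0 < ∫ x in Set.Ioi (0 : ℝ), deriv χ x ^ 2 := by
  have deriv_continuous : Continuous (deriv χ) := hχ.continuous_deriv_one
  have sq_hasCompactSupport : HasCompactSupport fun x => deriv χ x ^ 2 :=
    hsupp.deriv.comp_left (g := fun r : ℝ => r ^ 2) (zero_pow two_ne_zero)
  have sq_integrable : Integrable fun x => deriv χ x ^ 2 :=
    (deriv_continuous.pow 2).integrable_of_hasCompactSupport sq_hasCompactSupport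
  obtain ⟨y, hy, hy'⟩ : ∃ y, 0 < y ∧ deriv χ y ≠ 0 := by
    by_contra! deriv_eq_zero
    obtain ⟨b, hb, hb'⟩ : ∃ b, 0 < b ∧ b ∉ tsupport χ :=
      ((eventually_gt_atTop 0).and
        (atTop_le_cocompact hsupp.isCompact.compl_mem_cocompact)).exists
    obtain ⟨y, hy, slope_eq⟩ := exists_deriv_eq_slope χ hb hχ.continuous.continuousOn
      (hχ.differentiable one_ne_zero).differentiableOn
    rw [deriv_eq_zero y hy.1, image_eq_zero_of_notMem_tsupport hb', eq_comm,
      div_eq_zero_iff] at slope_eq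
    rcases slope_eq with h | h
    · exact h₀ (by linarith)
    · linarith
  rw [setIntegral_pos_iff_support_of_nonneg_ae (Eventually.of_forall fun _ => sq_nonneg _)
    sq_integrable.integrableOn]
  exact ((deriv_continuous.pow 2).isOpen_support.inter isOpen_Ioi).measure_pos _
    ⟨y, by simpa using hy', hy⟩

end FourierDensity

/-! ### Partial Euler products of the zeta function near `1` -/

section EulerProduct

open Filter Topology

theorem exists_pos_exp_mul_exp_sub_one_le (T : ℝ) {ε : ℝ} (hε : 0 < ε) :
    ∃ δ > 0, Real.exp T * (Real.exp δ - 1) ≤ ε := by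
  have continuous : Continuous fun δ : ℝ => Real.exp T * (Real.exp δ - 1) := by fun_prop
  have tendsto_zero : Tendsto (fun δ : ℝ => Real.exp T * (Real.exp δ - 1)) (𝓝[>] 0) (𝓝 0) := by
    simpa using (continuous.tendsto 0).mono_left nhdsWithin_le_nhds
  obtain ⟨δ, le, pos⟩ := ((tendsto_zero.eventually_le_const hε).and self_mem_nhdsWithin).exists
  exact ⟨δ, pos, le⟩

theorem exists_finset_norm_prod_sub_le {ι α : Type*} {f : ι → α → ℂ} {b : ι → ℝ} {F : α → ℂ}
    (hb : Summable b) (hf : ∀ i x, ‖f i x‖ ≤ b i) (hF : ∀ x, HasProd (fun i => 1 + f i x) (F x))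
    {ε : ℝ} (hε : 0 < ε) :
    ∃ P₀ : Finset ι, ∀ P, P₀ ⊆ P → ∀ x, ‖∏ i ∈ P, (1 + f i x) - F x‖ ≤ ε := by
  classical
  obtain ⟨δ, hδ, hδε⟩ := exists_pos_exp_mul_exp_sub_one_le (∑' i, b i) hε
  obtain ⟨P₀, hP₀⟩ := summable_iff_vanishing_norm.1 hb δ hδ
  refine ⟨P₀, fun P hP x => ?_⟩
  have b_nonneg : ∀ i, 0 ≤ b i := fun i => (norm_nonneg _).trans (hf i x)
  rw [norm_sub_rev]
  refine le_of_tendsto ((hF x).sub_const _).norm ?_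
  filter_upwards [eventually_ge_atTop P] with P' (hP' : P ⊆ P')
  have head_le : ‖∏ i ∈ P, (1 + f i x)‖ ≤ Real.exp (∑' i, b i) :=
    calc ‖∏ i ∈ P, (1 + f i x)‖ ≤ ∏ i ∈ P, (1 + b i) :=
          norm_prod_le_prod_of_le P fun i _ => norm_add_le_of_le norm_one.le (hf i x)
      _ ≤ Real.exp (∑ i ∈ P, b i) := Real.prod_one_add_le_exp_sum P b_nonneg
      _ ≤ Real.exp (∑' i, b i) := Real.exp_le_exp.2 (hb.sum_le_tsum P fun i _ => b_nonneg i)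
  have tail_sum_le : ∑ i ∈ P' \ P, ‖f i x‖ ≤ δ :=
    calc ∑ i ∈ P' \ P, ‖f i x‖ ≤ ∑ i ∈ P' \ P, b i := Finset.sum_le_sum fun i _ => hf i x
      _ ≤ ‖∑ i ∈ P' \ P, b i‖ := Real.le_norm_self _
      _ ≤ δ := (hP₀ _ (Finset.sdiff_disjoint.mono_right hP)).le
  have tail_le : ‖∏ i ∈ P' \ P, (1 + f i x) - 1‖ ≤ Real.exp δ - 1 :=
    (Finset.norm_prod_one_add_sub_one_le _ _).trans
      (sub_le_sub_right (Real.exp_le_exp.2 tail_sum_le) 1)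
  calc ‖∏ i ∈ P', (1 + f i x) - ∏ i ∈ P, (1 + f i x)‖
      = ‖(∏ i ∈ P' \ P, (1 + f i x) - 1) * ∏ i ∈ P, (1 + f i x)‖ := by
        rw [← Finset.prod_sdiff hP', sub_one_mul]
    _ ≤ (Real.exp δ - 1) * Real.exp (∑' i, b i) := norm_mul_le_of_le tail_le head_le
    _ ≤ ε := by rwa [mul_comm]

variable {s : ℂ}

theorem norm_prime_cpow_neg (p : Nat.Primes) (s : ℂ) : ‖(p : ℂ) ^ (-s)‖ = (p : ℝ) ^ (-s.re) := by
  rw [Complex.norm_natCast_cpow_of_pos p.2.pos, Complex.neg_re]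

theorem prime_rpow_neg_le_half (p : Nat.Primes) {σ : ℝ} (hσ : 1 ≤ σ) :
    (p : ℝ) ^ (-σ) ≤ 1 / 2 :=
  calc (p : ℝ) ^ (-σ) ≤ (p : ℝ) ^ (-1 : ℝ) :=
        Real.rpow_le_rpow_of_exponent_le (by exact_mod_cast p.2.one_le) (by linarith)
    _ = 1 / p := by rw [Real.rpow_neg_one, one_div]
    _ ≤ 1 / 2 := one_div_le_one_div_of_le two_pos (by exact_mod_cast p.2.two_le)

theorem hasProd_one_sub_prime_cpow (hs : 1 < s.re) :
    HasProd (fun p : Nat.Primes => 1 - (p : ℂ) ^ (-s)) (riemannZeta s)⁻¹ := by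
  simpa using (riemannZeta_eulerProduct_hasProd hs).inv₀ (riemannZeta_ne_zero_of_one_lt_re hs)

theorem norm_inv_one_sub_sub_one_le {x : ℂ} (hx : ‖x‖ ≤ 1 / 2) : ‖(1 - x)⁻¹ - 1‖ ≤ 2 * ‖x‖ := by
  have ne_zero : 1 - x ≠ 0 := by simpa using one_sub_mul_ne_zero hx norm_one.le
  have inv_le : ‖(1 - x)⁻¹‖ ≤ 2 := by simpa using norm_inv_one_sub_le hx norm_one.le
  rw [show (1 - x)⁻¹ - 1 = (1 - x)⁻¹ * x by field_simp; ring]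
  exact norm_mul_le_of_le inv_le le_rfl

theorem exists_finset_eulerProduct_approx {σ ε : ℝ} (hσ : 1 < σ) (hε : 0 < ε) :
    ∃ P₀ : Finset Nat.Primes, ∀ P, P₀ ⊆ P → ∀ s : ℂ, s.re = σ →
      ‖∏ p ∈ P, (1 - (p : ℂ) ^ (-s)) - (riemannZeta s)⁻¹‖ ≤ ε ∧
      ‖∏ p ∈ P, (1 - (p : ℂ) ^ (-s))⁻¹ - riemannZeta s‖ ≤ ε := by
  classical
  have summable : Summable fun p : Nat.Primes => (p : ℝ) ^ (-σ) :=
    Nat.Primes.summable_rpow.2 (by linarith)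
  have norm_eq (p : Nat.Primes) (s : {s : ℂ // s.re = σ}) :
      ‖(p : ℂ) ^ (-(s : ℂ))‖ = (p : ℝ) ^ (-σ) := by rw [norm_prime_cpow_neg, s.2]
  have one_lt_re (s : {s : ℂ // s.re = σ}) : 1 < (s : ℂ).re := hσ.trans_eq s.2.symm
  obtain ⟨P₁, hP₁⟩ := exists_finset_norm_prod_sub_le
    (f := fun (p : Nat.Primes) (s : {s : ℂ // s.re = σ}) => -(p : ℂ) ^ (-(s : ℂ)))
    (F := fun s => (riemannZeta s)⁻¹) summable (fun p s => by rw [norm_neg, norm_eq])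
    (fun s => by simpa [sub_eq_add_neg] using hasProd_one_sub_prime_cpow (one_lt_re s)) hε
  obtain ⟨P₂, hP₂⟩ := exists_finset_norm_prod_sub_le
    (f := fun (p : Nat.Primes) (s : {s : ℂ // s.re = σ}) => (1 - (p : ℂ) ^ (-(s : ℂ)))⁻¹ - 1)
    (F := fun s => riemannZeta s) (summable.mul_left 2)
    (fun p s => by
      rw [← norm_eq p s]
      exact norm_inv_one_sub_sub_one_le ((norm_eq p s).trans_le (prime_rpow_neg_le_half p hσ.le)))
    (fun s => by simpa using riemannZeta_eulerProduct_hasProd (one_lt_re s)) hε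
  refine ⟨P₁ ∪ P₂, fun P hP s hs => ⟨?_, ?_⟩⟩
  · simpa [sub_eq_add_neg] using hP₁ P (Finset.union_subset_left hP) ⟨s, hs⟩
  · simpa using hP₂ P (Finset.union_subset_right hP) ⟨s, hs⟩

theorem hasProd_norm_riemannZeta_ofReal {σ : ℝ} (hσ : 1 < σ) :
    HasProd (fun p : Nat.Primes => (1 - (p : ℝ) ^ (-σ))⁻¹) ‖riemannZeta σ‖ := by
  have eulerProduct := (riemannZeta_eulerProduct_hasProd (s := (σ : ℂ)) (by simpa using hσ)).norm
  refine eulerProduct.congr_fun fun p => ?_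
  have rpow_le := prime_rpow_neg_le_half p hσ.le
  have cpow_eq : (p : ℂ) ^ (-(σ : ℂ)) = (((p : ℝ) ^ (-σ) : ℝ) : ℂ) := by
    rw [Complex.ofReal_cpow (by positivity)]; simp
  rw [cpow_eq, norm_inv, ← Complex.ofReal_one, ← Complex.ofReal_sub, Complex.norm_real,
    Real.norm_of_nonneg (by linarith)]

theorem norm_riemannZeta_le (hs : 1 < s.re) : ‖riemannZeta s‖ ≤ ‖riemannZeta s.re‖ := by
  refine le_of_tendsto_of_tendsto' (riemannZeta_eulerProduct_hasProd hs).norm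
    (hasProd_norm_riemannZeta_ofReal hs) fun P =>
      Finset.prod_le_prod (fun _ _ => norm_nonneg _) fun p _ => ?_
  rw [norm_inv]
  refine inv_anti₀ (by linarith [prime_rpow_neg_le_half p hs.le]) ?_
  simpa only [norm_one, norm_prime_cpow_neg] using norm_sub_norm_le (1 : ℂ) ((p : ℂ) ^ (-s))

theorem norm_inv_riemannZeta_le (hs : 1 < s.re) : ‖(riemannZeta s)⁻¹‖ ≤ ‖riemannZeta s.re‖ := by
  refine le_of_tendsto_of_tendsto' (hasProd_one_sub_prime_cpow hs).norm
    (hasProd_norm_riemannZeta_ofReal hs) fun P =>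
      Finset.prod_le_prod (fun _ _ => norm_nonneg _) fun p _ => ?_
  have rpow_nonneg : 0 ≤ (p : ℝ) ^ (-s.re) := by positivity
  have rpow_le := prime_rpow_neg_le_half p hs.le
  calc ‖1 - (p : ℂ) ^ (-s)‖ ≤ 1 + (p : ℝ) ^ (-s.re) :=
        norm_sub_le_of_le norm_one.le (norm_prime_cpow_neg p s).le
    _ ≤ (1 - (p : ℝ) ^ (-s.re))⁻¹ := by
        rw [← one_div, le_div_iff₀ (by linarith)]
        nlinarith

end EulerProduct

section ZetaNearOne

open Filter Topology

theorem exists_norm_riemannZeta_sub_one_div_le : ∃ δ M : ℝ, 0 < δ ∧ δ ≤ 1 ∧ 1 ≤ M ∧ δ * M ≤ 1 / 2 ∧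
    ∀ z : ℂ, z ≠ 0 → ‖z‖ < δ → ‖riemannZeta (1 + z) - 1 / z‖ ≤ M := by
  have eventually_le := tendsto_riemannZeta_sub_one_div.norm.eventually_le_const
    (lt_add_one ‖(Real.eulerMascheroniConstant : ℂ)‖)
  rw [eventually_nhdsWithin_iff, Metric.eventually_nhds_iff] at eventually_le
  obtain ⟨δ, hδ, norm_le⟩ := eventually_le
  set M := ‖(Real.eulerMascheroniConstant : ℂ)‖ + 1
  have hM : 1 ≤ M := le_add_of_nonneg_left (norm_nonneg _)
  have half_div_le : 1 / 2 / M ≤ 1 := by rw [div_le_one (by positivity)]; linarith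
  refine ⟨min δ (1 / 2 / M), M, by positivity, (min_le_right _ _).trans half_div_le, hM, ?_,
    fun z hz hzδ => ?_⟩
  · rw [← le_div_iff₀ (by positivity)]
    exact min_le_right _ _
  · have dist_lt : dist (1 + z) 1 < δ := by
      simpa [dist_eq_norm] using hzδ.trans_le (min_le_left _ _)
    simpa using norm_le dist_lt (by simpa using hz)

theorem norm_inv_sub_le {w z : ℂ} {M : ℝ} (hz : z ≠ 0) (hw : ‖w - 1 / z‖ ≤ M)
    (hM : ‖z‖ * M ≤ 1 / 2) : ‖w⁻¹ - z‖ ≤ 2 * M * ‖z‖ ^ 2 := by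
  have mul_sub_one_le : ‖z * w - 1‖ ≤ ‖z‖ * M := by
    rw [show z * w - 1 = z * (w - 1 / z) by field_simp]
    exact norm_mul_le_of_le le_rfl hw
  have half_le : 1 / 2 ≤ ‖z * w‖ := by
    have := norm_sub_norm_le (1 : ℂ) (1 - z * w)
    rw [norm_one, sub_sub_cancel, norm_sub_rev] at this
    linarith
  have hw₀ : w ≠ 0 := by rintro rfl; norm_num at half_le
  have inv_le : ‖(z * w)⁻¹‖ ≤ 2 := by
    rw [norm_inv]; exact inv_le_of_inv_le₀ two_pos (by linarith)
  calc ‖w⁻¹ - z‖ = ‖z * w - 1‖ * ‖(z * w)⁻¹‖ * ‖z‖ := by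
        rw [← norm_mul, ← norm_mul, ← norm_neg]
        congr 1
        field_simp
        ring
    _ ≤ ‖z‖ * M * 2 * ‖z‖ := by
        have := (norm_nonneg _).trans mul_sub_one_le
        gcongr
    _ = 2 * M * ‖z‖ ^ 2 := by ring

theorem norm_riemannZeta_one_add_re_le {δ M : ℝ} (hδ : δ ≤ 1) (hM : 1 ≤ M)
    (near : ∀ z : ℂ, z ≠ 0 → ‖z‖ < δ → ‖riemannZeta (1 + z) - 1 / z‖ ≤ M) {x : ℝ} (hx : 0 < x)
    (hxδ : x < δ) : ‖riemannZeta ((1 + x : ℝ) : ℂ)‖ ≤ 2 * M / x := by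
  have sub_le : ‖riemannZeta ((1 + x : ℝ) : ℂ) - 1 / x‖ ≤ M := by
    simpa using near x (by exact_mod_cast hx.ne') (by simpa [abs_of_pos hx] using hxδ)
  have norm_one_div : ‖(1 / x : ℂ)‖ = 1 / x := by
    rw [norm_div, norm_one, Complex.norm_real, Real.norm_of_nonneg hx.le]
  calc ‖riemannZeta ((1 + x : ℝ) : ℂ)‖ ≤ ‖riemannZeta ((1 + x : ℝ) : ℂ) - 1 / x‖ + ‖(1 / x : ℂ)‖ :=
        norm_le_norm_sub_add _ _
    _ ≤ M / x + M / x := by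
        rw [norm_one_div]
        gcongr
        exact sub_le.trans (le_div_self (by linarith) hx (by linarith))
    _ = 2 * M / x := by ring

-- Away from the pole both bounds follow from `|ζ(1 + z)|^{±1} ≤ ζ(1 + Re z) ≪ 1 / Re z`.
theorem exists_norm_riemannZeta_sub_le_div_re : ∃ δ C : ℝ, 0 < δ ∧ 1 ≤ C ∧
    ∀ z : ℂ, 0 < z.re → z.re < δ →
      ‖riemannZeta (1 + z) - 1 / z‖ ≤ C * (‖z‖ / z.re) ∧
        ‖(riemannZeta (1 + z))⁻¹ - z‖ ≤ C * (‖z‖ ^ 3 / z.re) := by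
  obtain ⟨δ, M, hδ, hδ₁, hM, hδM, near⟩ := exists_norm_riemannZeta_sub_one_div_le
  have δ_cube_le : δ ^ 3 ≤ δ := pow_le_of_le_one hδ.le hδ₁ three_ne_zero
  refine ⟨δ, 3 * M / δ ^ 3, hδ, ?_, fun z hz hzδ => ?_⟩
  · rw [le_div_iff₀ (by positivity)]; linarith
  have hz₀ : z ≠ 0 := by rintro rfl; simp at hz
  have re_le : z.re ≤ ‖z‖ := Complex.re_le_norm z
  rcases lt_or_ge ‖z‖ δ with hlt | hge
  · have one_le_ratio : 1 ≤ ‖z‖ / z.re := (one_le_div hz).2 re_le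
    have M_le : 3 * M ≤ 3 * M / δ ^ 3 := le_div_self (by linarith) (by positivity) (by linarith)
    refine ⟨(near z hz₀ hlt).trans (by nlinarith), ?_⟩
    calc ‖(riemannZeta (1 + z))⁻¹ - z‖ ≤ 2 * M * ‖z‖ ^ 2 :=
          norm_inv_sub_le hz₀ (near z hz₀ hlt) (by nlinarith)
      _ ≤ 3 * M / δ ^ 3 * (‖z‖ ^ 2 * (‖z‖ / z.re)) := by
          gcongr ?_ * ?_
          · linarith
          · exact le_mul_of_one_le_right (by positivity) one_le_ratio
      _ = 3 * M / δ ^ 3 * (‖z‖ ^ 3 / z.re) := by ring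
  · have one_lt_re : 1 < (1 + z).re := by simpa using hz
    have zeta_re_le : ‖riemannZeta (1 + z).re‖ ≤ 2 * M / z.re := by
      simpa using norm_riemannZeta_one_add_re_le hδ₁ hM near hz hzδ
    constructor
    · calc ‖riemannZeta (1 + z) - 1 / z‖ ≤ 2 * M / z.re + M / z.re := by
            refine norm_sub_le_of_le ((norm_riemannZeta_le one_lt_re).trans zeta_re_le) ?_
            rw [norm_div, norm_one]
            gcongr
        _ = 3 * M / δ ^ 3 * (δ ^ 3 / z.re) := by field_simp; ring
        _ ≤ 3 * M / δ ^ 3 * (‖z‖ / z.re) := by gcongr; linarith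
    · have norm_le : ‖z‖ * (δ ^ 3 * z.re) ≤ ‖z‖ * (‖z‖ * ‖z‖) := by gcongr; linarith
      calc ‖(riemannZeta (1 + z))⁻¹ - z‖ ≤ 2 * M / z.re + ‖z‖ :=
            norm_sub_le_of_le ((norm_inv_riemannZeta_le one_lt_re).trans zeta_re_le) le_rfl
        _ = (2 * M * δ ^ 3 + ‖z‖ * (δ ^ 3 * z.re)) / δ ^ 3 / z.re := by field_simp
        _ ≤ (2 * M * ‖z‖ ^ 3 + M * (‖z‖ * (‖z‖ * ‖z‖))) / δ ^ 3 / z.re := by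
            gcongr (2 * M * ?_ ^ 3 + ?_) / δ ^ 3 / z.re
            exact norm_le.trans (le_mul_of_one_le_left (by positivity) hM)
        _ = 3 * M / δ ^ 3 * (‖z‖ ^ 3 / z.re) := by ring

end ZetaNearOne

section EulerRatioProduct

theorem prime_cpow_neg_one_add (p : Nat.Primes) (w : ℂ) :
    (p : ℂ) ^ (-(1 + w)) = (p : ℂ) ^ (-w) * (1 / p) := by
  rw [neg_add, add_comm, Complex.cpow_add _ _ (by exact_mod_cast p.2.ne_zero),
    Complex.cpow_neg_one, one_div]

theorem inv_eulerRatio_eq (p : Nat.Primes) (z z' : ℂ) :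
    (eulerRatio (1 / p) ((p : ℂ) ^ (-z)) ((p : ℂ) ^ (-z')))⁻¹ =
      (1 - (p : ℂ) ^ (-(1 + z))) * (1 - (p : ℂ) ^ (-(1 + z'))) *
        (1 - (p : ℂ) ^ (-(1 + (z + z'))))⁻¹ := by
  have cpow_add : (p : ℂ) ^ (-(z + z')) = (p : ℂ) ^ (-z) * (p : ℂ) ^ (-z') := by
    rw [neg_add, Complex.cpow_add _ _ (by exact_mod_cast p.2.ne_zero)]
  simp only [prime_cpow_neg_one_add, cpow_add, eulerRatio, mul_inv, inv_inv]
  ring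

theorem norm_mul_mul_sub_mul_mul_le {A A' B z z' w : ℂ} {a b K ℓ : ℝ} (ha : 1 ≤ a) (hb : 1 ≤ b)
    (hK : 1 ≤ K) (hℓ : 1 ≤ ℓ) (hz : ‖z‖ ≤ a / ℓ) (hz' : ‖z'‖ ≤ b / ℓ) (hw : ‖w‖ ≤ ℓ)
    (hA : ‖A - z‖ ≤ K * a ^ 3 / ℓ ^ 2) (hA' : ‖A' - z'‖ ≤ K * b ^ 3 / ℓ ^ 2)
    (hB : ‖B - w‖ ≤ K * (a * b)) :
    ‖A * A' * B - z * z' * w‖ ≤ 7 * K ^ 3 * (a * b) ^ 4 / ℓ ^ 2 := by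
  have norm_le {c : ℝ} {A z : ℂ} (hc : 1 ≤ c) (hz : ‖z‖ ≤ c / ℓ)
      (hA : ‖A - z‖ ≤ K * c ^ 3 / ℓ ^ 2) : ‖A‖ ≤ 2 * K * c ^ 3 / ℓ :=
    calc ‖A‖ ≤ ‖A - z‖ + ‖z‖ := norm_le_norm_sub_add A z
      _ ≤ K * c ^ 3 / ℓ ^ 1 + K * c ^ 3 / ℓ := by
          refine add_le_add (hA.trans ?_) (hz.trans ?_)
          · gcongr
            exact one_le_two
          · gcongr
            exact (le_self_pow₀ hc three_ne_zero).trans (le_mul_of_one_le_left (by positivity) hK)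
      _ = 2 * K * c ^ 3 / ℓ := by ring
  calc ‖A * A' * B - z * z' * w‖
      = ‖A * A' * (B - w) + ((A - z) * A' + z * (A' - z')) * w‖ := by congr 1; ring
    _ ≤ 2 * K * a ^ 3 / ℓ * (2 * K * b ^ 3 / ℓ) * (K * (a * b)) +
          (K * a ^ 3 / ℓ ^ 2 * (2 * K * b ^ 3 / ℓ) + a / ℓ * (K * b ^ 3 / ℓ ^ 2)) * ℓ :=
        norm_add_le_of_le
          (norm_mul_le_of_le (norm_mul_le_of_le (norm_le ha hz hA) (norm_le hb hz' hA')) hB)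
          (norm_mul_le_of_le (norm_add_le_of_le (norm_mul_le_of_le hA (norm_le hb hz' hA'))
            (norm_mul_le_of_le hz hA')) hw)
    _ = (4 * K ^ 3 * (a * b) ^ 4 + 2 * (K ^ 2 * (a * b) ^ 3) + K ^ 1 * a ^ 1 * b ^ 3) / ℓ ^ 2 := by
        field_simp
        ring
    _ ≤ (4 * K ^ 3 * (a * b) ^ 4 + 2 * (K ^ 3 * (a * b) ^ 4) + K ^ 3 * a ^ 4 * b ^ 4) / ℓ ^ 2 := by
        have hab : 1 ≤ a * b := one_le_mul_of_one_le_of_one_le ha hb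
        gcongr <;> first | assumption | norm_num
    _ = 7 * K ^ 3 * (a * b) ^ 4 / ℓ ^ 2 := by ring

theorem two_le_norm_lineOne_add (v v' : ℝ) : 2 ≤ ‖lineOne v + lineOne v'‖ := by
  have := Complex.re_le_norm (lineOne v + lineOne v')
  rw [Complex.add_re, lineOne_re, lineOne_re] at this
  linarith

theorem norm_lineOne_add_le (v v' : ℝ) :
    ‖lineOne v + lineOne v'‖ ≤ 2 * (‖lineOne v‖ * ‖lineOne v'‖) := by
  nlinarith [norm_add_le (lineOne v) (lineOne v'), one_le_norm_lineOne v, one_le_norm_lineOne v']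

theorem exists_riemannZeta_lineOne_bounds : ∃ C ℓ₀ : ℝ, 1 ≤ C ∧ 1 ≤ ℓ₀ ∧ ∀ ℓ : ℝ, ℓ₀ ≤ ℓ →
    (∀ v : ℝ, ‖(riemannZeta (1 + lineOne v / ℓ))⁻¹ - lineOne v / ℓ‖ ≤
      C * ‖lineOne v‖ ^ 3 / ℓ ^ 2) ∧
    ∀ v v' : ℝ, ‖riemannZeta (1 + (lineOne v / ℓ + lineOne v' / ℓ)) -
      ℓ / (lineOne v + lineOne v')‖ ≤ C * (‖lineOne v‖ * ‖lineOne v'‖) := by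
  obtain ⟨δ, C, hδ, hC, bound⟩ := exists_norm_riemannZeta_sub_le_div_re
  refine ⟨C, max 1 (3 / δ), hC, le_max_left _ _, fun ℓ hℓ => ?_⟩
  have ℓ_pos : 0 < ℓ := one_pos.trans_le ((le_max_left _ _).trans hℓ)
  have three_div_le : 3 / ℓ ≤ δ := (div_le_comm₀ ℓ_pos hδ).2 ((le_max_right _ _).trans hℓ)
  have norm_ofReal : ‖(ℓ : ℂ)‖ = ℓ := by rw [Complex.norm_real, Real.norm_of_nonneg ℓ_pos.le]
  constructor
  · intro v
    have re_eq : (lineOne v / ℓ).re = 1 / ℓ := by rw [Complex.div_ofReal_re, lineOne_re]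
    refine (bound (lineOne v / ℓ) ?_ ?_).2.trans_eq ?_
    · rw [re_eq]; positivity
    · rw [re_eq]
      exact (div_lt_div_of_pos_right (by norm_num) ℓ_pos).trans_le three_div_le
    · rw [re_eq, norm_div, norm_ofReal]
      field_simp
  · intro v v'
    rw [← add_div, ← one_div_div (lineOne v + lineOne v') (ℓ : ℂ)]
    have re_eq : ((lineOne v + lineOne v') / ℓ).re = 2 / ℓ := by
      rw [Complex.div_ofReal_re, Complex.add_re, lineOne_re, lineOne_re]; norm_num
    refine (bound ((lineOne v + lineOne v') / ℓ) ?_ ?_).1.trans ?_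
    · rw [re_eq]; positivity
    · rw [re_eq]
      exact (div_lt_div_of_pos_right (by norm_num) ℓ_pos).trans_le three_div_le
    · rw [re_eq, norm_div, norm_ofReal, div_div_div_cancel_right₀ ℓ_pos.ne']
      gcongr
      linarith [norm_lineOne_add_le v v']

theorem exists_prod_lineOne_approx : ∃ C ℓ₀ : ℝ, 1 ≤ C ∧ 1 ≤ ℓ₀ ∧ ∀ ℓ : ℝ, ℓ₀ ≤ ℓ →
    ∃ P₀ : Finset Nat.Primes, ∀ P, P₀ ⊆ P →
      (∀ v : ℝ, ‖∏ p ∈ P, (1 - (p : ℂ) ^ (-(1 + lineOne v / ℓ))) - lineOne v / ℓ‖ ≤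
        C * ‖lineOne v‖ ^ 3 / ℓ ^ 2) ∧
      ∀ v v' : ℝ, ‖∏ p ∈ P, (1 - (p : ℂ) ^ (-(1 + (lineOne v / ℓ + lineOne v' / ℓ))))⁻¹ -
        ℓ / (lineOne v + lineOne v')‖ ≤ C * (‖lineOne v‖ * ‖lineOne v'‖) := by
  classical
  obtain ⟨C, ℓ₀, hC, hℓ₀, bound⟩ := exists_riemannZeta_lineOne_bounds
  refine ⟨C + 1, ℓ₀, by linarith, hℓ₀, fun ℓ hℓ => ?_⟩
  have ℓ_pos : 0 < ℓ := by linarith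
  obtain ⟨inv_zeta_sub_le, zeta_sub_le⟩ := bound ℓ hℓ
  obtain ⟨P₁, hP₁⟩ := exists_finset_eulerProduct_approx (σ := 1 + 1 / ℓ) (ε := 1 / ℓ ^ 2)
    (lt_add_of_pos_right 1 (by positivity)) (by positivity)
  obtain ⟨P₂, hP₂⟩ := exists_finset_eulerProduct_approx (σ := 1 + 2 / ℓ) (ε := 1)
    (lt_add_of_pos_right 1 (by positivity)) one_pos
  refine ⟨P₁ ∪ P₂, fun P hP => ⟨fun v => ?_, fun v v' => ?_⟩⟩
  · have re_eq : (1 + lineOne v / ℓ).re = 1 + 1 / ℓ := by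
      rw [Complex.add_re, Complex.div_ofReal_re, lineOne_re, Complex.one_re]
    have one_le : 1 / ℓ ^ 2 ≤ ‖lineOne v‖ ^ 3 / ℓ ^ 2 := by
      gcongr
      exact one_le_pow₀ (one_le_norm_lineOne v)
    refine (norm_sub_le_norm_sub_add_norm_sub _ _ _).trans ((add_le_add
      ((hP₁ P (Finset.union_subset_left hP) _ re_eq).1.trans one_le)
        (inv_zeta_sub_le v)).trans_eq ?_)
    ring
  · have re_eq : (1 + (lineOne v / ℓ + lineOne v' / ℓ)).re = 1 + 2 / ℓ := by
      simp only [Complex.add_re, Complex.div_ofReal_re, lineOne_re, Complex.one_re]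
      ring
    have one_le : 1 ≤ ‖lineOne v‖ * ‖lineOne v'‖ :=
      one_le_mul_of_one_le_of_one_le (one_le_norm_lineOne v) (one_le_norm_lineOne v')
    refine (norm_sub_le_norm_sub_add_norm_sub _ _ _).trans ((add_le_add
      ((hP₂ P (Finset.union_subset_right hP) _ re_eq).2.trans one_le)
        (zeta_sub_le v v')).trans_eq ?_)
    ring

theorem exists_prod_inv_eulerRatio_approx : ∃ C ℓ₀ : ℝ, 1 ≤ C ∧ 1 ≤ ℓ₀ ∧ ∀ ℓ : ℝ, ℓ₀ ≤ ℓ →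
    ∃ P₀ : Finset Nat.Primes, ∀ P, P₀ ⊆ P → ∀ v v' : ℝ,
      ‖ℓ * ∏ p ∈ P, (eulerRatio (1 / p) ((p : ℂ) ^ (-(lineOne v / ℓ)))
          ((p : ℂ) ^ (-(lineOne v' / ℓ))))⁻¹ -
        lineOne v * lineOne v' / (lineOne v + lineOne v')‖ ≤
      C * (‖lineOne v‖ * ‖lineOne v'‖) ^ 4 / ℓ := by
  obtain ⟨C, ℓ₀, hC, hℓ₀, approx⟩ := exists_prod_lineOne_approx
  refine ⟨7 * C ^ 3, ℓ₀, by linarith [one_le_pow₀ hC (n := 3)], hℓ₀, fun ℓ hℓ => ?_⟩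
  obtain ⟨P₀, hP₀⟩ := approx ℓ hℓ
  refine ⟨P₀, fun P hP v v' => ?_⟩
  obtain ⟨prod_sub_le, prod_inv_sub_le⟩ := hP₀ P hP
  have ℓ_pos : 0 < ℓ := by linarith
  have norm_ofReal : ‖(ℓ : ℂ)‖ = ℓ := by rw [Complex.norm_real, Real.norm_of_nonneg ℓ_pos.le]
  have ofReal_ne_zero : (ℓ : ℂ) ≠ 0 := by exact_mod_cast ℓ_pos.ne'
  have norm_div_eq (v : ℝ) : ‖lineOne v / ℓ‖ = ‖lineOne v‖ / ℓ := by rw [norm_div, norm_ofReal]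
  have two_le := two_le_norm_lineOne_add v v'
  have add_ne_zero : lineOne v + lineOne v' ≠ 0 := norm_pos_iff.1 (by linarith)
  have norm_div_add_le : ‖ℓ / (lineOne v + lineOne v')‖ ≤ ℓ := by
    rw [norm_div, norm_ofReal]
    exact div_le_self ℓ_pos.le (by linarith)
  simp only [inv_eulerRatio_eq, Finset.prod_mul_distrib]
  have key := norm_mul_mul_sub_mul_mul_le (one_le_norm_lineOne v) (one_le_norm_lineOne v') hC
    (hℓ₀.trans hℓ) (norm_div_eq v).le (norm_div_eq v').le norm_div_add_le (prod_sub_le v)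
    (prod_sub_le v') (prod_inv_sub_le v v')
  rw [show lineOne v * lineOne v' / (lineOne v + lineOne v') =
    ℓ * (lineOne v / ℓ * (lineOne v' / ℓ) * (ℓ / (lineOne v + lineOne v'))) by field_simp,
    ← mul_sub]
  refine (norm_mul_le_of_le norm_ofReal.le key).trans_eq ?_
  field_simp

end EulerRatioProduct

/-! ### Equidistribution of a box in residue classes -/

section Equidistribution

theorem abs_card_filter_modEq_sub_le {a b r : ℤ} (hab : a ≤ b) (hr : 0 < r) (v : ℤ) :
    |(((Finset.Ioc a b).filter fun x => x ≡ v [ZMOD r]).card : ℚ) - (b - a) / r| ≤ 1 := by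
  have card_eq : (((Finset.Ioc a b).filter fun x => x ≡ v [ZMOD r]).card : ℚ) =
      max (⌊(b - v) / (r : ℚ)⌋ - ⌊(a - v) / (r : ℚ)⌋ : ℚ) 0 := by
    exact_mod_cast Int.Ioc_filter_modEq_card a b hr v
  have sub_eq : (b - a : ℚ) / r = (b - v) / r - (a - v) / r := by ring
  have sub_nonneg : (0 : ℚ) ≤ (b - a) / r := by
    have : (a : ℚ) ≤ b := by exact_mod_cast hab
    have : (0 : ℚ) < r := by exact_mod_cast hr
    exact div_nonneg (by linarith) this.le
  have floor_b := Int.floor_le ((b - v) / (r : ℚ))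
  have floor_b' := Int.lt_floor_add_one ((b - v) / (r : ℚ))
  have floor_a := Int.floor_le ((a - v) / (r : ℚ))
  have floor_a' := Int.lt_floor_add_one ((a - v) / (r : ℚ))
  rw [card_eq, abs_sub_le_iff]
  constructor
  · rw [sub_le_iff_le_add]
    exact max_le (by linarith) (by linarith)
  · rw [sub_le_comm]
    exact le_max_of_le_left (by linarith)

theorem abs_card_residue_sub_le (D : ℕ) [NeZero D] (x : ZMod D) {Z : ℝ} (hZ : 0 ≤ Z) :
    |(((Finset.Icc 1 ⌊Z⌋).filter fun m : ℤ => (m : ZMod D) = x).card : ℝ) - Z / D| ≤ 2 := by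
  have D_pos : 0 < D := Nat.pos_of_ne_zero (NeZero.ne D)
  have filter_eq : ((Finset.Icc 1 ⌊Z⌋).filter fun m : ℤ => (m : ZMod D) = x) =
      (Finset.Ioc 0 ⌊Z⌋).filter fun m : ℤ => m ≡ (x.val : ℤ) [ZMOD (D : ℤ)] := by
    rw [show Finset.Icc 1 ⌊Z⌋ = Finset.Ioc 0 ⌊Z⌋ by ext; simp [Int.lt_iff_add_one_le]]
    refine Finset.filter_congr fun m _ => ?_
    rw [← ZMod.intCast_eq_intCast_iff]
    simp
  have card_sub_le : |(((Finset.Icc 1 ⌊Z⌋).filter fun m : ℤ => (m : ZMod D) = x).card : ℝ) -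
      ⌊Z⌋ / D| ≤ 1 := by
    have := abs_card_filter_modEq_sub_le (Int.floor_nonneg.2 hZ) (r := D) (by exact_mod_cast D_pos)
      (x.val : ℤ)
    rw [← filter_eq, Int.cast_zero, sub_zero] at this
    exact_mod_cast this
  have floor_sub_le : |(⌊Z⌋ : ℝ) / D - Z / D| ≤ 1 := by
    have one_le : (1 : ℝ) ≤ D := by exact_mod_cast D_pos
    rw [← sub_div, abs_div, Nat.abs_cast, div_le_one (by linarith), abs_sub_le_iff]
    constructor <;> linarith [Int.floor_le Z, Int.lt_floor_add_one Z]
  linarith [abs_sub_le (((Finset.Icc 1 ⌊Z⌋).filter fun m : ℤ => (m : ZMod D) = x).card : ℝ)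
    (⌊Z⌋ / D) (Z / D)]

theorem abs_card_residues_sub_le (d D : ℕ) [NeZero D] (a : Fin d → ZMod D) {Z : ℝ}
    (hD : (D : ℝ) ≤ Z) :
    |(((intBox d Z).filter fun n => (fun j => (n j : ZMod D)) = a).card : ℝ) - (Z / D) ^ d| ≤
      (Z / D) ^ d * (2 * d * 3 ^ d * (D / Z)) := by
  have D_pos : (0 : ℝ) < D := by exact_mod_cast Nat.pos_of_ne_zero (NeZero.ne D)
  have Z_pos : 0 < Z := by linarith
  have filter_eq : ((intBox d Z).filter fun n => (fun j => (n j : ZMod D)) = a) =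
      Fintype.piFinset fun j => (Finset.Icc 1 ⌊Z⌋).filter fun m : ℤ => (m : ZMod D) = a j := by
    ext n
    simp only [intBox, Finset.mem_filter, Fintype.mem_piFinset, funext_iff, forall_and]
  rw [filter_eq, Fintype.card_piFinset, Nat.cast_prod]
  set c : Fin d → ℝ := fun j =>
    ((Finset.Icc 1 ⌊Z⌋).filter fun m : ℤ => (m : ZMod D) = a j).card
  have ratio_sub_le (j : Fin d) : ‖c j / (Z / D) - 1‖ ≤ 2 * (D / Z) := by
    rw [div_sub_one (by positivity), norm_div, Real.norm_of_nonneg (r := Z / D) (by positivity),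
      div_le_iff₀ (by positivity)]
    exact (abs_card_residue_sub_le D (a j) Z_pos.le).trans_eq (by field_simp)
  have prod_ratio_sub_le := norm_prod_one_add_sub_one_le_pow Finset.univ (M := 3)
    (by linarith [(div_le_one Z_pos).2 hD]) (by positivity) fun j _ => ratio_sub_le j
  simp only [add_sub_cancel, Finset.prod_div_distrib, Finset.prod_const, Finset.card_univ,
    Fintype.card_fin, ← div_pow] at prod_ratio_sub_le
  calc |∏ j, c j - (Z / D) ^ d| = (Z / D) ^ d * |(∏ j, c j) / (Z / D) ^ d - 1| := by
        rw [← abs_of_nonneg (a := (Z / D) ^ d) (by positivity), ← abs_mul]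
        congr 1
        rw [abs_of_nonneg (a := (Z / D) ^ d) (by positivity)]
        field_simp
    _ ≤ (Z / D) ^ d * (3 ^ d * (d * (2 * (D / Z)))) :=
        mul_le_mul_of_nonneg_left prod_ratio_sub_le (by positivity)
    _ = (Z / D) ^ d * (2 * d * 3 ^ d * (D / Z)) := by ring

theorem abs_sum_intBox_sub_le (d D : ℕ) [NeZero D] (G : (Fin d → ZMod D) → ℝ)
    (hG : ∀ a, |G a| ≤ 1) {Z : ℝ} (hD : (D : ℝ) ≤ Z) :
    |∑ n ∈ intBox d Z, G (fun j => (n j : ZMod D)) - Z ^ d * 𝔼 a, G a| ≤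
      2 * d * 3 ^ d * Z ^ d * (D / Z) := by
  have D_pos : (0 : ℝ) < D := by exact_mod_cast Nat.pos_of_ne_zero (NeZero.ne D)
  have card_eq : (Fintype.card (Fin d → ZMod D) : ℝ) = (D : ℝ) ^ d := by
    rw [Fintype.card_fun, ZMod.card, Fintype.card_fin, Nat.cast_pow]
  have sum_fiberwise : ∑ n ∈ intBox d Z, G (fun j => (n j : ZMod D)) =
      ∑ a, (((intBox d Z).filter fun n => (fun j => (n j : ZMod D)) = a).card : ℝ) * G a := by
    rw [← Finset.sum_fiberwise (intBox d Z) (fun n => fun j => (n j : ZMod D))]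
    refine Finset.sum_congr rfl fun a _ => ?_
    rw [← nsmul_eq_mul, ← Finset.sum_const]
    exact Finset.sum_congr rfl fun n hn => by rw [(Finset.mem_filter.1 hn).2]
  have expect_eq : Z ^ d * 𝔼 a, G a = ∑ a, (Z / D) ^ d * G a := by
    rw [Fintype.expect_eq_sum_div_card, card_eq, ← Finset.mul_sum, div_pow]; ring
  rw [sum_fiberwise, expect_eq, ← Finset.sum_sub_distrib]
  calc |∑ a, ((((intBox d Z).filter fun n => (fun j => (n j : ZMod D)) = a).card : ℝ) * G a -
          (Z / D) ^ d * G a)|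
      ≤ ∑ _a : Fin d → ZMod D, (Z / D) ^ d * (2 * d * 3 ^ d * (D / Z)) * 1 := by
        refine (Finset.abs_sum_le_sum_abs _ _).trans (Finset.sum_le_sum fun a _ => ?_)
        rw [← sub_mul, ← Real.norm_eq_abs]
        exact norm_mul_le_of_le (abs_card_residues_sub_le d D a hD) (hG a)
    _ = 2 * d * 3 ^ d * Z ^ d * (D / Z) := by
        rw [Finset.sum_const, Finset.card_univ, nsmul_eq_mul, card_eq, div_pow]
        field_simp

theorem expect_pi_prod {ι : Type*} [Fintype ι] [DecidableEq ι] {α : ι → Type*}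
    [∀ i, Fintype (α i)] {K : Type*} [Field K] [CharZero K] (f : ∀ i, α i → K) :
    𝔼 b : ∀ i, α i, ∏ i, f i (b i) = ∏ i, 𝔼 a, f i a := by
  simp only [Fintype.expect_eq_sum_div_card, Finset.prod_div_distrib, Fintype.card_pi,
    Nat.cast_prod, Fintype.prod_sum]

theorem abs_sum_intBox_prod_sub_le (d : ℕ) {ι : Type*} [Fintype ι] {m : ι → ℕ}
    [∀ i, NeZero (m i)] (hm : Pairwise (Function.onFun Nat.Coprime m))
    (F : ∀ i, (Fin d → ZMod (m i)) → ℝ) (hF : ∀ i b, |F i b| ≤ 1) {Z : ℝ}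
    (hZ : ∏ i, (m i : ℝ) ≤ Z) :
    |∑ n ∈ intBox d Z, ∏ i, F i (fun j => (n j : ZMod (m i))) - Z ^ d * ∏ i, 𝔼 b, F i b| ≤
      2 * d * 3 ^ d * Z ^ d * ((∏ i, (m i : ℝ)) / Z) := by
  classical
  set D : ℕ := ∏ i, m i
  have : NeZero D := ⟨Finset.prod_ne_zero_iff.2 fun i _ => NeZero.ne (m i)⟩
  let e : (Fin d → ZMod D) ≃ ∀ i, Fin d → ZMod (m i) :=
    (Equiv.piCongrRight fun _ => (ZMod.prodEquivPi m hm).toEquiv).trans (Equiv.piComm _)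
  let G (a : Fin d → ZMod D) : ℝ := ∏ i, F i (e a i)
  have G_intCast (n : Fin d → ℤ) :
      G (fun j => (n j : ZMod D)) = ∏ i, F i (fun j => (n j : ZMod (m i))) := by
    refine Finset.prod_congr rfl fun i _ => congrArg (F i) (funext fun j => ?_)
    change ZMod.prodEquivPi m hm (n j : ZMod D) i = _
    rw [map_intCast, Pi.intCast_apply]
  have expect_G : 𝔼 a, G a = ∏ i, 𝔼 b, F i b := by
    rw [← expect_pi_prod]
    exact Fintype.expect_equiv e _ _ fun _ => rfl
  have abs_G_le (a : Fin d → ZMod D) : |G a| ≤ 1 := by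
    rw [Finset.abs_prod]
    exact Finset.prod_le_one (fun _ _ => abs_nonneg _) fun i _ => hF i _
  have box := abs_sum_intBox_sub_le d D G abs_G_le (Z := Z) (by rwa [Nat.cast_prod])
  rwa [expect_G, Nat.cast_prod, Finset.sum_congr rfl fun n _ => G_intCast n] at box

theorem abs_sum_intBox_prod_primes_sub_le (d : ℕ) (Q : Finset Nat.Primes)
    (F : ∀ p : Nat.Primes, (Fin d → ZMod p) → ℝ) (hF : ∀ p b, |F p b| ≤ 1) {Z : ℝ}
    (hZ : ∏ p ∈ Q, (p : ℝ) ≤ Z) :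
    |∑ n ∈ intBox d Z, ∏ p ∈ Q, F p (fun j => (n j : ZMod p)) - Z ^ d * ∏ p ∈ Q, 𝔼 b, F p b| ≤
      2 * d * 3 ^ d * Z ^ d * ((∏ p ∈ Q, (p : ℝ)) / Z) := by
  have coprime : Pairwise (Function.onFun Nat.Coprime fun q : Q => ((q : Nat.Primes) : ℕ)) :=
    fun q q' hne => (Nat.coprime_primes q.1.2 q'.1.2).2
      fun h => hne (Subtype.ext (Subtype.ext h))
  simp only [← Finset.prod_coe_sort Q] at hZ ⊢
  exact abs_sum_intBox_prod_sub_le d coprime (fun q => F q) (fun q => hF q) hZ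

end Equidistribution

/-! ### The truncated divisor sum as a sum over sets of primes -/

section SieveSum

/-- The squarefree integer with prime divisors `s`; it indexes squarefree sieve moduli by finite
sets of primes. -/
def primeProd (s : Finset Nat.Primes) : ℕ := ∏ p ∈ s, (p : ℕ)

theorem primeProd_eq_prod_map (s : Finset Nat.Primes) :
    primeProd s = ∏ p ∈ s.map ⟨fun p : Nat.Primes => (p : ℕ), Subtype.val_injective⟩, p := by
  rw [Finset.prod_map]; rfl

theorem primeFactors_primeProd (s : Finset Nat.Primes) :
    (primeProd s).primeFactors = s.map ⟨fun p : Nat.Primes => (p : ℕ), Subtype.val_injective⟩ := by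
  rw [primeProd_eq_prod_map]
  refine Nat.primeFactors_prod fun p hp => ?_
  obtain ⟨q, -, rfl⟩ := Finset.mem_map.1 hp
  exact q.2

theorem primeProd_injective : Function.Injective primeProd := fun s s' h => by
  have map_eq := congrArg Nat.primeFactors h
  rw [primeFactors_primeProd, primeFactors_primeProd] at map_eq
  exact Finset.map_injective _ map_eq

theorem primeProd_pos (s : Finset Nat.Primes) : 0 < primeProd s :=
  Finset.prod_pos fun p _ => p.2.pos

theorem log_primeProd (s : Finset Nat.Primes) :
    Real.log (primeProd s) = ∑ p ∈ s, Real.log p := by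
  rw [primeProd, Nat.cast_prod, Real.log_prod]
  exact fun p _ => by exact_mod_cast p.2.ne_zero

theorem moebius_primeProd (s : Finset Nat.Primes) :
    ArithmeticFunction.moebius (primeProd s) = (-1) ^ s.card := by
  rw [primeProd_eq_prod_map,
    ArithmeticFunction.isMultiplicative_moebius.map_prod_of_prime _ fun p hp => by
      obtain ⟨q, -, rfl⟩ := Finset.mem_map.1 hp
      exact q.2, Finset.prod_map]
  rw [Finset.prod_congr rfl fun p _ => ArithmeticFunction.moebius_apply_prime p.2,
    Finset.prod_const]

theorem primeProd_dvd_iff (s : Finset Nat.Primes) (n : ℤ) :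
    (primeProd s : ℤ) ∣ n ↔ ∀ p ∈ s, ((p : ℕ) : ℤ) ∣ n := by
  refine ⟨fun h p hp => (Int.natCast_dvd_natCast.2 (Finset.dvd_prod_of_mem _ hp)).trans h,
    fun h => ?_⟩
  rw [Int.natCast_dvd, primeProd_eq_prod_map]
  refine Finset.prod_primes_dvd _ (fun p hp => ?_) fun p hp => ?_
  · obtain ⟨q, -, rfl⟩ := Finset.mem_map.1 hp
    exact q.2.prime
  · obtain ⟨q, hq, rfl⟩ := Finset.mem_map.1 hp
    exact Int.natCast_dvd.1 (h q hq)

theorem exists_primeProd_eq {m : ℕ} (hm : Squarefree m) : ∃ s, primeProd s = m := by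
  classical
  let toPrime (p : m.primeFactors) : Nat.Primes := ⟨p, Nat.prime_of_mem_primeFactors p.2⟩
  have toPrime_injective : Function.Injective toPrime := fun p q h =>
    Subtype.ext (congrArg (fun r : Nat.Primes => (r : ℕ)) h)
  refine ⟨m.primeFactors.attach.image toPrime, ?_⟩
  rw [primeProd, Finset.prod_image toPrime_injective.injOn]
  exact (Finset.prod_attach m.primeFactors fun p => p).trans
    (Nat.prod_primeFactors_of_squarefree hm)

theorem le_primeProd_of_mem {s : Finset Nat.Primes} {p : Nat.Primes} (hp : p ∈ s) :
    (p : ℕ) ≤ primeProd s :=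
  Nat.le_of_dvd (primeProd_pos s) (Finset.dvd_prod_of_mem _ hp)

variable {χ : ℝ → ℝ} {S R : ℝ}

theorem le_rpow_of_apply_log_ne_zero (hR : 1 < R) (hS : Function.support χ ⊆ Set.Icc (-S) S)
    {m : ℝ} (hm : 0 < m) (h : χ (Real.log m / Real.log R) ≠ 0) : m ≤ R ^ S := by
  have log_le := (hS h).2
  rw [div_le_iff₀ (Real.log_pos hR)] at log_le
  rwa [← Real.log_le_log_iff hm (by positivity), Real.log_rpow (by linarith)]

theorem primeProd_le_rpow_of_apply_ne_zero (hR : 1 < R)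
    (hS : Function.support χ ⊆ Set.Icc (-S) S) {s : Finset Nat.Primes}
    (h : χ ((∑ p ∈ s, Real.log p) / Real.log R) ≠ 0) : (primeProd s : ℝ) ≤ R ^ S := by
  rw [← log_primeProd] at h
  exact le_rpow_of_apply_log_ne_zero hR hS (by exact_mod_cast primeProd_pos s) h

/-- The divisor sum `∑ μ(m) χ(log m / ℓ)` over the squarefree `m` composed of primes in `P`, each
`m = ∏ p ∈ s, p` weighted by `∏ p ∈ s, x p`. When `x p` is the indicator of `p ∣ n` this is the sum
over the divisors of `n`; keeping `x` free lets `n` be replaced by a choice of residues. -/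
noncomputable def sieveSum (χ : ℝ → ℝ) (ℓ : ℝ) (P : Finset Nat.Primes) (x : Nat.Primes → ℝ) : ℝ :=
  ∑ s ∈ P.powerset, (∏ p ∈ s, (-x p)) * χ ((∑ p ∈ s, Real.log p) / ℓ)

open Classical in
theorem sieveSum_dvd_indicator (χ : ℝ → ℝ) (ℓ : ℝ) (P : Finset Nat.Primes) (n : ℤ) :
    sieveSum χ ℓ P (fun p => if ((p : ℕ) : ℤ) ∣ n then 1 else 0) =
      ∑ s ∈ P.powerset with ∀ p : Nat.Primes, p ∈ s → ((p : ℕ) : ℤ) ∣ n,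
        (ArithmeticFunction.moebius (primeProd s) : ℝ) * χ (Real.log (primeProd s) / ℓ) := by
  rw [Finset.sum_filter, sieveSum]
  refine Finset.sum_congr rfl fun s _ => ?_
  split_ifs with h
  · rw [moebius_primeProd, log_primeProd, Finset.prod_congr rfl fun p hp => by rw [if_pos (h p hp)],
      Finset.prod_const, Int.cast_pow, Int.cast_neg, Int.cast_one]
  · push Not at h
    obtain ⟨p, hp, hpn⟩ := h
    rw [Finset.prod_eq_zero hp (by rw [if_neg hpn, neg_zero]), zero_mul]

open Classical in
theorem truncatedDivisorSum_eq_sieveSum (hR : 1 < R) (hS : Function.support χ ⊆ Set.Icc (-S) S)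
    {P : Finset Nat.Primes} (hP : ∀ p : Nat.Primes, (p : ℝ) ≤ R ^ S → p ∈ P) (n : ℤ) :
    truncatedDivisorSum χ R n = Real.log R *
      sieveSum χ (Real.log R) P (fun p => if ((p : ℕ) : ℤ) ∣ n then 1 else 0) ^ 2 := by
  rw [truncatedDivisorSum, sieveSum_dvd_indicator]
  congr 2
  set f : ℕ → ℝ := fun m => (ArithmeticFunction.moebius m : ℝ) * χ (Real.log m / Real.log R)
  rw [← Finset.sum_image (f := f) primeProd_injective.injOn]
  refine finsum_mem_eq_sum_of_inter_support_eq f ?_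
  ext m
  simp only [Set.mem_inter_iff, Function.mem_support, Finset.coe_image, Set.mem_image,
    Finset.mem_coe, Finset.mem_filter, Finset.mem_powerset]
  refine and_congr_left fun hfm => ⟨?_, ?_⟩
  · rintro ⟨m_pos, m_dvd⟩
    have squarefree : Squarefree m := by
      rw [← ArithmeticFunction.moebius_ne_zero_iff_squarefree]
      exact_mod_cast left_ne_zero_of_mul hfm
    obtain ⟨s, rfl⟩ := exists_primeProd_eq squarefree
    have primeProd_le : (primeProd s : ℝ) ≤ R ^ S :=
      le_rpow_of_apply_log_ne_zero hR hS (by exact_mod_cast m_pos) (right_ne_zero_of_mul hfm)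
    exact ⟨s, ⟨fun p hp => hP p ((Nat.cast_le.2 (le_primeProd_of_mem hp)).trans primeProd_le),
      (primeProd_dvd_iff s n).1 m_dvd⟩, rfl⟩
  · rintro ⟨s, ⟨-, hs⟩, rfl⟩
    exact ⟨primeProd_pos s, (primeProd_dvd_iff s n).2 hs⟩

open Classical in
theorem card_filter_primeProd_le (P : Finset Nat.Primes) {x : ℝ} (hx : 0 ≤ x) :
    ((P.powerset.filter fun s => (primeProd s : ℝ) ≤ x).card : ℝ) ≤ x := by
  have card_le : (P.powerset.filter fun s => (primeProd s : ℝ) ≤ x).card ≤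
      (Finset.Icc 1 ⌊x⌋₊).card := by
    refine Finset.card_le_card_of_injOn primeProd (fun s hs => ?_) primeProd_injective.injOn
    rw [Finset.mem_coe, Finset.mem_Icc]
    exact ⟨primeProd_pos s, Nat.le_floor (Finset.mem_filter.1 hs).2⟩
  rw [Nat.card_Icc, Nat.add_sub_cancel] at card_le
  exact (Nat.cast_le.2 card_le).trans (Nat.floor_le hx)

theorem sum_abs_apply_log_le {K : ℝ} (hR : 1 < R) (hS : Function.support χ ⊆ Set.Icc (-S) S)
    (hK : ∀ x, |χ x| ≤ K) (P : Finset Nat.Primes) :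
    ∑ s ∈ P.powerset, |χ ((∑ p ∈ s, Real.log p) / Real.log R)| ≤ K * R ^ S := by
  classical
  have K_nonneg : 0 ≤ K := (abs_nonneg _).trans (hK 0)
  calc ∑ s ∈ P.powerset, |χ ((∑ p ∈ s, Real.log p) / Real.log R)|
      = ∑ s ∈ P.powerset with (primeProd s : ℝ) ≤ R ^ S,
          |χ ((∑ p ∈ s, Real.log p) / Real.log R)| :=
        (Finset.sum_filter_of_ne fun s _ h =>
          primeProd_le_rpow_of_apply_ne_zero hR hS (abs_ne_zero.1 h)).symm
    _ ≤ (P.powerset.filter fun s => (primeProd s : ℝ) ≤ R ^ S).card • K :=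
        Finset.sum_le_card_nsmul _ _ K fun s _ => hK _
    _ ≤ K * R ^ S := by
        rw [nsmul_eq_mul, mul_comm]
        exact mul_le_mul_of_nonneg_left (card_filter_primeProd_le P (by positivity)) K_nonneg

end SieveSum

/-! ### Reduction of the correlation sum to residue classes -/

section PairWeight

variable {t : ℕ} {χ : ℝ → ℝ} {S R : ℝ}

/-- The coefficient, depending on `χ` alone, of a pair of sets of primes in the expanded square of
`sieveSum`. -/
noncomputable def pairWeight (χ : ℝ → ℝ) (ℓ : ℝ) (q : Finset Nat.Primes × Finset Nat.Primes) : ℝ :=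
  ((-1) ^ q.1.card * χ ((∑ p ∈ q.1, Real.log p) / ℓ)) *
    ((-1) ^ q.2.card * χ ((∑ p ∈ q.2, Real.log p) / ℓ))

open Classical in
/-- The factor at `p` of the coefficient, depending on the divisibility indicators `x` at `p`, of a
family `σ` of pairs of sets of primes in the expanded product of squares of `sieveSum`s. -/
noncomputable def primeWeight (σ : Fin t → Finset Nat.Primes × Finset Nat.Primes)
    (p : Nat.Primes) (x : Fin t → ℝ) : ℝ :=
  ∏ i, (if p ∈ (σ i).1 then x i else 1) * (if p ∈ (σ i).2 then x i else 1)

open Classical in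
/-- The primes which occur in the family `σ`; at all the others `primeWeight σ` is `1`. -/
noncomputable def primeSupport (σ : Fin t → Finset Nat.Primes × Finset Nat.Primes) :
    Finset Nat.Primes :=
  Finset.univ.biUnion fun i => (σ i).1 ∪ (σ i).2

theorem prod_neg_eq_of_subset {P s : Finset Nat.Primes} [DecidableEq Nat.Primes] (hs : s ⊆ P)
    (x : Nat.Primes → ℝ) :
    ∏ p ∈ s, (-x p) = (-1) ^ s.card * ∏ p ∈ P, if p ∈ s then x p else 1 := by
  rw [Finset.prod_neg, Finset.prod_ite_mem, Finset.inter_eq_right.2 hs]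

open Classical in
theorem sieveSum_sq (χ : ℝ → ℝ) (ℓ : ℝ) (P : Finset Nat.Primes) (x : Nat.Primes → ℝ) :
    sieveSum χ ℓ P x ^ 2 = ∑ q ∈ P.powerset ×ˢ P.powerset, pairWeight χ ℓ q *
      ∏ p ∈ P, ((if p ∈ q.1 then x p else 1) * (if p ∈ q.2 then x p else 1)) := by
  rw [sq, sieveSum, Finset.sum_mul_sum, ← Finset.sum_product']
  refine Finset.sum_congr rfl fun q hq => ?_
  rw [Finset.mem_product, Finset.mem_powerset, Finset.mem_powerset] at hq
  rw [prod_neg_eq_of_subset hq.1, prod_neg_eq_of_subset hq.2, pairWeight, Finset.prod_mul_distrib]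
  ring

theorem prod_sieveSum_sq (χ : ℝ → ℝ) (ℓ : ℝ) (P : Finset Nat.Primes)
    (x : Fin t → Nat.Primes → ℝ) :
    ∏ i, sieveSum χ ℓ P (x i) ^ 2 =
      ∑ σ ∈ Fintype.piFinset fun _ : Fin t => P.powerset ×ˢ P.powerset,
        (∏ i, pairWeight χ ℓ (σ i)) * ∏ p ∈ P, primeWeight σ p (fun i => x i p) := by
  simp only [sieveSum_sq]
  rw [Finset.prod_univ_sum]
  refine Finset.sum_congr rfl fun σ _ => ?_
  rw [Finset.prod_mul_distrib, Finset.prod_comm]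
  rfl

theorem sum_abs_pairWeight_le {K : ℝ} (hR : 1 < R) (hS : Function.support χ ⊆ Set.Icc (-S) S)
    (hK : ∀ x, |χ x| ≤ K) (P : Finset Nat.Primes) :
    ∑ q ∈ P.powerset ×ˢ P.powerset, |pairWeight χ (Real.log R) q| ≤ (K * R ^ S) ^ 2 := by
  have sum_eq_sq : ∑ q ∈ P.powerset ×ˢ P.powerset, |pairWeight χ (Real.log R) q| =
      (∑ s ∈ P.powerset, |χ ((∑ p ∈ s, Real.log p) / Real.log R)|) ^ 2 := by
    rw [sq, Finset.sum_mul_sum, ← Finset.sum_product']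
    simp [pairWeight, abs_mul]
  rw [sum_eq_sq]
  exact pow_le_pow_left₀ (Finset.sum_nonneg fun _ _ => abs_nonneg _)
    (sum_abs_apply_log_le hR hS hK P) 2

theorem sum_abs_prod_pairWeight_le {K : ℝ} (hR : 1 < R)
    (hS : Function.support χ ⊆ Set.Icc (-S) S) (hK : ∀ x, |χ x| ≤ K) (P : Finset Nat.Primes) :
    ∑ σ ∈ Fintype.piFinset fun _ : Fin t => P.powerset ×ˢ P.powerset,
      |∏ i, pairWeight χ (Real.log R) (σ i)| ≤ ((K * R ^ S) ^ 2) ^ t := by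
  simp only [Finset.abs_prod]
  rw [← Finset.prod_univ_sum (fun _ : Fin t => P.powerset ×ˢ P.powerset)
    (fun _ q => |pairWeight χ (Real.log R) q|), Finset.prod_const, Finset.card_univ,
    Fintype.card_fin]
  exact pow_le_pow_left₀ (Finset.sum_nonneg fun _ _ => abs_nonneg _)
    (sum_abs_pairWeight_le hR hS hK P) t

variable {σ : Fin t → Finset Nat.Primes × Finset Nat.Primes}

theorem abs_primeWeight_le_one (p : Nat.Primes) {x : Fin t → ℝ} (hx : ∀ i, |x i| ≤ 1) :
    |primeWeight σ p x| ≤ 1 := by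
  have abs_ite_le (i : Fin t) (c : Prop) [Decidable c] : |if c then x i else 1| ≤ 1 := by
    split_ifs
    · exact hx i
    · exact abs_one.le
  rw [primeWeight, Finset.abs_prod]
  refine Finset.prod_le_one (fun _ _ => abs_nonneg _) fun i _ => ?_
  rw [abs_mul]
  exact mul_le_one₀ (abs_ite_le i _) (abs_nonneg _) (abs_ite_le i _)

theorem mem_primeSupport {p : Nat.Primes} :
    p ∈ primeSupport σ ↔ ∃ i, p ∈ (σ i).1 ∨ p ∈ (σ i).2 := by
  simp [primeSupport]

theorem primeSupport_subset {P : Finset Nat.Primes}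
    (hσ : σ ∈ Fintype.piFinset fun _ : Fin t => P.powerset ×ˢ P.powerset) :
    primeSupport σ ⊆ P := by
  intro p hp
  obtain ⟨i, hi⟩ := mem_primeSupport.1 hp
  obtain ⟨left_subset, right_subset⟩ := Finset.mem_product.1 (Fintype.mem_piFinset.1 hσ i)
  exact hi.elim (fun h => Finset.mem_powerset.1 left_subset h)
    fun h => Finset.mem_powerset.1 right_subset h

theorem primeWeight_eq_one_of_notMem_primeSupport {p : Nat.Primes} (hp : p ∉ primeSupport σ)
    (x : Fin t → ℝ) : primeWeight σ p x = 1 := by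
  rw [mem_primeSupport] at hp
  push Not at hp
  refine Finset.prod_eq_one fun i _ => ?_
  rw [if_neg (hp i).1, if_neg (hp i).2, one_mul]

theorem primeProd_primeSupport_le (σ : Fin t → Finset Nat.Primes × Finset Nat.Primes) :
    primeProd (primeSupport σ) ≤ ∏ i, primeProd (σ i).1 * primeProd (σ i).2 := by
  refine Nat.le_of_dvd (Finset.prod_pos fun i _ => mul_pos (primeProd_pos _) (primeProd_pos _)) ?_
  rw [← Int.natCast_dvd_natCast, primeProd_dvd_iff]
  intro p hp
  obtain ⟨i, hi⟩ := mem_primeSupport.1 hp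
  have dvd_factor : (p : ℕ) ∣ primeProd (σ i).1 * primeProd (σ i).2 :=
    hi.elim (fun h => (Finset.dvd_prod_of_mem _ h).mul_right _)
      fun h => (Finset.dvd_prod_of_mem _ h).mul_left _
  exact Int.natCast_dvd_natCast.2
    (dvd_factor.trans (Finset.dvd_prod_of_mem _ (Finset.mem_univ i)))

theorem prod_primeSupport_le_rpow (hR : 1 < R) (hS : Function.support χ ⊆ Set.Icc (-S) S)
    (h : ∏ i, pairWeight χ (Real.log R) (σ i) ≠ 0) :
    ∏ p ∈ primeSupport σ, (p : ℝ) ≤ R ^ (2 * t * S) := by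
  calc ∏ p ∈ primeSupport σ, (p : ℝ) = primeProd (primeSupport σ) := by
        rw [primeProd, Nat.cast_prod]
    _ ≤ ∏ i, (primeProd (σ i).1 * primeProd (σ i).2 : ℝ) := by
        exact_mod_cast primeProd_primeSupport_le σ
    _ ≤ ∏ _i : Fin t, R ^ S * R ^ S := by
        refine Finset.prod_le_prod (fun _ _ => by positivity) fun i hi => ?_
        have weight_ne := Finset.prod_ne_zero_iff.1 h i hi
        have left_le := primeProd_le_rpow_of_apply_ne_zero hR hS
          (right_ne_zero_of_mul (left_ne_zero_of_mul weight_ne))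
        have right_le := primeProd_le_rpow_of_apply_ne_zero hR hS
          (right_ne_zero_of_mul (right_ne_zero_of_mul weight_ne))
        gcongr
    _ = R ^ (2 * t * S) := by
        have R_pos : 0 < R := by linarith
        rw [Finset.prod_const, Finset.card_univ, Fintype.card_fin, ← Real.rpow_add R_pos,
          ← Real.rpow_natCast, ← Real.rpow_mul R_pos.le]
        ring_nf

end PairWeight

namespace AffineSystem

variable {d t : ℕ}

open Classical in
/-- The analogue of the indicator of `p ∣ ψ_i(n)` for a choice `b` of residues modulo each prime in
`P`; it is `0` for `p ∉ P`. -/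
noncomputable def residueInd (Ψ : AffineSystem d t) {P : Finset Nat.Primes}
    (b : ∀ q : P, Fin d → ZMod (q : Nat.Primes)) (i : Fin t) (p : Nat.Primes) : ℝ :=
  if h : p ∈ P then Ψ.zeroInd (ZMod p) i (b ⟨p, h⟩) else 0

/-- The mean, over all choices of residues modulo the primes in `P`, of the product of squared
sieve sums: this is the density which the correlation sum over a large box approximates. -/
noncomputable def sieveMean (Ψ : AffineSystem d t) (χ : ℝ → ℝ) (ℓ : ℝ) (P : Finset Nat.Primes) :
    ℝ :=
  𝔼 b : ∀ q : P, Fin d → ZMod (q : Nat.Primes), ∏ i, sieveSum χ ℓ P (Ψ.residueInd b i) ^ 2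

/-- `primeWeight` as a function of a residue vector modulo `p`. -/
noncomputable def residueWeight (Ψ : AffineSystem d t)
    (σ : Fin t → Finset Nat.Primes × Finset Nat.Primes) (p : Nat.Primes) (a : Fin d → ZMod p) : ℝ :=
  primeWeight σ p fun i => Ψ.zeroInd (ZMod p) i a

theorem residueInd_coe (Ψ : AffineSystem d t) {P : Finset Nat.Primes}
    (b : ∀ q : P, Fin d → ZMod (q : Nat.Primes)) (i : Fin t) (q : P) :
    Ψ.residueInd b i q = Ψ.zeroInd (ZMod (q : Nat.Primes)) i (b q) :=
  dif_pos q.2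

theorem expect_residues_prod {K : Type*} [Field K] [CharZero K] (P : Finset Nat.Primes)
    (f : ∀ p : Nat.Primes, (Fin d → ZMod p) → K) :
    𝔼 b : ∀ q : P, Fin d → ZMod (q : Nat.Primes), ∏ q : P, f q (b q) = ∏ p ∈ P, 𝔼 a, f p a := by
  classical
  rw [expect_pi_prod fun q : P => f q, Finset.prod_coe_sort P fun p => 𝔼 a, f p a]

theorem sieveMean_eq_sum (Ψ : AffineSystem d t) (χ : ℝ → ℝ) (ℓ : ℝ) (P : Finset Nat.Primes) :
    Ψ.sieveMean χ ℓ P = ∑ σ ∈ Fintype.piFinset fun _ : Fin t => P.powerset ×ˢ P.powerset,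
      (∏ i, pairWeight χ ℓ (σ i)) * ∏ p ∈ P, 𝔼 a, Ψ.residueWeight σ p a := by
  simp only [sieveMean, prod_sieveSum_sq]
  rw [Finset.expect_sum_comm]
  refine Finset.sum_congr rfl fun σ _ => ?_
  rw [← Finset.mul_expect, ← expect_residues_prod]
  simp only [← Finset.prod_coe_sort P, residueInd_coe, residueWeight]

theorem zeroInd_intCast (Ψ : AffineSystem d t) (p : Nat.Primes) (i : Fin t) (n : Fin d → ℤ) :
    Ψ.zeroInd (ZMod p) i (fun j => (n j : ZMod p)) =
      if ((p : ℕ) : ℤ) ∣ Ψ.form ℤ i n then 1 else 0 := by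
  have form_intCast : Ψ.form (ZMod p) i (fun j => (n j : ZMod p)) =
      ((Ψ.form ℤ i n : ℤ) : ZMod p) := by
    simp [form]
  simp only [zeroInd, form_intCast, ZMod.intCast_zmod_eq_zero_iff_dvd]

section BoxSum

variable (Ψ : AffineSystem d t) {χ : ℝ → ℝ} {S R Z : ℝ} {P : Finset Nat.Primes}

theorem abs_sum_prod_residueWeight_sub_le (hR : 1 < R)
    (hS : Function.support χ ⊆ Set.Icc (-S) S)
    {σ : Fin t → Finset Nat.Primes × Finset Nat.Primes}
    (hσ : σ ∈ Fintype.piFinset fun _ : Fin t => P.powerset ×ˢ P.powerset)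
    (hw : ∏ i, pairWeight χ (Real.log R) (σ i) ≠ 0) (hZ : R ^ (2 * t * S) ≤ Z) :
    |∑ n ∈ intBox d Z, ∏ p ∈ P, Ψ.residueWeight σ p (fun j => (n j : ZMod p)) -
        Z ^ d * ∏ p ∈ P, 𝔼 a, Ψ.residueWeight σ p a| ≤
      2 * d * 3 ^ d * Z ^ d * (R ^ (2 * t * S) / Z) := by
  have Z_pos : 0 < Z := lt_of_lt_of_le (by positivity) hZ
  have weight_eq_one (p : Nat.Primes) (hp : p ∉ primeSupport σ) (a : Fin d → ZMod p) :
      Ψ.residueWeight σ p a = 1 := primeWeight_eq_one_of_notMem_primeSupport hp _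
  have prod_eq (n : Fin d → ℤ) : ∏ p ∈ P, Ψ.residueWeight σ p (fun j => (n j : ZMod p)) =
      ∏ p ∈ primeSupport σ, Ψ.residueWeight σ p (fun j => (n j : ZMod p)) :=
    (Finset.prod_subset (primeSupport_subset hσ) fun p _ hp => weight_eq_one p hp _).symm
  have prod_expect_eq : ∏ p ∈ P, 𝔼 a, Ψ.residueWeight σ p a =
      ∏ p ∈ primeSupport σ, 𝔼 a, Ψ.residueWeight σ p a :=
    (Finset.prod_subset (primeSupport_subset hσ) fun p _ hp => by
      simp only [weight_eq_one p hp, Fintype.expect_const]).symm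
  have abs_weight_le (p : Nat.Primes) (a : Fin d → ZMod p) : |Ψ.residueWeight σ p a| ≤ 1 :=
    abs_primeWeight_le_one p fun i => by
      rw [abs_of_nonneg (Ψ.zeroInd_nonneg _ i a)]
      exact Ψ.zeroInd_le_one _ i a
  have prod_le := prod_primeSupport_le_rpow hR hS hw
  simp only [prod_eq, prod_expect_eq]
  exact (abs_sum_intBox_prod_primes_sub_le d (primeSupport σ) (Ψ.residueWeight σ) abs_weight_le
    (prod_le.trans hZ)).trans (by gcongr)

theorem sum_prod_truncatedDivisorSum_eq (hR : 1 < R) (hS : Function.support χ ⊆ Set.Icc (-S) S)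
    (hP : ∀ p : Nat.Primes, (p : ℝ) ≤ R ^ S → p ∈ P) :
    ∑ n ∈ intBox d Z, ∏ i, truncatedDivisorSum χ R (Ψ.form ℤ i n) = Real.log R ^ t *
      ∑ σ ∈ Fintype.piFinset fun _ : Fin t => P.powerset ×ˢ P.powerset,
        (∏ i, pairWeight χ (Real.log R) (σ i)) *
          ∑ n ∈ intBox d Z, ∏ p ∈ P, Ψ.residueWeight σ p (fun j => (n j : ZMod p)) := by
  classical
  simp only [truncatedDivisorSum_eq_sieveSum hR hS hP, Finset.prod_mul_distrib, Finset.prod_const,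
    Finset.card_univ, Fintype.card_fin, ← Finset.mul_sum, prod_sieveSum_sq]
  rw [Finset.sum_comm]
  simp only [← Finset.mul_sum, residueWeight, zeroInd_intCast]

theorem pow_mul_rpow_eq_rpow_four_mul (hR : 0 < R) (t : ℕ) (S : ℝ) :
    ((R ^ S) ^ 2) ^ t * R ^ (2 * t * S) = R ^ (4 * t * S) := by
  rw [← pow_mul, ← Real.rpow_natCast, ← Real.rpow_mul hR.le, ← Real.rpow_add hR]
  push_cast
  ring_nf

theorem abs_sum_prod_truncatedDivisorSum_sub_le {K : ℝ} (hR : 1 < R)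
    (hS : Function.support χ ⊆ Set.Icc (-S) S) (hK : ∀ x, |χ x| ≤ K)
    (hP : ∀ p : Nat.Primes, (p : ℝ) ≤ R ^ S → p ∈ P) (hZ : R ^ (2 * t * S) ≤ Z) :
    |∑ n ∈ intBox d Z, ∏ i, truncatedDivisorSum χ R (Ψ.form ℤ i n) -
        Z ^ d * (Real.log R ^ t * Ψ.sieveMean χ (Real.log R) P)| ≤
      Z ^ d * (K ^ (2 * t) * (2 * d * 3 ^ d) * Real.log R ^ t * R ^ (4 * t * S) / Z) := by
  have log_pos := Real.log_pos hR
  have Z_pos : 0 < Z := lt_of_lt_of_le (by positivity) hZ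
  set T := Fintype.piFinset fun _ : Fin t => P.powerset ×ˢ P.powerset
  set w := fun σ : Fin t → Finset Nat.Primes × Finset Nat.Primes =>
    ∏ i, pairWeight χ (Real.log R) (σ i)
  set boxSum := fun σ => ∑ n ∈ intBox d Z, ∏ p ∈ P, Ψ.residueWeight σ p (fun j => (n j : ZMod p))
  set mean := fun σ => ∏ p ∈ P, 𝔼 a, Ψ.residueWeight σ p a
  have sub_eq : ∑ n ∈ intBox d Z, ∏ i, truncatedDivisorSum χ R (Ψ.form ℤ i n) -
        Z ^ d * (Real.log R ^ t * Ψ.sieveMean χ (Real.log R) P) =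
      Real.log R ^ t * ∑ σ ∈ T, w σ * (boxSum σ - Z ^ d * mean σ) := by
    rw [sum_prod_truncatedDivisorSum_eq Ψ hR hS hP, sieveMean_eq_sum, mul_left_comm, ← mul_sub,
      Finset.mul_sum, ← Finset.sum_sub_distrib]
    simp only [mul_sub, mul_left_comm (Z ^ d), w, boxSum, mean, T]
  have abs_term_le (σ) (hσ : σ ∈ T) : |w σ * (boxSum σ - Z ^ d * mean σ)| ≤
      |w σ| * (2 * d * 3 ^ d * Z ^ d * (R ^ (2 * t * S) / Z)) := by
    rw [abs_mul]
    obtain hw | hw := eq_or_ne (w σ) 0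
    · rw [hw, abs_zero, zero_mul, zero_mul]
    · exact mul_le_mul_of_nonneg_left (Ψ.abs_sum_prod_residueWeight_sub_le hR hS hσ hw hZ)
        (abs_nonneg _)
  calc _ = Real.log R ^ t * |∑ σ ∈ T, w σ * (boxSum σ - Z ^ d * mean σ)| := by
        rw [sub_eq, abs_mul, abs_of_pos (by positivity)]
    _ ≤ Real.log R ^ t *
          ((∑ σ ∈ T, |w σ|) * (2 * d * 3 ^ d * Z ^ d * (R ^ (2 * t * S) / Z))) := by
        rw [Finset.sum_mul]
        gcongr
        exact (Finset.abs_sum_le_sum_abs _ _).trans (Finset.sum_le_sum abs_term_le)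
    _ ≤ Real.log R ^ t *
          (((K * R ^ S) ^ 2) ^ t * (2 * d * 3 ^ d * Z ^ d * (R ^ (2 * t * S) / Z))) := by
        gcongr
        exact sum_abs_prod_pairWeight_le hR hS hK P
    _ = _ := by
        rw [← pow_mul_rpow_eq_rpow_four_mul (zero_lt_one.trans hR), mul_pow, mul_pow, ← pow_mul K]
        ring

end BoxSum

end AffineSystem

/-! ### The residue mean as an integral of Euler products -/

section Evaluation

open MeasureTheory

/-- The arguments `(1 - 2πi w_j) / ℓ` at which the Euler products are evaluated. -/
noncomputable def scaledLine {ι : Type*} (ℓ : ℝ) (w : ι → ℝ) (j : ι) : ℂ := lineOne (w j) / ℓ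

theorem scaledLine_re_nonneg {ι : Type*} {ℓ : ℝ} (hℓ : 0 ≤ ℓ) (w : ι → ℝ) (j : ι) :
    0 ≤ (scaledLine ℓ w j).re := by
  rw [scaledLine, Complex.div_ofReal_re, lineOne_re]
  positivity

theorem exp_neg_lineOne_eq_prod (ℓ v : ℝ) (s : Finset Nat.Primes) :
    Complex.exp (-lineOne v * ((∑ p ∈ s, Real.log p) / ℓ : ℝ)) =
      ∏ p ∈ s, (p : ℂ) ^ (-(lineOne v / ℓ)) := by
  have cpow_eq (p : Nat.Primes) : (p : ℂ) ^ (-(lineOne v / ℓ)) =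
      Complex.exp ((Real.log p : ℂ) * (-(lineOne v / ℓ))) := by
    rw [Complex.cpow_def_of_ne_zero (by exact_mod_cast p.2.ne_zero), Complex.natCast_log]
  simp only [cpow_eq]
  rw [← Complex.exp_sum, ← Finset.sum_mul]
  push_cast
  ring_nf

/-- The integrand whose integral over `v` is `sieveSum χ ℓ P x`, for a Fourier density `φ` of `χ`:
the Fourier expansion of `χ` turns the sum over sets of primes into an Euler product. -/
noncomputable def sieveTransform (φ : ℝ → ℂ) (ℓ : ℝ) (P : Finset Nat.Primes) (x : Nat.Primes → ℝ)
    (v : ℝ) : ℂ :=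
  φ v * ∏ p ∈ P, (1 - (x p : ℂ) * (p : ℂ) ^ (-(lineOne v / ℓ)))

theorem sieveTransform_eq_sum (φ : ℝ → ℂ) (ℓ : ℝ) (P : Finset Nat.Primes) (x : Nat.Primes → ℝ)
    (v : ℝ) : sieveTransform φ ℓ P x v = ∑ s ∈ P.powerset, ((∏ p ∈ s, (-x p) : ℝ) : ℂ) *
      (φ v * Complex.exp (-lineOne v * ((∑ p ∈ s, Real.log p) / ℓ : ℝ))) := by
  simp only [sieveTransform, sub_eq_add_neg, Finset.prod_one_add, Finset.mul_sum]
  refine Finset.sum_congr rfl fun s _ => ?_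
  rw [exp_neg_lineOne_eq_prod]
  simp only [← neg_mul, Finset.prod_mul_distrib]
  push_cast
  ring

namespace IsFourierDensity

variable {φ : ℝ → ℂ} {χ : ℝ → ℝ} {t : ℕ}

theorem integrable_sieveTransform (h : IsFourierDensity φ χ) (ℓ : ℝ) (P : Finset Nat.Primes)
    (x : Nat.Primes → ℝ) : Integrable (sieveTransform φ ℓ P x) := by
  rw [funext (sieveTransform_eq_sum φ ℓ P x)]
  exact integrable_finsetSum _ fun s _ => (h.integrable_mul_exp _).const_mul _

theorem ofReal_sieveSum (h : IsFourierDensity φ χ) (ℓ : ℝ) (P : Finset Nat.Primes)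
    (x : Nat.Primes → ℝ) :
    (sieveSum χ ℓ P x : ℂ) = ∫ v, sieveTransform φ ℓ P x v := by
  simp only [sieveTransform_eq_sum]
  rw [integral_finsetSum _ fun s _ => (h.integrable_mul_exp _).const_mul _, sieveSum,
    Complex.ofReal_sum]
  refine Finset.sum_congr rfl fun s _ => ?_
  rw [integral_const_mul, ← h.eq_integral, Complex.ofReal_mul]

theorem integrable_prod_sieveTransform (h : IsFourierDensity φ χ) (ℓ : ℝ) (P : Finset Nat.Primes)
    (x : Fin t → Nat.Primes → ℝ) :
    Integrable fun v : Fin t → ℝ × ℝ =>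
      ∏ i, (sieveTransform φ ℓ P (x i) (v i).1 * sieveTransform φ ℓ P (x i) (v i).2) :=
  Integrable.fintype_prod (f := fun i (q : ℝ × ℝ) =>
    sieveTransform φ ℓ P (x i) q.1 * sieveTransform φ ℓ P (x i) q.2) fun i =>
      (h.integrable_sieveTransform ℓ P (x i)).mul_prod (h.integrable_sieveTransform ℓ P (x i))

theorem ofReal_prod_sieveSum_sq (h : IsFourierDensity φ χ) (ℓ : ℝ) (P : Finset Nat.Primes)
    (x : Fin t → Nat.Primes → ℝ) :
    ((∏ i, sieveSum χ ℓ P (x i) ^ 2 : ℝ) : ℂ) = ∫ v : Fin t → ℝ × ℝ,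
      ∏ i, (sieveTransform φ ℓ P (x i) (v i).1 * sieveTransform φ ℓ P (x i) (v i).2) := by
  rw [integral_fintype_prod_volume_eq_prod (f := fun i (q : ℝ × ℝ) =>
    sieveTransform φ ℓ P (x i) q.1 * sieveTransform φ ℓ P (x i) q.2), Complex.ofReal_prod]
  refine Finset.prod_congr rfl fun i _ => ?_
  rw [Measure.volume_eq_prod, integral_prod_mul, ← h.ofReal_sieveSum, Complex.ofReal_pow, sq]

end IsFourierDensity

namespace AffineSystem

variable {d t : ℕ}

theorem zeroInd_mul_self (Ψ : AffineSystem d t) (K : Type*) [CommRing K] (i : Fin t)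
    (a : Fin d → K) : Ψ.zeroInd K i a * Ψ.zeroInd K i a = Ψ.zeroInd K i a := by
  unfold zeroInd; split_ifs <;> norm_num

theorem one_sub_zeroInd_mul_one_sub_zeroInd (Ψ : AffineSystem d t) (K : Type*) [CommRing K]
    (i : Fin t) (a : Fin d → K) (u u' : ℂ) :
    (1 - (Ψ.zeroInd K i a : ℂ) * u) * (1 - (Ψ.zeroInd K i a : ℂ) * u') =
      1 - (Ψ.zeroInd K i a : ℂ) * (u + u' - u * u') := by
  have sq_eq : (Ψ.zeroInd K i a : ℂ) * Ψ.zeroInd K i a = Ψ.zeroInd K i a := by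
    rw [← Complex.ofReal_mul, zeroInd_mul_self]
  linear_combination u * u' * sq_eq

/-- The integrand whose integral over `v` is `Ψ.sieveMean χ ℓ P`, for a Fourier density `φ` of `χ`;
averaging over residues has turned the Euler product into one of local means. -/
noncomputable def sieveIntegrand (Ψ : AffineSystem d t) (φ : ℝ → ℂ) (ℓ : ℝ) (P : Finset Nat.Primes)
    (v : Fin t → ℝ × ℝ) : ℂ :=
  (∏ i, (φ (v i).1 * φ (v i).2)) * ∏ p ∈ P, Ψ.localMean p
    (primeTwist (scaledLine ℓ (Prod.fst ∘ v)) p + primeTwist (scaledLine ℓ (Prod.snd ∘ v)) p -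
      primeTwist (scaledLine ℓ (Prod.fst ∘ v)) p * primeTwist (scaledLine ℓ (Prod.snd ∘ v)) p)

theorem sieveIntegrand_eq_expect (Ψ : AffineSystem d t) (φ : ℝ → ℂ) (ℓ : ℝ)
    (P : Finset Nat.Primes) (v : Fin t → ℝ × ℝ) : Ψ.sieveIntegrand φ ℓ P v =
      𝔼 b : ∀ q : P, Fin d → ZMod (q : Nat.Primes),
        ∏ i, (sieveTransform φ ℓ P (Ψ.residueInd b i) (v i).1 *
          sieveTransform φ ℓ P (Ψ.residueInd b i) (v i).2) := by
  simp only [sieveIntegrand, localMean]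
  rw [← expect_residues_prod, Finset.mul_expect]
  refine Finset.expect_congr rfl fun b _ => ?_
  rw [Finset.prod_comm, ← Finset.prod_mul_distrib]
  refine Finset.prod_congr rfl fun i _ => ?_
  rw [sieveTransform, sieveTransform, mul_mul_mul_comm, ← Finset.prod_mul_distrib,
    ← Finset.prod_coe_sort P]
  simp only [residueInd_coe, one_sub_zeroInd_mul_one_sub_zeroInd]
  rfl

variable (Ψ : AffineSystem d t) {φ : ℝ → ℂ} {χ : ℝ → ℝ}

theorem integrable_sieveIntegrand (h : IsFourierDensity φ χ) (ℓ : ℝ) (P : Finset Nat.Primes) :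
    Integrable (Ψ.sieveIntegrand φ ℓ P) := by
  rw [funext (Ψ.sieveIntegrand_eq_expect φ ℓ P)]
  simp only [Fintype.expect_eq_sum_div_card]
  exact (integrable_finsetSum _ fun b _ => h.integrable_prod_sieveTransform ℓ P _).div_const _

theorem ofReal_sieveMean (h : IsFourierDensity φ χ) (ℓ : ℝ) (P : Finset Nat.Primes) :
    (Ψ.sieveMean χ ℓ P : ℂ) = ∫ v, Ψ.sieveIntegrand φ ℓ P v := by
  simp only [sieveIntegrand_eq_expect, sieveMean, Fintype.expect_eq_sum_div_card]
  rw [integral_div, integral_finsetSum _ fun b _ => h.integrable_prod_sieveTransform ℓ P _,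
    Complex.ofReal_div, Complex.ofReal_sum, Complex.ofReal_natCast]
  simp only [h.ofReal_prod_sieveSum_sq]

theorem pow_mul_sieveIntegrand_eq (φ : ℝ → ℂ) {ℓ : ℝ} (hℓ : 0 ≤ ℓ) (P : Finset Nat.Primes)
    (v : Fin t → ℝ × ℝ) :
    (ℓ : ℂ) ^ t * Ψ.sieveIntegrand φ ℓ P v = (∏ i, (φ (v i).1 * φ (v i).2)) *
      ((∏ i, (ℓ * ∏ p ∈ P, (eulerRatio (1 / p) (primeTwist (scaledLine ℓ (Prod.fst ∘ v)) p i)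
          (primeTwist (scaledLine ℓ (Prod.snd ∘ v)) p i))⁻¹)) *
        ∏ p ∈ P, Ψ.twistedFactor p (primeTwist (scaledLine ℓ (Prod.fst ∘ v)) p)
          (primeTwist (scaledLine ℓ (Prod.snd ∘ v)) p)) := by
  set u := primeTwist (scaledLine ℓ (Prod.fst ∘ v))
  set u' := primeTwist (scaledLine ℓ (Prod.snd ∘ v))
  have ratio_ne_zero (p : Nat.Primes) (i : Fin t) : eulerRatio (1 / p) (u p i) (u' p i) ≠ 0 :=
    eulerRatio_ne_zero (norm_one_div_prime_le p)
      (norm_primeTwist_le_one p (scaledLine_re_nonneg hℓ _ i))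
      (norm_primeTwist_le_one p (scaledLine_re_nonneg hℓ _ i))
  have localMean_eq (p : Nat.Primes) : Ψ.localMean p (u p + u' p - u p * u' p) =
      (∏ i, (eulerRatio (1 / p) (u p i) (u' p i))⁻¹) * Ψ.twistedFactor p (u p) (u' p) := by
    rw [twistedFactor, mul_left_comm, ← Finset.prod_mul_distrib, Finset.prod_eq_one, mul_one]
    exact fun i _ => inv_mul_cancel₀ (ratio_ne_zero p i)
  rw [sieveIntegrand, Finset.prod_congr rfl fun p _ => localMean_eq p,
    Finset.prod_mul_distrib (s := P), Finset.prod_mul_distrib (f := fun _ : Fin t => (ℓ : ℂ)),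
    Finset.prod_const, Finset.card_univ, Fintype.card_fin, Finset.prod_comm (s := P)]
  ring

end AffineSystem

end Evaluation

/-! ### The main term -/

section MainTerm

open MeasureTheory

theorem le_prod_of_one_le {ι : Type*} [Fintype ι] {m : ι → ℝ} (hm : ∀ i, 1 ≤ m i) (i : ι) :
    m i ≤ ∏ j, m j :=
  (Finset.prod_singleton m i).symm.trans_le <|
    Finset.prod_le_prod_of_subset_of_one_le (Finset.subset_univ {i})
      (fun j _ => zero_le_one.trans (hm j)) fun j _ _ => hm j

theorem norm_lineOne_mul_div_le (v w : ℝ) :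
    ‖lineOne v * lineOne w / (lineOne v + lineOne w)‖ ≤ ‖lineOne v‖ * ‖lineOne w‖ := by
  rw [norm_div, norm_mul]
  exact div_le_self (by positivity) (one_le_two.trans (two_le_norm_lineOne_add v w))

theorem one_le_norm_lineOne_mul (v w : ℝ) : 1 ≤ ‖lineOne v‖ * ‖lineOne w‖ :=
  one_le_mul_of_one_le_of_one_le (one_le_norm_lineOne _) (one_le_norm_lineOne _)

/-- The product over `i` of the norms of the points `lineOne (v i).1` and `lineOne (v i).2`. Its
powers are the weights, integrable against the Fourier density, in which the error terms of the
main term are measured. -/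
noncomputable def lineNorm {t : ℕ} (v : Fin t → ℝ × ℝ) : ℝ :=
  ∏ i, (‖lineOne (v i).1‖ * ‖lineOne (v i).2‖)

theorem norm_lineOne_mul_le_lineNorm {t : ℕ} (v : Fin t → ℝ × ℝ) (i : Fin t) :
    ‖lineOne (v i).1‖ * ‖lineOne (v i).2‖ ≤ lineNorm v :=
  le_prod_of_one_le (fun i => one_le_norm_lineOne_mul (v i).1 (v i).2) i

theorem one_le_lineNorm {t : ℕ} (v : Fin t → ℝ × ℝ) : 1 ≤ lineNorm v :=
  Finset.one_le_prod fun _ _ => one_le_norm_lineOne_mul _ _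

theorem sum_norm_scaledLine_mul_le {t : ℕ} (v : Fin t → ℝ × ℝ) {ℓ : ℝ} (hℓ : 1 ≤ ℓ) :
    ∑ i, ‖scaledLine ℓ (Prod.fst ∘ v) i‖ * ‖scaledLine ℓ (Prod.snd ∘ v) i‖ ≤
      t * lineNorm v / ℓ := by
  have ℓ_pos : 0 < ℓ := by linarith
  have term_le (i : Fin t) :
      ‖scaledLine ℓ (Prod.fst ∘ v) i‖ * ‖scaledLine ℓ (Prod.snd ∘ v) i‖ ≤ lineNorm v / ℓ := by
    calc ‖scaledLine ℓ (Prod.fst ∘ v) i‖ * ‖scaledLine ℓ (Prod.snd ∘ v) i‖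
        = ‖lineOne (v i).1‖ * ‖lineOne (v i).2‖ / ℓ / ℓ := by
          simp only [scaledLine, Function.comp_apply, norm_div, Complex.norm_of_nonneg ℓ_pos.le]
          ring
      _ ≤ ‖lineOne (v i).1‖ * ‖lineOne (v i).2‖ / ℓ := div_le_self (by positivity) hℓ
      _ ≤ lineNorm v / ℓ := by gcongr; exact norm_lineOne_mul_le_lineNorm v i
  refine (Finset.sum_le_card_nsmul _ _ _ fun i _ => term_le i).trans (le_of_eq ?_)
  rw [Finset.card_univ, Fintype.card_fin, nsmul_eq_mul, mul_div_assoc]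

theorem sqrt_le_self_of_one_le {x : ℝ} (hx : 1 ≤ x) : √x ≤ x :=
  Real.sqrt_le_iff.2 ⟨by linarith, by nlinarith⟩

theorem sqrt_add_self_le {s M ℓ : ℝ} (hM : 1 ≤ M) (hℓ : 1 ≤ ℓ) (hs : s ≤ M / ℓ) :
    √s + s ≤ 2 * M / √ℓ := by
  have : 0 < √ℓ := Real.sqrt_pos.2 (by linarith)
  calc √s + s ≤ √M / √ℓ + M / ℓ := by
        rw [← Real.sqrt_div (by positivity)]
        exact add_le_add (Real.sqrt_le_sqrt hs) hs
    _ ≤ M / √ℓ + M / √ℓ := by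
        gcongr
        · exact sqrt_le_self_of_one_le hM
        · exact sqrt_le_self_of_one_le hℓ
    _ = 2 * M / √ℓ := by ring

theorem norm_prod_sub_prod_le_of_approx {ι : Type*} [Fintype ι] {x y : ι → ℂ} {m : ι → ℝ}
    {C ε : ℝ} (hC : 0 ≤ C) (hε : 0 ≤ ε) (hε₁ : ε ≤ 1) (hm : ∀ i, 1 ≤ m i)
    (hy : ∀ i, ‖y i‖ ≤ m i) (hxy : ∀ i, ‖x i - y i‖ ≤ C * m i * ε) :
    ‖∏ i, x i - ∏ i, y i‖ ≤
      (C + 1) ^ Fintype.card ι * (Fintype.card ι * C) * (∏ i, m i) ^ 2 * ε := by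
  have m_nonneg (i : ι) : 0 ≤ m i := zero_le_one.trans (hm i)
  have m_le (i : ι) : m i ≤ (C + 1) * m i := le_mul_of_one_le_left (m_nonneg i) (by linarith)
  have norm_x_le (i : ι) : ‖x i‖ ≤ (C + 1) * m i := by
    calc ‖x i‖ = ‖(x i - y i) + y i‖ := by rw [sub_add_cancel]
      _ ≤ C * m i * ε + m i := norm_add_le_of_le (hxy i) (hy i)
      _ ≤ C * m i * 1 + m i := by have := m_nonneg i; gcongr
      _ = (C + 1) * m i := by ring
  have sum_le : ∑ i, ‖x i - y i‖ ≤ Fintype.card ι * (C * (∏ j, m j) * ε) := by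
    refine (Finset.sum_le_card_nsmul _ _ (C * (∏ j, m j) * ε) fun i _ => (hxy i).trans ?_).trans
      (by rw [Finset.card_univ, nsmul_eq_mul])
    have := le_prod_of_one_le hm i
    gcongr
  have prod_nonneg : 0 ≤ ∏ i, m i := Finset.prod_nonneg fun i _ => m_nonneg i
  calc ‖∏ i, x i - ∏ i, y i‖
      ≤ (∏ i, (C + 1) * m i) * ∑ i, ‖x i - y i‖ :=
        norm_prod_sub_prod_le Finset.univ (fun i _ => (hm i).trans (m_le i))
          (fun i _ => norm_x_le i) fun i _ => (hy i).trans (m_le i)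
    _ = (C + 1) ^ Fintype.card ι * (∏ i, m i) * ∑ i, ‖x i - y i‖ := by
        rw [Finset.prod_mul_distrib, Finset.prod_const, Finset.card_univ]
    _ ≤ (C + 1) ^ Fintype.card ι * (∏ i, m i) *
          (Fintype.card ι * (C * (∏ j, m j) * ε)) := by gcongr
    _ = _ := by ring

theorem exists_norm_prod_prod_inv_eulerRatio_sub_le (t : ℕ) : ∃ K ℓ₀ : ℝ, 0 ≤ K ∧ 1 ≤ ℓ₀ ∧
    ∀ ℓ : ℝ, ℓ₀ ≤ ℓ → ∃ P₀ : Finset Nat.Primes, ∀ P, P₀ ⊆ P → ∀ v : Fin t → ℝ × ℝ,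
      ‖∏ i, (ℓ * ∏ p ∈ P, (eulerRatio (1 / p) (primeTwist (scaledLine ℓ (Prod.fst ∘ v)) p i)
          (primeTwist (scaledLine ℓ (Prod.snd ∘ v)) p i))⁻¹) -
        ∏ i, (lineOne (v i).1 * lineOne (v i).2 / (lineOne (v i).1 + lineOne (v i).2))‖ ≤
      K * lineNorm v ^ 8 / ℓ := by
  obtain ⟨C, ℓ₀, hC, hℓ₀, approx⟩ := exists_prod_inv_eulerRatio_approx
  refine ⟨(C + 1) ^ t * (t * C), ℓ₀, by positivity, hℓ₀, fun ℓ hℓ => ?_⟩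
  obtain ⟨P₀, hP₀⟩ := approx ℓ hℓ
  refine ⟨P₀, fun P hP v => ?_⟩
  have one_le_ℓ : 1 ≤ ℓ := hℓ₀.trans hℓ
  set m : Fin t → ℝ := fun i => (‖lineOne (v i).1‖ * ‖lineOne (v i).2‖) ^ 4
  have prod_m : ∏ i, m i = lineNorm v ^ 4 := Finset.prod_pow _ _ _
  refine (norm_prod_sub_prod_le_of_approx (m := m) (C := C) (ε := ℓ⁻¹) (by linarith)
    (by positivity) (inv_le_one_of_one_le₀ one_le_ℓ)
    (fun i => one_le_pow₀ (one_le_norm_lineOne_mul _ _)) (fun i => ?_) fun i => ?_).trans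
      (le_of_eq ?_)
  · exact (norm_lineOne_mul_div_le _ _).trans
      (le_self_pow₀ (one_le_norm_lineOne_mul _ _) (by norm_num))
  · exact (hP₀ P hP (v i).1 (v i).2).trans_eq (div_eq_mul_inv _ _)
  · rw [prod_m, Fintype.card_fin]
    ring

namespace AffineSystem

theorem exists_norm_prod_twistedFactor_scaledLine_le (t : ℕ) (ht : 2 ≤ t) :
    ∃ C K : ℝ, 0 ≤ C ∧ 0 ≤ K ∧ ∀ (ℓ : ℝ) (P : Finset Nat.Primes) (d : ℕ) (Ψ : AffineSystem d t)
      (v : Fin t → ℝ × ℝ), 1 ≤ ℓ → Ψ.Admissible →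
      ‖∏ p ∈ P, Ψ.twistedFactor p (primeTwist (scaledLine ℓ (Prod.fst ∘ v)) p)
          (primeTwist (scaledLine ℓ (Prod.snd ∘ v)) p)‖ ≤
        Real.exp (C * (1 + Ψ.exceptionalSum)) ∧
      ‖∏ p ∈ P, Ψ.twistedFactor p (primeTwist (scaledLine ℓ (Prod.fst ∘ v)) p)
          (primeTwist (scaledLine ℓ (Prod.snd ∘ v)) p) - ∏ p ∈ P, (Ψ.localFactor p : ℂ)‖ ≤
        K * Real.exp (C * (1 + Ψ.exceptionalSum)) * lineNorm v / √ℓ := by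
  obtain ⟨C, hC, bound⟩ := exists_prod_twistedFactor_bound t ht
  refine ⟨C + 1, 2 * t * C, by linarith, by positivity, fun ℓ P d Ψ v hℓ hΨ => ?_⟩
  have re_nonneg := scaledLine_re_nonneg (ι := Fin t) (zero_le_one.trans hℓ)
  obtain ⟨prod_le, prod_sub_le⟩ := bound d Ψ P _ _ hΨ (re_nonneg (Prod.fst ∘ v))
    (re_nonneg (Prod.snd ∘ v))
  have one_le_t : (1 : ℝ) ≤ t := by exact_mod_cast one_le_two.trans ht
  have sqrt_add_le := sqrt_add_self_le
    (one_le_mul_of_one_le_of_one_le one_le_t (one_le_lineNorm v)) hℓ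
    (sum_norm_scaledLine_mul_le v hℓ)
  have X_nonneg := Ψ.exceptionalSum_nonneg
  set X := Ψ.exceptionalSum
  refine ⟨prod_le.trans (Real.exp_le_exp.2 (by gcongr; linarith)), prod_sub_le.trans ?_⟩
  have : 0 ≤ lineNorm v := zero_le_one.trans (one_le_lineNorm v)
  calc Real.exp (C * (1 + X)) * (C * (1 + X) * (√_ + _))
      ≤ Real.exp (C * (1 + X)) * (C * Real.exp (1 + X) * (2 * (t * lineNorm v) / √ℓ)) := by
        gcongr
        linarith [Real.add_one_le_exp (1 + X)]
    _ = 2 * t * C * (Real.exp (C * (1 + X)) * Real.exp (1 + X)) * lineNorm v / √ℓ := by ring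
    _ = 2 * t * C * Real.exp ((C + 1) * (1 + X)) * lineNorm v / √ℓ := by
        rw [← Real.exp_add, add_one_mul]

theorem exists_norm_prod_mul_prod_twistedFactor_sub_le (t : ℕ) (ht : 2 ≤ t) :
    ∃ C K ℓ₀ : ℝ, 0 ≤ C ∧ 0 ≤ K ∧ 1 ≤ ℓ₀ ∧ ∀ ℓ : ℝ, ℓ₀ ≤ ℓ → ∃ P₀ : Finset Nat.Primes,
      ∀ P, P₀ ⊆ P → ∀ (d : ℕ) (Ψ : AffineSystem d t) (v : Fin t → ℝ × ℝ), Ψ.Admissible →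
      ‖(∏ i, (ℓ * ∏ p ∈ P, (eulerRatio (1 / p) (primeTwist (scaledLine ℓ (Prod.fst ∘ v)) p i)
            (primeTwist (scaledLine ℓ (Prod.snd ∘ v)) p i))⁻¹)) *
          ∏ p ∈ P, Ψ.twistedFactor p (primeTwist (scaledLine ℓ (Prod.fst ∘ v)) p)
            (primeTwist (scaledLine ℓ (Prod.snd ∘ v)) p) -
        (∏ i, (lineOne (v i).1 * lineOne (v i).2 / (lineOne (v i).1 + lineOne (v i).2))) *
          ∏ p ∈ P, (Ψ.localFactor p : ℂ)‖ ≤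
      K * Real.exp (C * (1 + Ψ.exceptionalSum)) / √ℓ * lineNorm v ^ 8 := by
  obtain ⟨K₁, ℓ₀, hK₁, hℓ₀, ratio_approx⟩ := exists_norm_prod_prod_inv_eulerRatio_sub_le t
  obtain ⟨C, K₂, hC, hK₂, factor_bound⟩ := exists_norm_prod_twistedFactor_scaledLine_le t ht
  refine ⟨C, K₁ + K₂, ℓ₀, hC, by positivity, hℓ₀, fun ℓ hℓ => ?_⟩
  obtain ⟨P₀, hP₀⟩ := ratio_approx ℓ hℓ
  refine ⟨P₀, fun P hP d Ψ v hΨ => ?_⟩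
  have one_le_ℓ : 1 ≤ ℓ := hℓ₀.trans hℓ
  obtain ⟨factor_le, factor_sub_le⟩ := factor_bound ℓ P d Ψ v one_le_ℓ hΨ
  have limit_le := norm_prod_le_prod_of_le Finset.univ
    fun i _ => norm_lineOne_mul_div_le (v i).1 (v i).2
  have one_le_A := one_le_lineNorm v
  set A := lineNorm v
  set E := Real.exp (C * (1 + Ψ.exceptionalSum))
  have : 0 < √ℓ := Real.sqrt_pos.2 (by linarith)
  rw [← sub_add_sub_cancel, ← sub_mul, ← mul_sub]
  calc _ ≤ K₁ * A ^ 8 / ℓ * E + A * (K₂ * E * A / √ℓ) :=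
        norm_add_le_of_le (norm_mul_le_of_le (hP₀ P hP v) factor_le)
          (norm_mul_le_of_le limit_le factor_sub_le)
    _ = K₁ * A ^ 8 / ℓ * E + K₂ * E * A ^ 2 / √ℓ := by ring
    _ ≤ K₁ * A ^ 8 / √ℓ * E + K₂ * E * A ^ 8 / √ℓ := by
        gcongr
        · exact sqrt_le_self_of_one_le one_le_ℓ
        · norm_num
    _ = (K₁ + K₂) * E / √ℓ * A ^ 8 := by ring

end AffineSystem

namespace IsFourierDensity

variable {φ : ℝ → ℂ} {χ : ℝ → ℝ}

theorem integrable_prod_mul_lineNorm (h : IsFourierDensity φ χ) (t k : ℕ) :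
    Integrable fun v : Fin t → ℝ × ℝ =>
      (∏ i, (‖φ (v i).1‖ * ‖φ (v i).2‖)) * lineNorm v ^ k := by
  refine (Integrable.fintype_prod (ι := Fin t) (f := fun _ (q : ℝ × ℝ) =>
    (‖φ q.1‖ * ‖lineOne q.1‖ ^ k) * (‖φ q.2‖ * ‖lineOne q.2‖ ^ k)) fun _ =>
      (h.integrable k).mul_prod (h.integrable k)).congr (Filter.Eventually.of_forall fun v => ?_)
  simp only [lineNorm]
  rw [← Finset.prod_pow, ← Finset.prod_mul_distrib]
  exact Finset.prod_congr rfl fun i _ => by ring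

theorem integrable_prod_mul_div (h : IsFourierDensity φ χ) : Integrable fun q : ℝ × ℝ =>
    φ q.1 * φ q.2 * (lineOne q.1 * lineOne q.2 / (lineOne q.1 + lineOne q.2)) := by
  have φ_continuous := h.continuous
  have line_continuous := continuous_lineOne
  have add_ne_zero (q : ℝ × ℝ) : lineOne q.1 + lineOne q.2 ≠ 0 :=
    norm_pos_iff.1 (two_pos.trans_le (two_le_norm_lineOne_add _ _))
  have integrand_continuous : Continuous fun q : ℝ × ℝ =>
      φ q.1 * φ q.2 * (lineOne q.1 * lineOne q.2 / (lineOne q.1 + lineOne q.2)) :=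
    Continuous.mul (by fun_prop) (Continuous.div (by fun_prop) (by fun_prop) add_ne_zero)
  refine ((h.integrable 1).mul_prod (h.integrable 1)).mono'
    integrand_continuous.aestronglyMeasurable (Filter.Eventually.of_forall fun q => ?_)
  calc ‖φ q.1 * φ q.2 * (lineOne q.1 * lineOne q.2 / (lineOne q.1 + lineOne q.2))‖
      ≤ ‖φ q.1‖ * ‖φ q.2‖ * (‖lineOne q.1‖ * ‖lineOne q.2‖) :=
        norm_mul_le_of_le (norm_mul_le _ _) (norm_lineOne_mul_div_le _ _)
    _ = ‖φ q.1‖ * ‖lineOne q.1‖ ^ 1 * (‖φ q.2‖ * ‖lineOne q.2‖ ^ 1) := by ring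

end IsFourierDensity

namespace AffineSystem

variable {t : ℕ}

theorem exists_norm_sieveIntegrand_sub_le (ht : 2 ≤ t) (φ : ℝ → ℂ) :
    ∃ C K ℓ₀ : ℝ, 0 ≤ C ∧ 0 ≤ K ∧ 1 ≤ ℓ₀ ∧ ∀ ℓ : ℝ, ℓ₀ ≤ ℓ → ∃ P₀ : Finset Nat.Primes,
      ∀ P, P₀ ⊆ P → ∀ (d : ℕ) (Ψ : AffineSystem d t) (v : Fin t → ℝ × ℝ), Ψ.Admissible →
      ‖(ℓ : ℂ) ^ t * Ψ.sieveIntegrand φ ℓ P v -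
        (∏ i, φ (v i).1 * φ (v i).2 *
          (lineOne (v i).1 * lineOne (v i).2 / (lineOne (v i).1 + lineOne (v i).2))) *
          ∏ p ∈ P, (Ψ.localFactor p : ℂ)‖ ≤
      K * Real.exp (C * (1 + Ψ.exceptionalSum)) / √ℓ *
        ((∏ i, (‖φ (v i).1‖ * ‖φ (v i).2‖)) * lineNorm v ^ 8) := by
  obtain ⟨C, K, ℓ₀, hC, hK, hℓ₀, bound⟩ := exists_norm_prod_mul_prod_twistedFactor_sub_le t ht
  refine ⟨C, K, ℓ₀, hC, hK, hℓ₀, fun ℓ hℓ => ?_⟩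
  obtain ⟨P₀, hP₀⟩ := bound ℓ hℓ
  refine ⟨P₀, fun P hP d Ψ v hΨ => ?_⟩
  rw [Ψ.pow_mul_sieveIntegrand_eq φ (by linarith), Finset.prod_mul_distrib (f := fun i => φ _ * _),
    mul_assoc, ← mul_sub, norm_mul, norm_prod]
  simp only [norm_mul]
  rw [mul_left_comm]
  exact mul_le_mul_of_nonneg_left (hP₀ P hP d Ψ v hΨ)
    (Finset.prod_nonneg fun i _ => by positivity)

theorem exists_sieveMean_approx (ht : 2 ≤ t) {φ : ℝ → ℂ} {χ : ℝ → ℝ} (h : IsFourierDensity φ χ)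
    (hχ : Differentiable ℝ χ) : ∃ C K ℓ₀ : ℝ, 0 ≤ C ∧ 0 ≤ K ∧ 1 ≤ ℓ₀ ∧
    ∀ ℓ : ℝ, ℓ₀ ≤ ℓ → ∃ P₀ : Finset Nat.Primes, ∀ P, P₀ ⊆ P →
      ∀ (d : ℕ) (Ψ : AffineSystem d t), Ψ.Admissible →
      |ℓ ^ t * Ψ.sieveMean χ ℓ P -
        (∫ x in Set.Ioi (0 : ℝ), deriv χ x ^ 2) ^ t * ∏ p ∈ P, Ψ.localFactor p| ≤
      K * Real.exp (C * (1 + Ψ.exceptionalSum)) / √ℓ := by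
  obtain ⟨C, K, ℓ₀, hC, hK, hℓ₀, bound⟩ := exists_norm_sieveIntegrand_sub_le ht φ
  set W := fun v : Fin t → ℝ × ℝ => (∏ i, (‖φ (v i).1‖ * ‖φ (v i).2‖)) * lineNorm v ^ 8
  have W_integrable : Integrable W := h.integrable_prod_mul_lineNorm t 8
  have W_nonneg (v) : 0 ≤ W v := mul_nonneg (Finset.prod_nonneg fun i _ => by positivity)
    (pow_nonneg (zero_le_one.trans (one_le_lineNorm v)) _)
  refine ⟨C, K * ∫ v, W v, ℓ₀, hC, mul_nonneg hK (integral_nonneg W_nonneg), hℓ₀, fun ℓ hℓ => ?_⟩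
  obtain ⟨P₀, hP₀⟩ := bound ℓ hℓ
  refine ⟨P₀, fun P hP d Ψ hΨ => ?_⟩
  set F := fun q : ℝ × ℝ =>
    φ q.1 * φ q.2 * (lineOne q.1 * lineOne q.2 / (lineOne q.1 + lineOne q.2))
  have prod_integrable : Integrable fun v : Fin t → ℝ × ℝ => ∏ i, F (v i) :=
    Integrable.fintype_prod (f := fun _ => F) fun _ => h.integrable_prod_mul_div
  have integral_prod : ∫ v : Fin t → ℝ × ℝ, ∏ i, F (v i) =
      ((∫ x in Set.Ioi (0 : ℝ), deriv χ x ^ 2 : ℝ) : ℂ) ^ t := by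
    rw [integral_fintype_prod_volume_eq_pow, h.integral_prod_eq hχ, Fintype.card_fin]
  have diff_eq : ((ℓ ^ t * Ψ.sieveMean χ ℓ P -
        (∫ x in Set.Ioi (0 : ℝ), deriv χ x ^ 2) ^ t * ∏ p ∈ P, Ψ.localFactor p : ℝ) : ℂ) =
      ∫ v, ((ℓ : ℂ) ^ t * Ψ.sieveIntegrand φ ℓ P v -
        (∏ i, F (v i)) * ∏ p ∈ P, (Ψ.localFactor p : ℂ)) := by
    rw [integral_sub ((Ψ.integrable_sieveIntegrand h ℓ P).const_mul _)
      (prod_integrable.mul_const _), integral_const_mul, integral_mul_const, integral_prod,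
      ← Ψ.ofReal_sieveMean h]
    push_cast
    rfl
  rw [← Real.norm_eq_abs, ← Complex.norm_real, diff_eq]
  refine (norm_integral_le_of_norm_le (W_integrable.const_mul _)
    (Filter.Eventually.of_forall fun v => hP₀ P hP d Ψ v hΨ)).trans (le_of_eq ?_)
  rw [integral_const_mul]
  ring

end AffineSystem

end MainTerm

/-! ### The correlation estimate -/

section Correlation

open MeasureTheory Filter Topology

namespace AffineSystem

variable {d t : ℕ}

theorem exists_sieveMean_approx_tprod (ht : 2 ≤ t) {χ : ℝ → ℝ} (hχ : ContDiff ℝ ∞ χ)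
    (hsupp : HasCompactSupport χ) : ∃ C K ℓ₀ : ℝ, 0 ≤ C ∧ 0 ≤ K ∧ 1 ≤ ℓ₀ ∧
    ∀ (ℓ : ℝ) (Ψ : AffineSystem d t), ℓ₀ ≤ ℓ → Ψ.Admissible →
      ∀ᶠ P : Finset Nat.Primes in atTop,
        |ℓ ^ t * Ψ.sieveMean χ ℓ P -
          (∫ x in Set.Ioi (0 : ℝ), deriv χ x ^ 2) ^ t * ∏' p, Ψ.localFactor p| ≤
        K * Real.exp (C * (1 + Ψ.exceptionalSum)) / √ℓ := by
  obtain ⟨φ, hφ⟩ := exists_isFourierDensity hχ hsupp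
  obtain ⟨C, K, ℓ₀, hC, hK, hℓ₀, approx⟩ :=
    exists_sieveMean_approx ht hφ (hχ.differentiable (by simp))
  set c := ∫ x in Set.Ioi (0 : ℝ), deriv χ x ^ 2
  refine ⟨C, K + 1, ℓ₀, hC, by linarith, hℓ₀, fun ℓ Ψ hℓ hΨ => ?_⟩
  have sqrt_pos : 0 < √ℓ := Real.sqrt_pos.2 (by linarith)
  have one_le_exp : 1 ≤ Real.exp (C * (1 + Ψ.exceptionalSum)) :=
    Real.one_le_exp (mul_nonneg hC (by linarith [Ψ.exceptionalSum_nonneg]))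
  have prod_near : ∀ᶠ P : Finset Nat.Primes in atTop,
      |c ^ t * ∏ p ∈ P, Ψ.localFactor p - c ^ t * ∏' p, Ψ.localFactor p| < 1 / √ℓ :=
    Metric.tendsto_nhds.1 ((tendsto_prod_localFactor ht hΨ).const_mul (c ^ t)) _ (by positivity)
  obtain ⟨P₀, hP₀⟩ := approx ℓ hℓ
  filter_upwards [prod_near, eventually_ge_atTop P₀] with P near hP
  calc |ℓ ^ t * Ψ.sieveMean χ ℓ P - c ^ t * ∏' p, Ψ.localFactor p|
      ≤ K * Real.exp (C * (1 + Ψ.exceptionalSum)) / √ℓ + 1 / √ℓ :=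
        (abs_sub_le _ _ _).trans (add_le_add (hP₀ P hP d Ψ hΨ) near.le)
    _ ≤ K * Real.exp (C * (1 + Ψ.exceptionalSum)) / √ℓ +
          Real.exp (C * (1 + Ψ.exceptionalSum)) / √ℓ := by gcongr
    _ = (K + 1) * Real.exp (C * (1 + Ψ.exceptionalSum)) / √ℓ := by ring

theorem exists_abs_sum_prod_truncatedDivisorSum_sub_le (ht : 2 ≤ t) {χ : ℝ → ℝ}
    (hχ : ContDiff ℝ ∞ χ) {S : ℝ} (hsupp : Function.support χ ⊆ Set.Icc (-S) S) :
    ∃ C K ℓ₀ : ℝ, 0 ≤ C ∧ 0 ≤ K ∧ ∀ (R Z : ℝ) (Ψ : AffineSystem d t), 1 < R →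
      ℓ₀ ≤ Real.log R → R ^ (2 * t * S) ≤ Z → Ψ.Admissible →
      |∑ n ∈ intBox d Z, ∏ i, truncatedDivisorSum χ R (Ψ.form ℤ i n) -
        Z ^ d * (∫ x in Set.Ioi (0 : ℝ), deriv χ x ^ 2) ^ t * ∏' p, Ψ.localFactor p| ≤
      Z ^ d * (K * Real.log R ^ t * R ^ (4 * t * S) / Z +
        K * Real.exp (C * (1 + Ψ.exceptionalSum)) / √(Real.log R)) := by
  have compact_support := HasCompactSupport.of_support_subset_isCompact isCompact_Icc hsupp
  obtain ⟨M, hM⟩ := compact_support.exists_bound_of_continuous hχ.continuous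
  have : 0 ≤ M := (norm_nonneg _).trans (hM 0)
  obtain ⟨C, K, ℓ₀, hC, hK, -, approx⟩ :=
    exists_sieveMean_approx_tprod (d := d) ht hχ compact_support
  set c := ∫ x in Set.Ioi (0 : ℝ), deriv χ x ^ 2
  set D : ℝ := M ^ (2 * t) * (2 * d * 3 ^ d)
  refine ⟨C, max D K, ℓ₀, hC, le_max_of_le_right hK, fun R Z Ψ hR hℓ hZ hΨ => ?_⟩
  have R_pos : 0 < R := by linarith
  have Z_pos : 0 < Z := (Real.rpow_pos_of_pos R_pos _).trans_le hZ
  have log_pos : 0 < Real.log R := Real.log_pos hR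
  obtain ⟨P, mean_approx, hP⟩ := ((approx (Real.log R) Ψ hℓ hΨ).and
    (eventually_ge_atTop ((Finset.Iic ⌊R ^ S⌋₊).subtype Nat.Prime))).exists
  have box_approx := Ψ.abs_sum_prod_truncatedDivisorSum_sub_le hR hsupp hM (P := P) (fun p hp =>
    hP (Finset.mem_subtype.2 (Finset.mem_Iic.2 (Nat.le_floor hp)))) hZ
  set T := ∑ n ∈ intBox d Z, ∏ i, truncatedDivisorSum χ R (Ψ.form ℤ i n)
  set G := Real.log R ^ t * Ψ.sieveMean χ (Real.log R) P
  calc |T - Z ^ d * c ^ t * ∏' p, Ψ.localFactor p|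
      ≤ |T - Z ^ d * G| + |Z ^ d * G - Z ^ d * c ^ t * ∏' p, Ψ.localFactor p| := abs_sub_le _ _ _
    _ = |T - Z ^ d * G| + Z ^ d * |G - c ^ t * ∏' p, Ψ.localFactor p| := by
        rw [mul_assoc, ← mul_sub, abs_mul, abs_of_pos (pow_pos Z_pos d)]
    _ ≤ Z ^ d * (D * Real.log R ^ t * R ^ (4 * t * S) / Z) +
          Z ^ d * (K * Real.exp (C * (1 + Ψ.exceptionalSum)) / √(Real.log R)) := by
        gcongr
    _ ≤ Z ^ d * (max D K * Real.log R ^ t * R ^ (4 * t * S) / Z) +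
          Z ^ d * (max D K * Real.exp (C * (1 + Ψ.exceptionalSum)) / √(Real.log R)) := by
        gcongr
        · exact le_max_left _ _
        · exact le_max_right _ _
    _ = _ := by ring

end AffineSystem

end Correlation

/-! ### Uniformity in the system -/

section ErrorTerms

open Filter Topology

theorem tendsto_exp_mul_sqrt_log_div_sqrt (a : ℝ) :
    Tendsto (fun x : ℝ => Real.exp (a * √(Real.log x)) / √x) atTop (𝓝 0) := by
  have exponent_tendsto : Tendsto (fun y : ℝ => y * (y / 2 - a)) atTop atTop :=
    tendsto_id.atTop_mul_atTop₀
      (tendsto_atTop_add_const_right _ (-a) (tendsto_id.atTop_div_const two_pos))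
  refine ((Real.tendsto_exp_neg_atTop_nhds_zero.comp exponent_tendsto).comp
    (Real.tendsto_sqrt_atTop.comp Real.tendsto_log_atTop)).congr' ?_
  filter_upwards [eventually_ge_atTop 1] with x hx
  have sqrt_eq : √x = Real.exp (√(Real.log x) ^ 2 / 2) := by
    rw [Real.sq_sqrt (Real.log_nonneg hx), Real.exp_half, Real.exp_log (by linarith)]
  simp only [Function.comp_apply]
  rw [sqrt_eq, ← Real.exp_sub]
  ring_nf

theorem tendsto_log_pow_mul_rpow_neg (t : ℕ) {r : ℝ} (hr : 0 < r) :
    Tendsto (fun N : ℝ => Real.log N ^ t * N ^ (-r)) atTop (𝓝 0) := by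
  refine (isLittleO_log_rpow_rpow_atTop (t : ℝ) hr).tendsto_div_nhds_zero.congr' ?_
  filter_upwards [eventually_gt_atTop 0] with N hN
  rw [Real.rpow_neg hN.le, Real.rpow_natCast, div_eq_mul_inv]

theorem eventually_log_rpow_le_rpow (A : ℝ) {δ : ℝ} (hδ : 0 < δ) :
    ∀ᶠ N : ℝ in atTop, Real.log N ^ A ≤ N ^ δ := by
  filter_upwards [(isLittleO_log_rpow_rpow_atTop A hδ).bound one_pos, eventually_gt_atTop 0]
    with N hN N_pos
  rw [one_mul, Real.norm_of_nonneg (Real.rpow_nonneg N_pos.le δ)] at hN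
  exact (Real.le_norm_self _).trans hN

theorem eventually_rpow_le_and_le_rpow (A : ℝ) {δ : ℝ} (hδ : 0 < δ) :
    ∀ᶠ N : ℝ in atTop, ∀ Z : ℝ, N / Real.log N ^ A ≤ Z → Z ≤ N * Real.log N ^ A →
      N ^ (1 - δ) ≤ Z ∧ Z ≤ N ^ (1 + δ) := by
  filter_upwards [eventually_log_rpow_le_rpow A hδ, eventually_gt_atTop 1]
    with N log_le hN Z hZ hZ'
  have N_pos : 0 < N := by linarith
  have : 0 < Real.log N ^ A := Real.rpow_pos_of_pos (Real.log_pos hN) _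
  constructor
  · calc N ^ (1 - δ) = N / N ^ δ := by rw [Real.rpow_sub N_pos, Real.rpow_one]
      _ ≤ N / Real.log N ^ A := by gcongr
      _ ≤ Z := hZ
  · calc Z ≤ N * Real.log N ^ A := hZ'
      _ ≤ N * N ^ δ := by gcongr
      _ = N ^ (1 + δ) := by rw [Real.rpow_add N_pos, Real.rpow_one]

theorem eventually_log_pow_mul_rpow_div_le (t : ℕ) {K γ s b η : ℝ} (hK : 0 ≤ K) (hγ : 0 ≤ γ)
    (hb : γ * s < b) (hη : 0 < η) : ∀ᶠ N : ℝ in atTop, ∀ Z : ℝ, N ^ b ≤ Z →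
      K * Real.log (N ^ γ) ^ t * (N ^ γ) ^ s / Z ≤ η := by
  have bound_tendsto :=
    (tendsto_log_pow_mul_rpow_neg t (sub_pos.2 hb)).const_mul (K * γ ^ t)
  rw [mul_zero] at bound_tendsto
  filter_upwards [bound_tendsto.eventually_le_const hη, eventually_gt_atTop 1] with N hN N_gt Z hZ
  have N_pos : 0 < N := by linarith
  have := Real.log_pos N_gt
  calc K * Real.log (N ^ γ) ^ t * (N ^ γ) ^ s / Z
      ≤ K * Real.log (N ^ γ) ^ t * (N ^ γ) ^ s / N ^ b := by
        rw [Real.log_rpow N_pos]; gcongr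
    _ = K * γ ^ t * (Real.log N ^ t * N ^ (-(b - γ * s))) := by
        rw [Real.log_rpow N_pos, ← Real.rpow_mul N_pos.le, neg_sub, Real.rpow_sub N_pos]
        ring
    _ ≤ η := hN

theorem eventually_exp_mul_sqrt_log_log_le {K C C' γ κ η : ℝ} (hK : 0 ≤ K) (hC : 0 ≤ C)
    (hC' : 0 ≤ C') (hγ : 0 < γ) (hκ : 0 < κ) (hη : 0 < η) :
    ∀ᶠ N : ℝ in atTop, ∀ Z X : ℝ, 1 < Z → Z ≤ N ^ κ → X ≤ C' * √(Real.log (Real.log Z)) →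
      K * Real.exp (C * (1 + X)) / √(Real.log (N ^ γ)) ≤ η := by
  have bound_tendsto := ((tendsto_exp_mul_sqrt_log_div_sqrt (C * C')).comp
    (Real.tendsto_log_atTop.const_mul_atTop hκ)).const_mul (K * Real.exp C / √(γ / κ))
  rw [mul_zero] at bound_tendsto
  filter_upwards [bound_tendsto.eventually_le_const hη, eventually_gt_atTop 0]
    with N hN N_pos Z X hZ hZN hX
  have log_Z_le : Real.log Z ≤ κ * Real.log N := by
    rw [← Real.log_rpow N_pos]
    exact Real.log_le_log (by linarith) hZN
  have X_le : X ≤ C' * √(Real.log (κ * Real.log N)) := hX.trans (by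
    gcongr
    exact Real.log_pos hZ)
  have sqrt_eq : √(Real.log (N ^ γ)) = √(γ / κ) * √(κ * Real.log N) := by
    rw [Real.log_rpow N_pos, ← Real.sqrt_mul (by positivity)]
    field_simp
  calc K * Real.exp (C * (1 + X)) / √(Real.log (N ^ γ))
      ≤ K * Real.exp (C * (1 + C' * √(Real.log (κ * Real.log N)))) / √(Real.log (N ^ γ)) := by
        gcongr
    _ = K * Real.exp C / √(γ / κ) *
          (Real.exp (C * C' * √(Real.log (κ * Real.log N))) / √(κ * Real.log N)) := by
        rw [sqrt_eq, div_mul_div_comm, mul_assoc K, ← Real.exp_add]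
        ring_nf
    _ ≤ η := hN

end ErrorTerms

section Uniformity

open Filter

variable {d t : ℕ}

namespace AffineSystem

theorem exists_le_tprod_localFactor (d : ℕ) (ht : 2 ≤ t) : ∃ b : ℝ, 0 < b ∧
    ∀ Ψ : AffineSystem d t, Ψ.Admissible → b ≤ ∏' p, Ψ.localFactor p := by
  obtain ⟨b, hb, b_le⟩ := exists_prod_localFactor_ge d t
  exact ⟨b, hb, fun Ψ hΨ =>
    ge_of_tendsto' (tendsto_prod_localFactor ht hΨ) fun P => b_le Ψ P hΨ.2⟩

theorem tprod_localFactor_pos {Ψ : AffineSystem d t} (ht : 2 ≤ t) (hΨ : Ψ.Admissible) :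
    0 < ∏' p, Ψ.localFactor p := by
  obtain ⟨b, hb, b_le⟩ := exists_le_tprod_localFactor d ht
  exact hb.trans_le (b_le Ψ hΨ)

theorem eventually_abs_sum_prod_truncatedDivisorSum_sub_le (ht : 2 ≤ t) {χ : ℝ → ℝ}
    (hχ : ContDiff ℝ ∞ χ) {S γ A B L η : ℝ} (hsupp : Function.support χ ⊆ Set.Icc (-S) S)
    (hS : 0 < S) (hγ : 0 < γ) (hγS : γ * (8 * t * S) < 1) (hB : 0 < B) (hL : 0 < L) (hη : 0 < η) :
    ∀ᶠ N : ℝ in atTop, ∀ Z : ℝ, N / Real.log N ^ A ≤ Z → Z ≤ N * Real.log N ^ A →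
      ∀ Ψ : AffineSystem d t, Ψ.Admissible → Ψ.size Z B ≤ L →
      |∑ n ∈ intBox d Z, ∏ i, truncatedDivisorSum χ (N ^ γ) (Ψ.form ℤ i n) -
          Z ^ d * (∫ x in Set.Ioi (0 : ℝ), deriv χ x ^ 2) ^ t * ∏' p, Ψ.localFactor p| ≤
        η * Z ^ d := by
  obtain ⟨C, K, ℓ₀, hC, hK, estimate⟩ :=
    exists_abs_sum_prod_truncatedDivisorSum_sub_le (d := d) ht hχ hsupp
  obtain ⟨C', Z₀, hC', exceptional_le⟩ := exists_exceptionalSum_le_mul_sqrt_log_log d t hB hL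
  filter_upwards [eventually_rpow_le_and_le_rpow A (by norm_num : (0 : ℝ) < 1 / 4),
    eventually_log_pow_mul_rpow_div_le t (s := 4 * t * S) (b := 1 - 1 / 4) hK hγ.le (by linarith)
      (half_pos hη),
    eventually_exp_mul_sqrt_log_log_le (κ := 1 + 1 / 4) hK hC hC' hγ (by norm_num) (half_pos hη),
    (tendsto_rpow_atTop hγ).eventually_gt_atTop 1,
    (Real.tendsto_log_atTop.comp (tendsto_rpow_atTop hγ)).eventually_ge_atTop ℓ₀,
    (tendsto_rpow_atTop (by norm_num : (0 : ℝ) < 1 - 1 / 4)).eventually_ge_atTop Z₀,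
    eventually_gt_atTop 1]
    with N Z_bounds box_error_le local_error_le R_gt ℓ₀_le Z₀_le N_gt Z hZ hZ' Ψ hΨ size_le
  obtain ⟨le_Z, Z_le⟩ := Z_bounds Z hZ hZ'
  have Z_gt : 1 < Z := (Real.one_lt_rpow N_gt (by norm_num)).trans_le le_Z
  have level_le : (N ^ γ) ^ (2 * t * S) ≤ Z := by
    rw [← Real.rpow_mul (by linarith)]
    have : 0 ≤ γ * (t * S) := by positivity
    exact (Real.rpow_le_rpow_of_exponent_le N_gt.le (by linarith)).trans le_Z
  calc _ ≤ Z ^ d * (K * Real.log (N ^ γ) ^ t * (N ^ γ) ^ (4 * t * S) / Z +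
          K * Real.exp (C * (1 + Ψ.exceptionalSum)) / √(Real.log (N ^ γ))) :=
        estimate (N ^ γ) Z Ψ R_gt ℓ₀_le level_le hΨ
    _ ≤ Z ^ d * (η / 2 + η / 2) :=
        mul_le_mul_of_nonneg_left (add_le_add (box_error_le Z le_Z) (local_error_le Z _ Z_gt Z_le
          (exceptional_le Z (Z₀_le.trans le_Z) Ψ hΨ.1 size_le))) (by positivity)
    _ = η * Z ^ d := by ring

theorem exists_forall_abs_correlation_sub_le_mul (d : ℕ) (ht : 2 ≤ t) {χ : ℝ → ℝ}
    (hχ : ContDiff ℝ ∞ χ) {S γ B L ε : ℝ} (hsupp : Function.support χ ⊆ Set.Icc (-S) S)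
    (hχ₀ : χ 0 ≠ 0) (hS : 0 < S) (hγ : 0 < γ) (hγS : γ * (8 * t * S) < 1) (A : ℝ) (hB : 0 < B)
    (hL : 0 < L) (hε : 0 < ε) :
    ∃ N₀ : ℝ, ∀ N Z : ℝ, N₀ ≤ N → N / Real.log N ^ A ≤ Z → Z ≤ N * Real.log N ^ A →
      ∀ Ψ : AffineSystem d t, Ψ.Admissible → Ψ.size Z B ≤ L →
      |∑ n ∈ intBox d Z, ∏ i, truncatedDivisorSum χ (N ^ γ) (Ψ.form ℤ i n) -
          Z ^ d * (∫ x in Set.Ioi (0 : ℝ), deriv χ x ^ 2) ^ t * ∏' p, Ψ.localFactor p| ≤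
        ε * (Z ^ d * (∫ x in Set.Ioi (0 : ℝ), deriv χ x ^ 2) ^ t * ∏' p, Ψ.localFactor p) := by
  have c_pos := integral_deriv_sq_pos (hχ.of_le (by simp))
    (HasCompactSupport.of_support_subset_isCompact isCompact_Icc hsupp) hχ₀
  set c := ∫ x in Set.Ioi (0 : ℝ), deriv χ x ^ 2
  obtain ⟨b, hb, b_le⟩ := exists_le_tprod_localFactor d ht
  obtain ⟨N₀, hN₀⟩ := eventually_atTop.1 ((eventually_ge_atTop 1).and
    (eventually_abs_sum_prod_truncatedDivisorSum_sub_le (d := d) (A := A) ht hχ hsupp hS hγ hγS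
      hB hL (by positivity : 0 < ε * (c ^ t * b))))
  refine ⟨N₀, fun N Z hN hZ hZ' Ψ hΨ size_le => ?_⟩
  obtain ⟨one_le_N, estimate⟩ := hN₀ N hN
  have Z_nonneg : 0 ≤ Z := le_trans (div_nonneg (by linarith)
    (Real.rpow_nonneg (Real.log_nonneg one_le_N) A)) hZ
  calc _ ≤ ε * (c ^ t * b) * Z ^ d := estimate Z hZ hZ' Ψ hΨ size_le
    _ = ε * (Z ^ d * c ^ t * b) := by ring
    _ ≤ _ := by gcongr; exact b_le Ψ hΨ

end AffineSystem

end Uniformity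

theorem mainTheorem4 (d t : ℕ) (hd : 2 ≤ d) (ht : 2 ≤ t) :
    -- the exceptional primes: `∑_{p ∈ P_Ψ} p^{-1/2} = O(√(log log Z))`
    (∀ B L : ℝ, 0 < B → 0 < L → ∃ C Z₀ : ℝ, ∀ Z : ℝ, Z₀ ≤ Z →
      ∀ Ψ : AffineSystem d t, Ψ.Admissible → Ψ.size Z B ≤ L →
        Ψ.exceptionalPrimes.Finite ∧
        ∑' p : Ψ.exceptionalPrimes, (((p : ℕ) : ℝ)) ^ (-(1 / 2) : ℝ) ≤
          C * Real.sqrt (Real.log (Real.log Z))) ∧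
    -- the correlation estimate, for `R = N ^ γ` a small power of `N`
    (∀ S : ℝ, 0 < S → ∃ γ₀ : ℝ, 0 < γ₀ ∧ ∀ γ : ℝ, 0 < γ → γ < γ₀ →
      ∀ χ : ℝ → ℝ, ContDiff ℝ ∞ χ → Function.support χ ⊆ Set.Icc (-S) S → χ 0 = 1 →
      ∀ A B L : ℝ, 0 < A → 0 < B → 0 < L →
      ∀ ε : ℝ, 0 < ε → ∃ N₀ : ℝ, ∀ N Z : ℝ, N₀ ≤ N →
        N / Real.log N ^ A ≤ Z → Z ≤ N * Real.log N ^ A →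
      ∀ Ψ : AffineSystem d t, Ψ.Admissible → Ψ.size Z B ≤ L →
        Multipliable Ψ.localFactor ∧
        0 < ∏' p, Ψ.localFactor p ∧
        |∑ n ∈ intBox d Z, ∏ i, truncatedDivisorSum χ (N ^ γ) (Ψ.form ℤ i n) -
            Z ^ d * (∫ x in Set.Ioi (0 : ℝ), deriv χ x ^ 2) ^ t * ∏' p, Ψ.localFactor p| ≤
          ε * (Z ^ d * (∫ x in Set.Ioi (0 : ℝ), deriv χ x ^ 2) ^ t *
            ∏' p, Ψ.localFactor p)) := by
  refine ⟨fun B L hB hL => ?_, fun S hS => ?_⟩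
  · obtain ⟨C, Z₀, -, exceptional_le⟩ :=
      AffineSystem.exists_exceptionalSum_le_mul_sqrt_log_log d t hB hL
    exact ⟨C, Z₀, fun Z hZ Ψ hΨ size_le =>
      ⟨hΨ.1.finite_exceptionalPrimes, exceptional_le Z hZ Ψ hΨ.1 size_le⟩⟩
  · have : (0 : ℝ) < t := by exact_mod_cast two_pos.trans_le ht
    refine ⟨1 / (8 * t * S), by positivity,
      fun γ hγ hγ₀ χ hχ hsupp hχ₀ A B L _ hB hL ε hε => ?_⟩
    obtain ⟨N₀, estimate⟩ := AffineSystem.exists_forall_abs_correlation_sub_le_mul d ht hχ hsupp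
      (by rw [hχ₀]; exact one_ne_zero) hS hγ ((lt_div_iff₀ (by positivity)).1 hγ₀) A hB hL hε
    exact ⟨N₀, fun N Z hN hZ hZ' Ψ hΨ size_le =>
      ⟨AffineSystem.multipliable_localFactor ht hΨ, AffineSystem.tprod_localFactor_pos ht hΨ,
        estimate N Z hN hZ hZ' Ψ hΨ size_le⟩⟩
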